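/- Let $n\ge 2$, $1\le k<n$ and $\sigma\in\mathfrak S_n$, written $\sigma=\sigma_1\cdots\sigma_n$, with $\sigma\mu=\sigma\circ\mu$, so that $\sigma\,(a,b)$ exchanges the entries of $\sigma$ in positions $a$ and $b$. Let $s_i=(i,i+1)$, let $\ell$ be the length (the minimal number of factors in a decomposition into $s_i$'s), let $\omega=n\,(n-1)\cdots 1$, and let $\le$ be the Bruhat order, i.e. the reflexive transitive closure of the relations $\sigma<\sigma\tau$ with $\tau$ a transposition and $\ell(\sigma\tau)=\ell(\sigma)+1$. On $L=\mathbb Z[x_1^{\pm1},\dots,x_n^{\pm1},y_1^{\pm1},\dots,y_n^{\pm1}]$ consider, for $1\le i<n$, the operators (acting on the right) $$f\pi_i=\frac{x_if-x_{i+1}\,(f s_i)}{x_i-x_{i+1}},\qquad f\hat\pi_i=\frac{x_{i+1}(f-f s_i)}{x_i-x_{i+1}},$$ where $f s_i$ is $f$ with $x_i$ and $x_{i+1}$ exchanged; for a reduced decomposition $\mu=s_{i_1}\cdots s_{i_m}$ put $\pi_\mu=\pi_{i_1}\cdots\pi_{i_m}$ and $\hat\pi_\mu=\hat\pi_{i_1}\cdots\hat\pi_{i_m}$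 (these do not depend on the decomposition). The double Grothendieck polynomials are $$G_\omega=\prod_{\substack{i,j\ge1\\ i+j\le n}}\Bigl(1-\frac{y_j}{x_i}\Bigr),\qquad G_\mu=G_\omega\,\pi_{\omega\mu}\quad(\mu\in\mathfrak S_n).$$ Let $I\subset L$ be the ideal generated by all $f(x_1,\dots,x_n)-f(y_1,\dots,y_n)$ with $f$ a symmetric polynomial over $\mathbb Z$. A $k$-Bruhat transposition of $\sigma$ is a transposition $(a,b)$ with $a\le k<b$ and $\ell(\sigma\,(a,b))=\ell(\sigma)+1$. Let $W_{\sigma,k}=(\tau_1,\dots,\tau_m)$ be the list of all of them, in increasing order for $$(a,b)\prec(a',b')\iff \sigma(a)>\sigma(a')\ \text{ or }\ \bigl(a=a'\text{ and }\sigma(b)<\sigma(b')\bigr),$$ and let $\eta=\eta(\sigma,k)=\sigma\tau_1\tau_2\cdots\tau_m$. Then the coset $\sigma(\mathfrak S_k\times\mathfrak S_{n-k})$ has a greatest element $\zeta$ for the Bruhat order, $\sigma\le\eta$, and $$G_\sigma\,\frac{y_{\sigma_1}\cdots y_{\sigma_k}}{x_1\cdots x_k}\equiv G_\omega\,\hat\pi_{\omega\zeta}\,\pi_{\zeta^{-1}\sigma}\pmod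 I,\qquad G_\omega\,\hat\pi_{\omega\zeta}\,\pi_{\zeta^{-1}\sigma}=\sum_{\sigma\le\mu\le\eta}(-1)^{\ell(\mu)-\ell(\sigma)}G_\mu ,$$ the second being an equality in $L$. -/

import Mathlib

open scoped BigOperators

namespace GrothPieri

/-! ### The symmetric group: words, length, Bruhat order

`S_n` is `Equiv.Perm (Fin n)`; positions and values are numbered from `0`, and the product is
composition, so that `σ * swap a b` exchanges the entries of `σ` in positions `a` and `b`. -/

/-- The simple transposition exchanging the consecutive positions `i` and `i + 1`. -/
def simple {n : ℕ} (i : Fin (n - 1)) : Equiv.Perm (Fin n) :=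
  Equiv.swap ⟨i.val, by omega⟩ ⟨i.val + 1, by omega⟩

/-- The product `s_{i₁} ⋯ s_{iₘ}` of a word in the simple transpositions. -/
def wordProd {n : ℕ} (w : List (Fin (n - 1))) : Equiv.Perm (Fin n) :=
  (w.map simple).prod

/-- The length `ℓ(σ)`: the least size of a word in the simple transpositions with product `σ`. -/
noncomputable def len {n : ℕ} (σ : Equiv.Perm (Fin n)) : ℕ :=
  sInf {m | ∃ w : List (Fin (n - 1)), wordProd w = σ ∧ w.length = m}

theorem exists_word {n : ℕ} (σ : Equiv.Perm (Fin n)) :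
    ∃ w : List (Fin (n - 1)), wordProd w = σ := by
  cases n with
  | zero => exact ⟨[], Subsingleton.elim _ _⟩
  | succ m =>
    have h : σ ∈ Submonoid.closure
        (Set.range fun i : Fin m => Equiv.swap i.castSucc i.succ) := by
      rw [Equiv.Perm.mclosure_swap_castSucc_succ]; trivial
    induction h using Submonoid.closure_induction with
    | mem x hx =>
      obtain ⟨i, rfl⟩ := hx
      exact ⟨[i], by simp [wordProd, simple]; rfl⟩
    | one => exact ⟨[], rfl⟩
    | mul x y _ _ hx hy =>
      obtain ⟨u, rfl⟩ := hx
      obtain ⟨v, rfl⟩ := hy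
      exact ⟨u ++ v, by simp [wordProd]⟩

/-- `w` is a reduced decomposition of `σ`. -/
def IsReducedWord {n : ℕ} (w : List (Fin (n - 1))) (σ : Equiv.Perm (Fin n)) : Prop :=
  wordProd w = σ ∧ w.length = len σ

theorem exists_reducedWord {n : ℕ} (σ : Equiv.Perm (Fin n)) :
    ∃ w : List (Fin (n - 1)), IsReducedWord w σ := by
  obtain ⟨w, hw⟩ := exists_word σ
  exact Nat.sInf_mem (s := {m | ∃ w : List (Fin (n - 1)), wordProd w = σ ∧ w.length = m})
    ⟨_, w, hw, rfl⟩

/-- A reduced decomposition of `σ`, chosen once and for all. -/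
noncomputable def reducedWord {n : ℕ} (σ : Equiv.Perm (Fin n)) : List (Fin (n - 1)) :=
  Classical.choose (exists_reducedWord σ)

/-- `(a, b)` is a Bruhat transposition for `σ`: `a < b` and `σ (a, b)` covers `σ`. -/
def IsBruhatTransposition {n : ℕ} (σ : Equiv.Perm (Fin n)) (a b : Fin n) : Prop :=
  a < b ∧ len (σ * Equiv.swap a b) = len σ + 1

/-- The Bruhat order: the reflexive transitive closure of the covering relation. -/
def BruhatLE {n : ℕ} : Equiv.Perm (Fin n) → Equiv.Perm (Fin n) → Prop :=
  Relation.ReflTransGen fun σ μ =>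
    ∃ a b : Fin n, IsBruhatTransposition σ a b ∧ μ = σ * Equiv.swap a b

open Classical in
/-- The Bruhat interval `[σ, η]`, the set of all `μ` with `σ ≤ μ ≤ η`. -/
noncomputable def bruhatInterval {n : ℕ} (σ η : Equiv.Perm (Fin n)) :
    Finset (Equiv.Perm (Fin n)) :=
  Finset.univ.filter fun μ => BruhatLE σ μ ∧ BruhatLE μ η

/-- The maximal permutation `n, n - 1, …, 1`. -/
def omega (n : ℕ) : Equiv.Perm (Fin n) := Fin.revPerm

/-- The subgroup `S_k × S_{n-k}` of `S_n`: the permutations that preserve the set of the first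
`k` positions. -/
def youngSubgroup (n k : ℕ) : Subgroup (Equiv.Perm (Fin n)) where
  carrier := {τ | ∀ i, (τ i).val < k ↔ i.val < k}
  mul_mem' {a b} ha hb i := by
    rw [Equiv.Perm.mul_apply]
    exact (ha (b i)).trans (hb i)
  one_mem' i := Iff.rfl
  inv_mem' {a} ha i := by
    have h := ha (a⁻¹ i)
    have e : a (a⁻¹ i) = i := a.apply_symm_apply i
    rw [e] at h
    exact h.symm

/-- `ζ` is the maximal element, for the Bruhat order, of the coset `σ (S_k × S_{n-k})`. -/
def IsCosetMax {n : ℕ} (k : ℕ) (σ ζ : Equiv.Perm (Fin n)) : Prop :=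
  (∃ τ ∈ youngSubgroup n k, ζ = σ * τ) ∧ ∀ τ ∈ youngSubgroup n k, BruhatLE (σ * τ) ζ

/-! ### The list `W_{σ,k}` and the permutation `η(σ,k)` -/

/-- `(a, b)` is a `k`-Bruhat transposition for `σ`. With positions numbered from `1` the condition
on the positions reads `a ≤ k < b`. -/
def IsKBruhatTransposition {n : ℕ} (k : ℕ) (σ : Equiv.Perm (Fin n)) (p : Fin n × Fin n) : Prop :=
  p.1.val < k ∧ k ≤ p.2.val ∧ IsBruhatTransposition σ p.1 p.2

/-- The total order on the `k`-Bruhat transpositions of `σ`. -/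
def transpositionLT {n : ℕ} (σ : Equiv.Perm (Fin n)) (p q : Fin n × Fin n) : Prop :=
  σ q.1 < σ p.1 ∨ (p.1 = q.1 ∧ σ p.2 < σ q.2)

/-- All pairs of positions `(a, b)`, by decreasing `σ a`, then by increasing `σ b`. -/
def allPairs {n : ℕ} (σ : Equiv.Perm (Fin n)) : List (Fin n × Fin n) :=
  (List.finRange n).reverse.flatMap fun v =>
    (List.finRange n).map fun u => (σ.symm v, σ.symm u)

open Classical in
/-- The list `W_{σ,k}` of the `k`-Bruhat transpositions of `σ`, in increasing order. -/
noncomputable def W {n : ℕ} (k : ℕ) (σ : Equiv.Perm (Fin n)) : List (Fin n × Fin n) :=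
  (allPairs σ).filter fun p => decide (IsKBruhatTransposition k σ p)

theorem mem_W {n : ℕ} (k : ℕ) (σ : Equiv.Perm (Fin n)) (p : Fin n × Fin n) :
    p ∈ W k σ ↔ IsKBruhatTransposition k σ p := by
  have h : p ∈ allPairs σ := by
    simp only [allPairs, List.mem_flatMap, List.mem_map]
    exact ⟨σ p.1, by simp, σ p.2, by simp, by simp⟩
  simp [W, h]

theorem W_sorted {n : ℕ} (k : ℕ) (σ : Equiv.Perm (Fin n)) :
    (W k σ).Pairwise (transpositionLT σ) := by
  refine List.Pairwise.filter _ ?_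
  rw [allPairs, List.pairwise_flatMap]
  constructor
  · intro v _
    rw [List.pairwise_map]
    exact (List.pairwise_lt_finRange n).imp fun h => Or.inr ⟨rfl, by simpa using h⟩
  · rw [List.pairwise_reverse]
    refine (List.pairwise_lt_finRange n).imp fun h => ?_
    simp only [List.mem_map]
    rintro _ ⟨u, _, rfl⟩ _ ⟨u', _, rfl⟩
    exact Or.inl (by simpa using h)

/-- `η(σ,k) = σ W_{σ,k} = σ τ₁ τ₂ ⋯ τₘ`, where `W_{σ,k} = (τ₁, …, τₘ)`. -/
noncomputable def eta {n : ℕ} (k : ℕ) (σ : Equiv.Perm (Fin n)) : Equiv.Perm (Fin n) :=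
  σ * ((W k σ).map fun p => Equiv.swap p.1 p.2).prod

/-! ### Laurent polynomials in `x₁, …, xₙ, y₁, …, yₙ` and divided differences -/

/-- Rational functions in the variables `xᵢ` (left summand) and `yⱼ` (right summand). -/
abbrev RatFun (n : ℕ) : Type := FractionRing (MvPolynomial (Fin n ⊕ Fin n) ℤ)

noncomputable def ratX {n : ℕ} (i : Fin n) : RatFun n :=
  algebraMap (MvPolynomial (Fin n ⊕ Fin n) ℤ) (RatFun n) (MvPolynomial.X (Sum.inl i))

noncomputable def ratY {n : ℕ} (i : Fin n) : RatFun n :=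
  algebraMap (MvPolynomial (Fin n ⊕ Fin n) ℤ) (RatFun n) (MvPolynomial.X (Sum.inr i))

/-- The ring `ℤ[x₁^±¹, …, xₙ^±¹, y₁^±¹, …, yₙ^±¹]`. -/
noncomputable def Laurent (n : ℕ) : Subalgebra ℤ (RatFun n) :=
  Algebra.adjoin ℤ (Set.range ratX ∪ Set.range (fun i => (ratX i)⁻¹) ∪
    Set.range ratY ∪ Set.range (fun i => (ratY i)⁻¹))

theorem ratX_mem {n : ℕ} (i : Fin n) : ratX i ∈ Laurent n :=
  Algebra.subset_adjoin (Or.inl (Or.inl (Or.inl ⟨i, rfl⟩)))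

theorem ratX_inv_mem {n : ℕ} (i : Fin n) : (ratX i)⁻¹ ∈ Laurent n :=
  Algebra.subset_adjoin (Or.inl (Or.inl (Or.inr ⟨i, rfl⟩)))

theorem ratY_mem {n : ℕ} (i : Fin n) : ratY i ∈ Laurent n :=
  Algebra.subset_adjoin (Or.inl (Or.inr ⟨i, rfl⟩))

theorem ratY_inv_mem {n : ℕ} (i : Fin n) : (ratY i)⁻¹ ∈ Laurent n :=
  Algebra.subset_adjoin (Or.inr ⟨i, rfl⟩)

/-- The variable `xᵢ`. -/
noncomputable def x {n : ℕ} (i : Fin n) : Laurent n := ⟨ratX i, ratX_mem i⟩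

/-- The inverse `1 / xᵢ`. -/
noncomputable def xInv {n : ℕ} (i : Fin n) : Laurent n := ⟨(ratX i)⁻¹, ratX_inv_mem i⟩

/-- The variable `yᵢ`. -/
noncomputable def y {n : ℕ} (i : Fin n) : Laurent n := ⟨ratY i, ratY_mem i⟩

/-- The action of a permutation on the variables `xᵢ`, the `yⱼ` being fixed. -/
noncomputable def permX {n : ℕ} (τ : Equiv.Perm (Fin n)) : RatFun n ≃+* RatFun n :=
  IsFractionRing.ringEquivOfRingEquiv
    (MvPolynomial.renameEquiv ℤ (Equiv.sumCongr τ (Equiv.refl (Fin n)))).toRingEquiv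

theorem permX_ratX {n : ℕ} (τ : Equiv.Perm (Fin n)) (i : Fin n) :
    permX τ (ratX i) = ratX (τ i) := by
  simp [permX, ratX]

theorem permX_ratY {n : ℕ} (τ : Equiv.Perm (Fin n)) (i : Fin n) :
    permX τ (ratY i) = ratY i := by
  simp [permX, ratY]

theorem ratX_ne_zero {n : ℕ} (i : Fin n) : ratX i ≠ 0 := by
  rw [ratX, Ne, FaithfulSMul.algebraMap_eq_zero_iff]
  exact MvPolynomial.X_ne_zero _

theorem ratX_injective {n : ℕ} : Function.Injective (ratX (n := n)) := by
  intro i j h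
  exact Sum.inl_injective (MvPolynomial.X_injective (IsFractionRing.injective _ _ h))

/-- The divided difference `∂ᵢ` on rational functions, `f ↦ (f - f sᵢ) / (xᵢ - xᵢ₊₁)`. -/
noncomputable def ratDiv {n : ℕ} (i : Fin (n - 1)) (f : RatFun n) : RatFun n :=
  (f - permX (simple i) f) / (ratX ⟨i.val, by omega⟩ - ratX ⟨i.val + 1, by omega⟩)

theorem permX_mem {n : ℕ} (τ : Equiv.Perm (Fin n)) {f : RatFun n} (hf : f ∈ Laurent n) :
    permX τ f ∈ Laurent n := by
  induction hf using Algebra.adjoin_induction with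
  | mem f hf =>
    rcases hf with ((⟨j, rfl⟩ | ⟨j, rfl⟩) | ⟨j, rfl⟩) | ⟨j, rfl⟩
    · rw [permX_ratX]; exact ratX_mem _
    · simp only [map_inv₀, permX_ratX]; exact ratX_inv_mem _
    · rw [permX_ratY]; exact ratY_mem _
    · simp only [map_inv₀, permX_ratY]; exact ratY_inv_mem _
  | algebraMap r => simp
  | add f g _ _ hf hg => rw [map_add]; exact add_mem hf hg
  | mul f g _ _ hf hg => rw [map_mul]; exact mul_mem hf hg

theorem ratDiv_mem {n : ℕ} (i : Fin (n - 1)) {f : RatFun n} (hf : f ∈ Laurent n) :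
    ratDiv i f ∈ Laurent n := by
  have hne : ratX (n := n) ⟨i.val, by omega⟩ - ratX ⟨i.val + 1, by omega⟩ ≠ 0 := by
    rw [sub_ne_zero]
    intro h
    have := congrArg Fin.val (ratX_injective h)
    simp at this
  have hX : ∀ j : Fin n, ratDiv i (ratX j) ∈ Laurent n := by
    intro j
    rw [ratDiv, permX_ratX]
    by_cases h1 : j = ⟨i.val, by omega⟩
    · subst h1
      rw [simple, Equiv.swap_apply_left, div_self hne]
      exact one_mem _
    by_cases h2 : j = ⟨i.val + 1, by omega⟩
    · subst h2
      rw [simple, Equiv.swap_apply_right, ← neg_sub, neg_div, div_self hne]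
      exact neg_mem (one_mem _)
    · rw [simple, Equiv.swap_apply_of_ne_of_ne h1 h2]
      simp
  induction hf using Algebra.adjoin_induction with
  | mem f hf =>
    rcases hf with ((⟨j, rfl⟩ | ⟨j, rfl⟩) | ⟨j, rfl⟩) | ⟨j, rfl⟩
    · exact hX j
    · have h : ratDiv i (ratX j)⁻¹ =
          -(ratDiv i (ratX j) * (ratX j)⁻¹ * (ratX (simple i j))⁻¹) := by
        have h1 := ratX_ne_zero j
        have h2 := ratX_ne_zero (simple i j)
        simp only [ratDiv, map_inv₀, permX_ratX]
        field_simp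
        ring
      simp only [h]
      exact neg_mem (mul_mem (mul_mem (hX j) (ratX_inv_mem _)) (ratX_inv_mem _))
    · simp [ratDiv, permX_ratY]
    · simp [ratDiv, permX_ratY]
  | algebraMap r => simp [ratDiv]
  | add f g _ _ hf hg =>
    have h : ratDiv i (f + g) = ratDiv i f + ratDiv i g := by
      simp only [ratDiv, map_add]; ring
    rw [h]; exact add_mem hf hg
  | mul f g hf' hg' hf hg =>
    have h : ratDiv i (f * g) = ratDiv i f * g + permX (simple i) f * ratDiv i g := by
      simp only [ratDiv, map_mul]; ring
    rw [h]; exact add_mem (mul_mem hf hg') (mul_mem (permX_mem _ hf') hg)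

/-- The divided difference `∂ᵢ` on Laurent polynomials. -/
noncomputable def divDiff {n : ℕ} (i : Fin (n - 1)) (f : Laurent n) : Laurent n :=
  ⟨ratDiv i f, ratDiv_mem i f.2⟩

/-- The isobaric divided difference `f πᵢ = (xᵢ f - xᵢ₊₁ (f sᵢ)) / (xᵢ - xᵢ₊₁) = (xᵢ f) ∂ᵢ`. -/
noncomputable def piOp {n : ℕ} (i : Fin (n - 1)) (f : Laurent n) : Laurent n :=
  divDiff i (x ⟨i.val, by omega⟩ * f)

/-- The isobaric divided difference `f π̂ᵢ = xᵢ₊₁ (f - f sᵢ) / (xᵢ - xᵢ₊₁) = xᵢ₊₁ (f ∂ᵢ)`. -/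
noncomputable def hatPiOp {n : ℕ} (i : Fin (n - 1)) (f : Laurent n) : Laurent n :=
  x ⟨i.val + 1, by omega⟩ * divDiff i f

/-- `f π_σ = f π_{i₁} ⋯ π_{iₘ}` for a reduced decomposition `s_{i₁} ⋯ s_{iₘ}` of `σ`. The operators
act on the right, so that `π_{i₁}` is applied first. As the `πᵢ` satisfy the braid relations, the
result does not depend on the reduced decomposition. -/
noncomputable def piPerm {n : ℕ} (σ : Equiv.Perm (Fin n)) (f : Laurent n) : Laurent n :=
  (reducedWord σ).foldl (fun g i => piOp i g) f

/-- `f π̂_σ = f π̂_{i₁} ⋯ π̂_{iₘ}` for a reduced decomposition `s_{i₁} ⋯ s_{iₘ}` of `σ`. -/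
noncomputable def hatPiPerm {n : ℕ} (σ : Equiv.Perm (Fin n)) (f : Laurent n) : Laurent n :=
  (reducedWord σ).foldl (fun g i => hatPiOp i g) f

/-! ### Grothendieck polynomials -/

/-- The dominant double Grothendieck polynomial `G_ω = ∏_{i + j ≤ n} (1 - yⱼ / xᵢ)` (with indices
from `1`; from `0`, the condition reads `i + j + 1 < n`). -/
noncomputable def grothOmega (n : ℕ) : Laurent n :=
  ∏ i : Fin n, ∏ j : Fin n, if i.val + j.val + 1 < n then 1 - y j * xInv i else 1

/-- The double Grothendieck polynomial `G_σ`, reached from `G_ω` by `G_{μ sᵢ} = G_μ πᵢ` whenever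
`μ(i) > μ(i+1)`; that is `G_σ = G_ω π_{ωσ}`. -/
noncomputable def groth {n : ℕ} (σ : Equiv.Perm (Fin n)) : Laurent n :=
  piPerm (omega n * σ) (grothOmega n)

/-- The ideal that identifies each symmetric function of the `xᵢ` with the same symmetric function
of the `yᵢ`. -/
noncomputable def symIdeal (n : ℕ) : Ideal (Laurent n) :=
  Ideal.span {h | ∃ f : MvPolynomial (Fin n) ℤ, f.IsSymmetric ∧
    h = MvPolynomial.aeval (x (n := n)) f - MvPolynomial.aeval (y (n := n)) f}

end GrothPieri

open GrothPieri

/-! The expansion. On Grothendieck polynomials πᵢ sends G_μ to G_{μsᵢ} at a descent of μ and fixes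
G_μ at an ascent, and π̂ᵢ = πᵢ - 1. So if a set of permutations is closed under going up by sᵢ,
applying πᵢ to its alternating sum cancels everything but the ascents ν outside the set with νsᵢ
inside it (`piOp_signedSum`). With the lifting property of the Bruhat order, this makes G_ω π̂_{ωζ}
the alternating sum over all μ ≥ ζ (`hatPiPerm_grothOmega`).

The greatest element ζ of the coset decreases on both blocks of positions, and a reduced word of
ζ⁻¹σ leads from ζ to σ by removing descents inside the blocks. The support of the sum is followed
through entrywise bounds (`InPieri`): an entry of the first block may rise, but stays below the
larger entries of σ to its right in that block; dually, an entry of the second block may fall, but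
stays above the smaller ones to its left. For ζ these bounds say exactly μ ≥ ζ, and each πᵢ used
carries the sum for σ to the sum for σsᵢ (`piOp_signedSum_inPieri`).

There remains to see that the bounds for σ describe the interval [σ, η] (`mem_bruhatInterval_eta`).
Bruhat order is comparison of rank functions (`bruhatLE_iff`). The bounds are encoded by rank
equalities, so they define an order ideal above σ. That η is its greatest element is proved by
freeing the entries of the first block one at a time, from the largest down (`InPieri.max_step`).

The congruence. Modulo I the polynomials ∏(X - xᵢ) and ∏(X - yᵢ) coincide, whence G_ω y_{ω(a)}/x_a ≡
G_ω: this is the case of ω. Divided differences in y commute with those in x and agree with them on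
G_ω up to reversal of indices, so they realize left multiplication by sⱼ and bring the congruence
from ω down to every ζ decreasing on both blocks (`BlockDecreasing.mk_groth_mul`). The monomial is
invariant under sᵢ for i ≠ k, so π_{ζ⁻¹σ} then carries the congruence to σ
(`BlockDecreasing.mk_piPerm`). -/

open scoped BigOperators

namespace GrothPieri

open Equiv

variable {n : ℕ}

/-! ### Inversions and length -/

/-- The inversions of `w`: pairs of positions `i < j` with `w j < w i`. -/
def inversions (w : Perm (Fin n)) : Finset (Fin n × Fin n) :=
  Finset.univ.filter fun p => p.1 < p.2 ∧ w p.2 < w p.1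

theorem mem_inversions {w : Perm (Fin n)} {p : Fin n × Fin n} :
    p ∈ inversions w ↔ p.1 < p.2 ∧ w p.2 < w p.1 := by
  simp [inversions]

/-- For c strictly between a and b, the pairs (a, c) and (c, b) keep their status because `w c`
avoids the values between `w a` and `w b`. Every other pair except (a, b) is carried along by the
swap of positions, and (a, b) itself is the one new inversion. -/
theorem card_inversions_mul_swap {w : Perm (Fin n)} {a b : Fin n} (hab : a < b)
    (hw : w a < w b) (hc : ∀ c, a < c → c < b → w c < w a ∨ w b < w c) :
    (inversions (w * swap a b)).card = (inversions w).card + 1 := by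
  have hm : (a, b) ∈ inversions (w * swap a b) := by
    simp [mem_inversions, hab, hw]
  rw [← Finset.card_erase_add_one hm]
  congr 1
  have hinj : ∀ i j, w i = w j → i = j := fun i j h => w.injective h
  let f : Fin n × Fin n → Fin n × Fin n := fun p =>
    if (p.1 = a ∧ a < p.2 ∧ p.2 < b) ∨ (p.2 = b ∧ a < p.1 ∧ p.1 < b) then p
    else (swap a b p.1, swap a b p.2)
  have hf : ∀ i j : Fin n, i < j → ¬ (i = a ∧ j = b) → f (f (i, j)) = (i, j) := by
    intro i j hij hne
    by_cases hC : (i = a ∧ a < j ∧ j < b) ∨ (j = b ∧ a < i ∧ i < b)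
    · simp only [f, if_pos hC]
    · have hC' : ¬ ((swap a b i = a ∧ a < swap a b j ∧ swap a b j < b) ∨
          (swap a b j = b ∧ a < swap a b i ∧ swap a b i < b)) := by
        simp only [swap_apply_def]
        split_ifs <;> grind
      simp only [f, if_neg hC, if_neg hC', swap_apply_self]
  refine Finset.card_nbij' f f ?_ ?_ ?_ ?_
  · rintro ⟨i, j⟩ h
    simp only [Finset.coe_erase, Set.mem_sdiff, Finset.mem_coe, mem_inversions, Perm.mul_apply,
      Set.mem_singleton_iff, swap_apply_def, f] at h ⊢
    have hi' := hc i
    have hj' := hc j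
    have := hinj i a; have := hinj i b; have := hinj j a; have := hinj j b
    clear hc hm hinj hf f
    split_ifs at h ⊢ <;> grind
  · rintro ⟨i, j⟩ h
    simp only [Finset.coe_erase, Set.mem_sdiff, Finset.mem_coe, mem_inversions, Perm.mul_apply,
      Set.mem_singleton_iff, swap_apply_def, f] at h ⊢
    have hi' := hc i
    have hj' := hc j
    have := hinj i a; have := hinj i b; have := hinj j a; have := hinj j b
    clear hc hm hinj hf f
    split_ifs at h ⊢ <;> grind
  · rintro ⟨i, j⟩ h
    simp only [Finset.coe_erase, Set.mem_sdiff, Finset.mem_coe, mem_inversions,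
      Set.mem_singleton_iff, Prod.mk.injEq] at h
    exact hf i j h.1.1 h.2
  · rintro ⟨i, j⟩ h
    simp only [Finset.mem_coe, mem_inversions] at h
    refine hf i j h.1 fun e => ?_
    rw [e.1, e.2] at h
    exact lt_asymm hw h.2

/-- The left position exchanged by `simple i`. -/
def lo (i : Fin (n - 1)) : Fin n := ⟨i.val, by omega⟩

/-- The right position exchanged by `simple i`. -/
def hi (i : Fin (n - 1)) : Fin n := ⟨i.val + 1, by omega⟩

@[simp] theorem lo_val (i : Fin (n - 1)) : (lo i).val = i.val := rfl

@[simp] theorem hi_val (i : Fin (n - 1)) : (hi i).val = i.val + 1 := rfl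

theorem lo_lt_hi (i : Fin (n - 1)) : lo i < hi i := by simp [Fin.lt_def]

theorem lo_ne_hi (i : Fin (n - 1)) : lo i ≠ hi i := (lo_lt_hi i).ne

theorem simple_eq (i : Fin (n - 1)) : simple i = swap (lo i) (hi i) := rfl

@[simp] theorem simple_lo (i : Fin (n - 1)) : simple i (lo i) = hi i := swap_apply_left _ _

@[simp] theorem simple_hi (i : Fin (n - 1)) : simple i (hi i) = lo i := swap_apply_right _ _

@[simp] theorem simple_mul_self (i : Fin (n - 1)) : simple i * simple i = 1 := swap_mul_self _ _

@[simp] theorem mul_simple_mul_simple (w : Perm (Fin n)) (i : Fin (n - 1)) :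
    w * simple i * simple i = w := by
  rw [mul_assoc, simple_mul_self, mul_one]

theorem card_inversions_mul_simple {w : Perm (Fin n)} {i : Fin (n - 1)}
    (h : w (lo i) < w (hi i)) :
    (inversions (w * simple i)).card = (inversions w).card + 1 := by
  refine card_inversions_mul_swap (lo_lt_hi i) h fun c h1 h2 => ?_
  rw [Fin.lt_def] at h1 h2
  simp at h1 h2
  omega

theorem lo_lt_or_hi_lt (w : Perm (Fin n)) (i : Fin (n - 1)) :
    w (lo i) < w (hi i) ∨ w (hi i) < w (lo i) :=
  lt_or_gt_of_ne fun h => lo_ne_hi i (w.injective h)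

theorem card_inversions_of_descent {w : Perm (Fin n)} {i : Fin (n - 1)}
    (h : w (hi i) < w (lo i)) :
    (inversions w).card = (inversions (w * simple i)).card + 1 := by
  have := card_inversions_mul_simple (w := w * simple i) (i := i) (by simpa using h)
  simpa using this

theorem inversions_one : inversions (1 : Perm (Fin n)) = ∅ := by
  ext ⟨i, j⟩
  simp [mem_inversions]
  exact fun h => h.le

theorem wordProd_append_singleton (w : List (Fin (n - 1))) (i : Fin (n - 1)) :
    wordProd (w ++ [i]) = wordProd w * simple i := by
  simp [wordProd]

theorem card_inversions_wordProd_le (w : List (Fin (n - 1))) :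
    (inversions (wordProd w)).card ≤ w.length := by
  induction w using List.reverseRecOn with
  | nil => simp [wordProd, inversions_one]
  | append_singleton w i ih =>
    rw [wordProd_append_singleton, List.length_append, List.length_singleton]
    rcases lo_lt_or_hi_lt (wordProd w) i with h | h
    · have := card_inversions_mul_simple h; omega
    · have := card_inversions_of_descent h; omega

theorem eq_one_of_no_descent {w : Perm (Fin n)} (h : ∀ i, w (lo i) < w (hi i)) : w = 1 := by
  have hm : StrictMono w := by
    cases n with
    | zero => intro a; exact a.elim0
    | succ m => exact Fin.strictMono_iff_lt_succ.2 fun i => h i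
  have h1 : (hm.orderIsoOfSurjective w w.surjective) = OrderIso.refl _ := Subsingleton.elim _ _
  ext i
  have := congrArg (fun e : Fin n ≃o Fin n => (e i).val) h1
  simpa using this

theorem exists_word_of_card_inversions (m : ℕ) :
    ∀ w : Perm (Fin n), (inversions w).card = m →
      ∃ l : List (Fin (n - 1)), wordProd l = w ∧ l.length = m := by
  induction m with
  | zero =>
    intro w hw
    refine ⟨[], ?_, rfl⟩
    rw [eq_one_of_no_descent (w := w)]
    · simp [wordProd]
    · intro i
      rcases lo_lt_or_hi_lt w i with h | h
      · exact h
      · have := card_inversions_of_descent h; omega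
  | succ m ih =>
    intro w hw
    by_cases h : ∀ i, w (lo i) < w (hi i)
    · rw [eq_one_of_no_descent h, inversions_one] at hw
      simp at hw
    · push Not at h
      obtain ⟨i, hi'⟩ := h
      have hd := (lo_lt_or_hi_lt w i).resolve_left (not_lt.2 hi')
      have := card_inversions_of_descent hd
      obtain ⟨l, hl, hm⟩ := ih (w * simple i) (by omega)
      exact ⟨l ++ [i], by rw [wordProd_append_singleton, hl, mul_simple_mul_simple],
        by simp [hm]⟩

theorem len_eq_card_inversions (w : Perm (Fin n)) : len w = (inversions w).card := by
  apply le_antisymm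
  · obtain ⟨l, hl⟩ := exists_word_of_card_inversions _ w rfl
    exact Nat.sInf_le ⟨l, hl⟩
  · obtain ⟨l, hl, hm⟩ := exists_reducedWord w
    rw [← hm, ← hl]
    exact card_inversions_wordProd_le l

theorem len_mul_simple {w : Perm (Fin n)} {i : Fin (n - 1)} (h : w (lo i) < w (hi i)) :
    len (w * simple i) = len w + 1 := by
  simp only [len_eq_card_inversions, card_inversions_mul_simple h]

theorem len_of_descent {w : Perm (Fin n)} {i : Fin (n - 1)} (h : w (hi i) < w (lo i)) :
    len w = len (w * simple i) + 1 := by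
  simp only [len_eq_card_inversions, card_inversions_of_descent h]

theorem len_one : len (1 : Perm (Fin n)) = 0 := by
  rw [len_eq_card_inversions, inversions_one, Finset.card_empty]

theorem len_inv (w : Perm (Fin n)) : len w⁻¹ = len w := by
  rw [len_eq_card_inversions, len_eq_card_inversions]
  refine Finset.card_nbij' (fun p => (w⁻¹ p.2, w⁻¹ p.1)) (fun p => (w p.2, w p.1)) ?_ ?_ ?_ ?_ <;>
    rintro ⟨i, j⟩ h <;> simp_all [mem_inversions]

theorem isReducedWord_append_singleton {l : List (Fin (n - 1))} {w : Perm (Fin n)}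
    {i : Fin (n - 1)} (hl : IsReducedWord l w) (h : w (lo i) < w (hi i)) :
    IsReducedWord (l ++ [i]) (w * simple i) :=
  ⟨by rw [wordProd_append_singleton, hl.1], by simp [len_mul_simple h, hl.2]⟩

theorem IsReducedWord.of_append_singleton {l : List (Fin (n - 1))} {w : Perm (Fin n)}
    {i : Fin (n - 1)} (hl : IsReducedWord (l ++ [i]) w) :
    w (hi i) < w (lo i) ∧ IsReducedWord l (w * simple i) := by
  have h1 : wordProd l = w * simple i := by
    rw [← hl.1, wordProd_append_singleton, mul_simple_mul_simple]
  have h2 := hl.2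
  simp only [List.length_append, List.length_singleton] at h2
  have h3 := card_inversions_wordProd_le l
  rw [h1, ← len_eq_card_inversions] at h3
  rcases lo_lt_or_hi_lt w i with h | h
  · have := len_mul_simple h; omega
  · have := len_of_descent h
    exact ⟨h, h1, by omega⟩

theorem isReducedWord_cons {l : List (Fin (n - 1))} {w : Perm (Fin n)} {i : Fin (n - 1)}
    (hl : IsReducedWord l w) (h : w⁻¹ (lo i) < w⁻¹ (hi i)) :
    IsReducedWord (i :: l) (simple i * w) := by
  refine ⟨by simp [← hl.1, wordProd], ?_⟩
  have h1 := len_mul_simple h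
  have h2 : w⁻¹ * simple i = (simple i * w)⁻¹ := by
    rw [mul_inv_rev, simple_eq, swap_inv]
  rw [h2, len_inv, len_inv] at h1
  simp [h1, hl.2]

/-! ### Rank functions and the Bruhat order -/

/-- The number of positions before `p` whose entry is at least `q`. -/
def rk (w : Perm (Fin n)) (p q : ℕ) : ℕ :=
  (Finset.univ.filter fun c : Fin n => c.val < p ∧ q ≤ (w c).val).card

/-- Comparison of rank functions; it agrees with the Bruhat order. -/
def RkLE (w u : Perm (Fin n)) : Prop := ∀ p q, rk w p q ≤ rk u p q

theorem RkLE.trans {u v w : Perm (Fin n)} (h : RkLE u v) (h' : RkLE v w) : RkLE u w :=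
  fun p q => (h p q).trans (h' p q)

theorem rk_succ (w : Perm (Fin n)) (c : Fin n) (q : ℕ) :
    rk w (c.val + 1) q = rk w c.val q + if q ≤ (w c).val then 1 else 0 := by
  have : (Finset.univ.filter fun d : Fin n => d.val < c.val + 1 ∧ q ≤ (w d).val) =
      (Finset.univ.filter fun d : Fin n => d.val < c.val ∧ q ≤ (w d).val) ∪
        if q ≤ (w c).val then {c} else ∅ := by
    ext d
    split_ifs <;> simp [Fin.ext_iff] <;> grind
  rw [rk, this, Finset.card_union_of_disjoint]
  · split_ifs <;> simp [rk]
  · split_ifs <;> simp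

theorem rk_zero (w : Perm (Fin n)) (q : ℕ) : rk w 0 q = 0 := by simp [rk]

/-- The total number of entries at least `q` does not depend on the permutation. -/
theorem rk_of_le (w u : Perm (Fin n)) {p : ℕ} (hp : n ≤ p) (q : ℕ) : rk w p q = rk u p q := by
  refine Finset.card_nbij' (fun c => u⁻¹ (w c)) (fun c => w⁻¹ (u c)) ?_ ?_ ?_ ?_ <;>
    intro c hc <;> simp_all <;> omega

/-- A prefix sees the swap only if it ends between the two positions, and its count changes only if
`q` separates the two entries. This rectangle of gain is what all later rank comparisons track. -/
theorem rk_mul_swap {w : Perm (Fin n)} {a b : Fin n} (hab : a < b) (hw : w a < w b) (p q : ℕ) :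
    rk (w * swap a b) p q =
      rk w p q + if a.val < p ∧ p ≤ b.val ∧ (w a).val < q ∧ q ≤ (w b).val then 1 else 0 := by
  have key : ∀ m, m ≤ n → rk (w * swap a b) m q =
      rk w m q + if a.val < m ∧ m ≤ b.val ∧ (w a).val < q ∧ q ≤ (w b).val then 1 else 0 := by
    intro m
    induction m with
    | zero => simp [rk_zero]
    | succ m ih =>
      intro hm
      have h1 := rk_succ w ⟨m, hm⟩ q
      have h2 := rk_succ (w * swap a b) ⟨m, hm⟩ q
      simp only at h1 h2
      rw [h1, h2, ih (by omega)]
      simp only [Perm.mul_apply, swap_apply_def, Fin.ext_iff]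
      grind
  rcases le_or_gt p n with h | h
  · exact key p h
  · rw [rk_of_le _ w h.le, if_neg (by omega), add_zero]

theorem rkLE_mul_swap {w : Perm (Fin n)} {a b : Fin n} (hab : a < b) (hw : w a < w b) :
    RkLE w (w * swap a b) := fun p q => by rw [rk_mul_swap hab hw]; omega

theorem rk_congr_of_lt {w u : Perm (Fin n)} {m : ℕ} (h : ∀ c : Fin n, c.val < m → w c = u c)
    {p : ℕ} (hp : p ≤ m) (q : ℕ) : rk w p q = rk u p q := by
  unfold rk
  congr 1
  ext c
  simp only [Finset.mem_filter, Finset.mem_univ, true_and, and_congr_right_iff]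
  intro hc
  rw [h c (by omega)]

/-- Comparison of rank functions through the entries in `[q, q')`: before `p`, those of `w` all stand
before `p'`, where `u` agrees with `w`, while `u` has one more. -/
theorem rk_lt_of_window {w u : Perm (Fin n)} {p p' q q' : ℕ} (hq : q ≤ q')
    (h1 : rk w p q' ≤ rk u p q')
    (h2 : ∀ c : Fin n, c.val < p → q ≤ (w c).val → (w c).val < q' → c.val < p')
    (h3 : ∀ c : Fin n, c.val < p' → u c = w c)
    (h4 : ∃ c : Fin n, p' ≤ c.val ∧ c.val < p ∧ q ≤ (u c).val ∧ (u c).val < q') :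
    rk w p q < rk u p q := by
  have split : ∀ x : Perm (Fin n), rk x p q = rk x p q' +
      (Finset.univ.filter fun c : Fin n => c.val < p ∧ q ≤ (x c).val ∧ (x c).val < q').card := by
    intro x
    rw [rk, rk, ← Finset.card_union_of_disjoint]
    · congr 1; ext c; simp; omega
    · rw [Finset.disjoint_filter]; intro c _ _ ; omega
  rw [split w, split u]
  refine add_lt_add_of_le_of_lt h1 (Finset.card_lt_card ?_)
  rw [Finset.ssubset_iff_of_subset]
  · obtain ⟨c, c1, c2, c3, c4⟩ := h4
    refine ⟨c, by simp [*], ?_⟩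
    simp only [Finset.mem_filter, Finset.mem_univ, true_and]
    intro h
    have := h2 c h.1 h.2.1 h.2.2
    omega
  · intro c hc
    simp only [Finset.mem_filter, Finset.mem_univ, true_and] at hc ⊢
    rw [h3 c (h2 c hc.1 hc.2.1 hc.2.2)]
    exact hc

/-- One step of a saturated chain from `w` towards a permutation with larger rank function. -/
theorem RkLE.exists_cover {w u : Perm (Fin n)} (h : RkLE w u) (hne : w ≠ u) :
    ∃ a b, a < b ∧ w a < w b ∧ (∀ c, a < c → c < b → w c < w a ∨ w b < w c) ∧
      RkLE (w * swap a b) u := by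
  have hex : ∃ c, w c ≠ u c := by
    by_contra hc
    push Not at hc
    exact hne (Equiv.ext hc)
  -- `a` is the first disagreement; the ranks just after it force `w a < u a`.
  obtain ⟨a, ha, hmin⟩ := WellFounded.has_min (wellFounded_lt (α := Fin n)) {c | w c ≠ u c} hex
  have heq : ∀ c : Fin n, c < a → w c = u c := by
    intro c hc
    by_contra h'
    exact hmin c h' hc
  have hlt : w a < u a := by
    have h1 := h (a + 1) (w a)
    rw [rk_succ, rk_succ, rk_congr_of_lt (fun c hc => heq c hc) le_rfl] at h1
    refine lt_of_le_of_ne ?_ ha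
    rw [Fin.le_def]
    by_contra h'
    simp [h'] at h1
  have hex2 : ∃ b, a < b ∧ w a < w b ∧ w b ≤ u a := by
    refine ⟨w.symm (u a), ?_, by simpa using hlt, by simp⟩
    rcases lt_trichotomy a (w.symm (u a)) with h' | h' | h'
    · exact h'
    · rw [h', Equiv.apply_symm_apply, ← h'] at hlt
      exact absurd hlt (lt_irrefl _)
    · have := heq _ h'
      rw [Equiv.apply_symm_apply] at this
      exact absurd (u.injective this) h'.ne'
  -- `b` is the leftmost later position whose entry exceeds `w a` without exceeding `u a`; one
  -- exists because `w` still has to place `u a` after `a`.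
  obtain ⟨b, ⟨hab, hwb, hbu⟩, hbmin⟩ := WellFounded.has_min (wellFounded_lt (α := Fin n))
    {b | a < b ∧ w a < w b ∧ w b ≤ u a} hex2
  have hbmin' : ∀ c, a < c → c < b → w c < w a ∨ u a < w c := by
    intro c h1 h2
    by_contra hc
    push Not at hc
    refine hbmin c ⟨h1, lt_of_le_of_ne hc.1 fun e => h1.ne (w.injective e), hc.2⟩ h2
  refine ⟨a, b, hab, hwb, fun c h1 h2 => (hbmin' c h1 h2).imp_right fun h => hbu.trans_lt h, ?_⟩
  intro p q
  rw [rk_mul_swap hab hwb]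
  split_ifs with hc
  · obtain ⟨c1, c2, c3, c4⟩ := hc
    -- In the window of entries from `q` to `u a`, minimality of `b` leaves `w` nothing from `a` up
    -- to `p`, whereas `u` has `u a` at position `a`.
    refine rk_lt_of_window (q' := (u a).val + 1) (p' := a.val) ?_ (h _ _) ?_ ?_ ?_
    · have := Fin.le_def.1 hbu; omega
    · intro c hc1 hc2 hc3
      by_contra hc4
      rcases eq_or_lt_of_le (not_lt.1 hc4) with h' | h'
      · have : c = a := Fin.ext h'.symm
        subst this; omega
      · rcases hbmin' c (Fin.lt_def.2 h') (Fin.lt_def.2 (by omega)) with h'' | h'' <;>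
          rw [Fin.lt_def] at h'' <;> omega
    · intro c hc
      exact (heq c hc).symm
    · exact ⟨a, le_rfl, c1, by have := Fin.le_def.1 hbu; omega, by omega⟩
  · exact h p q

theorem bruhatTransposition_of_cover {w : Perm (Fin n)} {a b : Fin n} (hab : a < b)
    (hw : w a < w b) (hc : ∀ c, a < c → c < b → w c < w a ∨ w b < w c) :
    IsBruhatTransposition w a b :=
  ⟨hab, by rw [len_eq_card_inversions, len_eq_card_inversions, card_inversions_mul_swap hab hw hc]⟩

/-- The sum of all values of the rank function, a measure for induction along chains. -/
def rkSum (w : Perm (Fin n)) : ℕ :=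
  ∑ p ∈ Finset.range (n + 1), ∑ q ∈ Finset.range (n + 1), rk w p q

theorem RkLE.rkSum_le {w u : Perm (Fin n)} (h : RkLE w u) : rkSum w ≤ rkSum u :=
  Finset.sum_le_sum fun p _ => Finset.sum_le_sum fun q _ => h p q

theorem rkSum_lt_mul_swap {w : Perm (Fin n)} {a b : Fin n} (hab : a < b) (hw : w a < w b) :
    rkSum w < rkSum (w * swap a b) := by
  have hle := rkLE_mul_swap hab hw
  refine Finset.sum_lt_sum (fun p _ => Finset.sum_le_sum fun q _ => hle p q) ⟨b, ?_, ?_⟩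
  · simp
  · refine Finset.sum_lt_sum (fun q _ => hle _ q) ⟨(w b).val, by simp, ?_⟩
    rw [rk_mul_swap hab hw, if_pos ⟨hab, le_rfl, hw, le_rfl⟩]
    omega

theorem RkLE.bruhatLE {w u : Perm (Fin n)} (h : RkLE w u) : BruhatLE w u := by
  generalize hm : rkSum u - rkSum w = m
  induction m using Nat.strong_induction_on generalizing w with
  | _ m ih =>
    by_cases hne : w = u
    · subst hne; exact Relation.ReflTransGen.refl
    · obtain ⟨a, b, hab, hwab, hc, hle⟩ := h.exists_cover hne
      refine Relation.ReflTransGen.head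
        ⟨a, b, bruhatTransposition_of_cover hab hwab hc, rfl⟩ (ih _ ?_ hle rfl)
      have := rkSum_lt_mul_swap hab hwab
      have := hle.rkSum_le
      omega

theorem BruhatLE.len_le {w u : Perm (Fin n)} (h : BruhatLE w u) : len w ≤ len u := by
  induction h with
  | refl => exact le_rfl
  | tail _ h ih =>
    obtain ⟨a, b, hb, rfl⟩ := h
    have := hb.2
    omega

theorem RkLE.len_le {w u : Perm (Fin n)} (h : RkLE w u) : len w ≤ len u := h.bruhatLE.len_le

theorem RkLE.len_lt {w u : Perm (Fin n)} (h : RkLE w u) (hne : w ≠ u) : len w < len u := by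
  obtain ⟨a, b, hab, hw, hc, hle⟩ := h.exists_cover hne
  have := (bruhatTransposition_of_cover hab hw hc).2
  have := hle.len_le
  omega

theorem mul_swap_ne {w : Perm (Fin n)} {a b : Fin n} (hab : a ≠ b) : w ≠ w * swap a b := by
  intro h
  have := congrArg (fun v : Perm (Fin n) => v a) h
  simp at this
  exact hab this

theorem IsBruhatTransposition.lt {w : Perm (Fin n)} {a b : Fin n}
    (h : IsBruhatTransposition w a b) : w a < w b := by
  rcases lt_or_ge (w a) (w b) with h' | h'
  · exact h'
  · have h'' := lt_of_le_of_ne h' fun e => h.1.ne' (w.injective e)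
    have := (rkLE_mul_swap (w := w * swap a b) h.1 (by simpa using h'')).len_le
    rw [mul_assoc, swap_mul_self, mul_one] at this
    have := h.2
    omega

theorem bruhatLE_iff {w u : Perm (Fin n)} : BruhatLE w u ↔ RkLE w u := by
  refine ⟨fun h => ?_, RkLE.bruhatLE⟩
  induction h with
  | refl => exact fun p q => le_rfl
  | tail _ h ih =>
    obtain ⟨a, b, hb, rfl⟩ := h
    exact ih.trans (rkLE_mul_swap hb.1 hb.lt)

theorem isBruhatTransposition_iff {w : Perm (Fin n)} {a b : Fin n} :
    IsBruhatTransposition w a b ↔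
      a < b ∧ w a < w b ∧ ∀ c, a < c → c < b → ¬ (w a < w c ∧ w c < w b) := by
  constructor
  · intro h
    -- An intermediate entry at `c` lets (a b) be written as (a c)(c b)(a c), each factor going up
    -- in Bruhat order, so the length would rise by at least two.
    refine ⟨h.1, h.lt, fun c h1 h2 h3 => ?_⟩
    have e1 := rkLE_mul_swap h1 h3.1
    have n1 := e1.len_lt (mul_swap_ne h1.ne)
    have hca : c ≠ a := h1.ne'
    have hbc : b ≠ c := h2.ne'
    have hba : b ≠ a := h.1.ne'
    have e2 := rkLE_mul_swap (w := w * swap a c) h2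
      (by simpa [swap_apply_of_ne_of_ne hba hbc] using h.lt)
    have n2 := e2.len_lt (mul_swap_ne h2.ne)
    have e3 := rkLE_mul_swap (w := w * swap a c * swap c b) h1
      (by simpa [swap_apply_of_ne_of_ne hba hbc, swap_apply_of_ne_of_ne hca.symm hba.symm]
        using h3.2)
    have n3 := e3.len_le
    have : w * swap a c * swap c b * swap a c = w * swap a b := by
      ext d
      simp only [Perm.mul_apply, swap_apply_def]
      grind
    rw [this] at n3
    have := h.2
    omega
  · rintro ⟨h1, h2, h3⟩
    refine bruhatTransposition_of_cover h1 h2 fun c hc1 hc2 => ?_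
    have := h3 c hc1 hc2
    by_contra h'
    push Not at h'
    refine this ⟨lt_of_le_of_ne h'.1 fun e => hc1.ne (w.injective e),
      lt_of_le_of_ne h'.2 fun e => hc2.ne (w.injective e)⟩

/-! ### The permutations in the Pieri sum for `σ`

They are described by bounds on each entry. With a threshold `v`, the entries `σ a < v` in the
first `k` positions are moreover required to stay in place. -/

/-- The entry `t` may stand in position `c`. -/
def Allowed (k : ℕ) (σ : Perm (Fin n)) (v : ℕ) (c t : Fin n) : Prop :=
  (c.val < k → σ c ≤ t ∧ (∀ p : Fin n, c < p → p.val < k → σ c < σ p → t < σ p) ∧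
    ((σ c).val < v → t = σ c)) ∧
  (k ≤ c.val → t ≤ σ c ∧ ∀ p : Fin n, k ≤ p.val → p < c → σ p < σ c → σ p < t)

/-- All entries of `μ` are allowed. -/
def InPieri (k : ℕ) (σ : Perm (Fin n)) (v : ℕ) (μ : Perm (Fin n)) : Prop :=
  ∀ c, Allowed k σ v c (μ c)

theorem InPieri.mul_swap {k v : ℕ} {σ μ : Perm (Fin n)} (h : InPieri k σ v μ) {c d : Fin n}
    (h1 : Allowed k σ v c (μ d)) (h2 : Allowed k σ v d (μ c)) : InPieri k σ v (μ * swap c d) := by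
  intro e
  rw [Perm.mul_apply, swap_apply_def]
  split_ifs with e1 e2
  · rwa [e1]
  · rwa [e2]
  · exact h e

theorem Allowed.mono {k v v' : ℕ} {σ : Perm (Fin n)} {c t : Fin n} (hv : v ≤ v')
    (h : Allowed k σ v' c t) : Allowed k σ v c t :=
  ⟨fun hc => ⟨(h.1 hc).1, (h.1 hc).2.1, fun h' => (h.1 hc).2.2 (by omega)⟩, h.2⟩

theorem InPieri.mono {k v v' : ℕ} {σ μ : Perm (Fin n)} (hv : v ≤ v')
    (h : InPieri k σ v' μ) : InPieri k σ v μ := fun c => (h c).mono hv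

/-- Entries of the first block only rise, so the gain in rank counts those that have risen across
`q`. -/
theorem InPieri.rk_of_le {k v : ℕ} {σ μ : Perm (Fin n)} (h : InPieri k σ v μ) {p : ℕ}
    (hp : p ≤ k) (q : ℕ) :
    rk μ p q = rk σ p q +
      (Finset.univ.filter fun c : Fin n => c.val < p ∧ (σ c).val < q ∧ q ≤ (μ c).val).card := by
  rw [rk, rk, ← Finset.card_union_of_disjoint]
  · congr 1
    ext c
    simp only [Finset.mem_filter, Finset.mem_univ, true_and, Finset.mem_union]
    constructor
    · rintro ⟨h1, h2⟩; omega
    · rintro (⟨h1, h2⟩ | h1)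
      · have := Fin.le_def.1 ((h c).1 (by omega)).1
        omega
      · omega
  · rw [Finset.disjoint_filter]; intro c _ _; omega

theorem rk_add_card_compl (w : Perm (Fin n)) (p q : ℕ) :
    rk w p q + (Finset.univ.filter fun c : Fin n => p ≤ c.val ∧ q ≤ (w c).val).card =
      rk w n q := by
  rw [rk, rk, ← Finset.card_union_of_disjoint]
  · congr 1; ext c; simp; omega
  · rw [Finset.disjoint_filter]; intro c _ _; omega

/-- Past the boundary the count is made from the right end: the totals agree, and entries there only
fall. -/
theorem InPieri.rk_of_ge {k v : ℕ} {σ μ : Perm (Fin n)} (h : InPieri k σ v μ) {p : ℕ}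
    (hp : k ≤ p) (q : ℕ) :
    rk μ p q = rk σ p q +
      (Finset.univ.filter fun c : Fin n => p ≤ c.val ∧ (μ c).val < q ∧ q ≤ (σ c).val).card := by
  have h1 := rk_add_card_compl μ p q
  have h2 := rk_add_card_compl σ p q
  rw [GrothPieri.rk_of_le μ σ le_rfl] at h1
  have h3 : (Finset.univ.filter fun c : Fin n => p ≤ c.val ∧ q ≤ (σ c).val).card =
      (Finset.univ.filter fun c : Fin n => p ≤ c.val ∧ q ≤ (μ c).val).card +
      (Finset.univ.filter fun c : Fin n => p ≤ c.val ∧ (μ c).val < q ∧ q ≤ (σ c).val).card := by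
    rw [← Finset.card_union_of_disjoint]
    · congr 1
      ext c
      simp only [Finset.mem_filter, Finset.mem_univ, true_and, Finset.mem_union]
      constructor
      · rintro ⟨h1, h2⟩; omega
      · rintro (⟨h1, h2⟩ | h1)
        · have := Fin.le_def.1 ((h c).2 (by omega)).1
          omega
        · omega
    · rw [Finset.disjoint_filter]; intro c _ _; omega
  omega

theorem InPieri.rkLE {k v : ℕ} {σ μ : Perm (Fin n)} (h : InPieri k σ v μ) : RkLE σ μ := by
  intro p q
  rcases le_total p k with hp | hp
  · rw [h.rk_of_le hp]; omega
  · rw [h.rk_of_ge hp]; omega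

/-- Some entry of the first `k` positions moves up across `q` if and only if some other entry
moves down across `q`. -/
theorem InPieri.exists_cross_iff {k v : ℕ} {σ μ : Perm (Fin n)} (h : InPieri k σ v μ) (q : ℕ) :
    (∃ c : Fin n, c.val < k ∧ (σ c).val < q ∧ q ≤ (μ c).val) ↔
      ∃ c : Fin n, k ≤ c.val ∧ (μ c).val < q ∧ q ≤ (σ c).val := by
  have h1 := h.rk_of_le le_rfl q
  have h2 := h.rk_of_ge le_rfl q
  have h3 : (Finset.univ.filter fun c : Fin n => c.val < k ∧ (σ c).val < q ∧ q ≤ (μ c).val).card =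
      (Finset.univ.filter fun c : Fin n => k ≤ c.val ∧ (μ c).val < q ∧ q ≤ (σ c).val).card := by
    omega
  have h4 := Finset.card_pos (s := Finset.univ.filter fun c : Fin n =>
    c.val < k ∧ (σ c).val < q ∧ q ≤ (μ c).val)
  rw [h3, Finset.card_pos] at h4
  simpa [Finset.Nonempty] using h4.symm

/-- A fall below `v` must be balanced by a rise across `v` in the first block, but the entries there
that start below `v` are frozen. -/
theorem InPieri.threshold_le {k v : ℕ} {σ μ : Perm (Fin n)} (h : InPieri k σ v μ) {c : Fin n}
    (hc : k ≤ c.val) (hv : v ≤ (σ c).val) : v ≤ (μ c).val := by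
  by_contra h'
  obtain ⟨f, f1, f2, f3⟩ := (h.exists_cross_iff v).2 ⟨c, hc, by omega, hv⟩
  have := ((h f).1 f1).2.2 f2
  rw [this] at f3
  omega

/-- For `a` among the first `k` positions, the condition that `(a, b)` is a `k`-Bruhat
transposition of `σ`. -/
def InList (k : ℕ) (σ : Perm (Fin n)) (a b : Fin n) : Prop :=
  k ≤ b.val ∧ σ a < σ b ∧ ∀ e, a < e → e < b → ¬ (σ a < σ e ∧ σ e < σ b)

/-! ### Freeing one more entry of the first block -/

section Step

variable {k : ℕ} {σ : Perm (Fin n)} {a : Fin n}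

/-- Used to recognize members of `InList` from bounds on `μ`. If `σ c` were at least `σ e`, the fall
of position `c` across `σ e` would be balanced by a rise at some `f` of the first block; the bounds
put `f` to the right of `e` with `σ a < σ f < σ e`, so induction on the value `σ e` applies to `f`.
-/
theorem InPieri.lt_of_not_cross {μ : Perm (Fin n)} (h : InPieri k σ ((σ a).val + 1) μ)
    {c : Fin n} (hc : k ≤ c.val)
    (hμ : ∀ e : Fin n, a < e → e.val < k → σ a < σ e → μ c < σ e) :
    ∀ e : Fin n, a < e → e.val < k → σ a < σ e → σ c < σ e := by
  have key : ∀ m : ℕ, ∀ e : Fin n, (σ e).val = m → a < e → e.val < k → σ a < σ e →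
      σ c < σ e := by
    intro m
    induction m using Nat.strong_induction_on with
    | _ m ih =>
      intro e hm h1 h2 h3
      by_contra h4
      have h5 := hμ e h1 h2 h3
      rw [not_lt, Fin.le_def] at h4
      obtain ⟨f, f1, f2, f3⟩ := (h.exists_cross_iff (σ e).val).2 ⟨c, hc, h5, h4⟩
      have hf := (h f).1 f1
      have h6 : σ a < σ f := by
        rw [Fin.lt_def]
        by_contra h6
        rw [hf.2.2 (by omega)] at f3
        omega
      have h7 : e < f := by
        rcases lt_trichotomy e f with h' | h' | h'
        · exact h'
        · rw [h'] at f2; omega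
        · have := Fin.lt_def.1 (hf.2.1 e h' h2 (Fin.lt_def.2 f2))
          omega
      have := Fin.lt_def.1 (ih _ (by omega) f rfl (h1.trans h7) f1 h6)
      omega
  exact fun e => key _ e rfl

/-- The entry `σ a` is brought back to position `a` at controlled cost. Standing at `β` in the
second block, it is exchanged with the entry at `a` if that one fits at `β`, and otherwise with an
earlier position `c` of the second block, from which the process continues. Each exchange costs one
unit of rank on a rectangle; these rectangles occupy disjoint ranges of `p`, so the total loss is at
most one anywhere. -/
theorem InPieri.exists_fix (hak : a.val < k) : ∀ (m : ℕ) (β : Fin n), β.val = m →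
    ∀ μ : Perm (Fin n), InPieri k σ (σ a).val μ → μ β = σ a →
    ∃ μ' : Perm (Fin n), InPieri k σ ((σ a).val + 1) μ' ∧ (∀ c, β < c → μ' c = μ c) ∧
      ∀ p q, rk μ p q ≤ rk μ' p q ∨ (rk μ p q ≤ rk μ' p q + 1 ∧ ∃ b, InList k σ a b ∧ b ≤ β ∧
        a.val < p ∧ p ≤ b.val ∧ (σ a).val < q ∧ q ≤ (μ' b).val) := by
  intro m
  induction m using Nat.strong_induction_on with
  | _ m ih =>
  intro β hm μ h hβ
  by_cases hβa : β = a
  · subst hβa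
    refine ⟨μ, fun c => ⟨fun hc => ⟨((h c).1 hc).1, ((h c).1 hc).2.1, fun h' => ?_⟩, (h c).2⟩,
      fun _ _ => rfl, fun p q => Or.inl le_rfl⟩
    rcases eq_or_lt_of_le (Nat.lt_succ_iff.1 h') with h'' | h''
    · have : c = β := σ.injective (Fin.ext h'')
      rw [this, hβ]
    · exact ((h c).1 hc).2.2 h''
  -- In the first block `β` would satisfy `σ β < σ a`, hence be frozen by the threshold and unable
  -- to hold `σ a`.
  have hβk : k ≤ β.val := by
    by_contra h'
    have h1 := (h β).1 (by omega)
    rw [hβ] at h1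
    have h2 : (σ β).val < (σ a).val :=
      lt_of_le_of_ne (Fin.le_def.1 h1.1) fun e => hβa (σ.injective (Fin.ext e))
    have := h1.2.2 h2
    rw [this] at h2
    omega
  have hab : a < β := Fin.lt_def.2 (by omega)
  have hσβ : σ a < σ β := by
    have := ((h β).2 hβk).1
    rw [hβ] at this
    exact lt_of_le_of_ne this fun e => hab.ne (σ.injective e)
  have hβl : ∀ p : Fin n, k ≤ p.val → p < β → σ p < σ β → σ p < σ a := by
    rw [← hβ]; exact ((h β).2 hβk).2
  have haμ : σ a < μ a :=
    lt_of_le_of_ne ((h a).1 hak).1 fun e => hβa (μ.injective (hβ.trans e))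
  have hlist : (∀ e : Fin n, a < e → e.val < k → σ a < σ e → σ β < σ e) → InList k σ a β := by
    intro h'
    refine ⟨hβk, hσβ, fun e e1 e2 e3 => ?_⟩
    rcases lt_or_ge e.val k with h'' | h''
    · exact lt_asymm e3.2 (h' e e1 h'' e3.1)
    · exact lt_asymm e3.1 (hβl e h'' e2 e3.2)
  rcases le_or_gt (μ a) (σ β) with ht | ht
  · have h0 : InPieri k σ (σ a).val (μ * swap a β) := by
      refine h.mul_swap ⟨fun _ => ?_, fun h' => by omega⟩ ⟨fun h' => by omega, fun _ => ⟨ht, ?_⟩⟩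
      · rw [hβ]
        exact ⟨le_rfl, fun p _ _ h => h, fun _ => rfl⟩
      · exact fun p p1 p2 p3 => (hβl p p1 p2 p3).trans haμ
    have h1 : InPieri k σ ((σ a).val + 1) (μ * swap a β) := by
      refine fun c => ⟨fun hc => ⟨((h0 c).1 hc).1, ((h0 c).1 hc).2.1, fun h' => ?_⟩, (h0 c).2⟩
      rcases eq_or_lt_of_le (Nat.lt_succ_iff.1 h') with h'' | h''
      · have : c = a := σ.injective (Fin.ext h'')
        rw [this, Perm.mul_apply, swap_apply_left, hβ]
      · exact ((h0 c).1 hc).2.2 h''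
    refine ⟨μ * swap a β, h1, fun c hc => ?_, fun p q => ?_⟩
    · rw [Perm.mul_apply, swap_apply_of_ne_of_ne (hab.trans hc).ne' hc.ne']
    · have e1 : μ = (μ * swap a β) * swap a β := by rw [mul_assoc, swap_mul_self, mul_one]
      have e2 := rk_mul_swap (w := μ * swap a β) hab (by simpa [hβ] using haμ) p q
      rw [← e1] at e2
      rw [e2]
      split_ifs with hc
      · right
        refine ⟨le_rfl, β, hlist ?_, le_rfl, hc.1, hc.2.1, ?_, hc.2.2.2⟩
        · refine h1.lt_of_not_cross hβk fun e e1 e2 e3 => ?_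
          rw [Perm.mul_apply, swap_apply_right]
          exact ((h a).1 hak).2.1 e e1 e2 e3
        · have := hc.2.2.1
          rwa [Perm.mul_apply, swap_apply_left, hβ] at this
      · left; omega
  -- `μ a` is too large for `β`, so its rise across `σ β + 1` is balanced by a fall at some `c`.
  -- This `c` lies left of `β`: to the right, its lower bound would keep it above `σ β`.
  · obtain ⟨c, hck, c1, c2⟩ := (h.exists_cross_iff ((σ β).val + 1)).1
      ⟨a, hak, by have := Fin.lt_def.1 hσβ; omega, by have := Fin.lt_def.1 ht; omega⟩
    have hcβ' : σ β < σ c := Fin.lt_def.2 (by omega)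
    have hcβ : c < β := by
      rcases lt_trichotomy c β with h' | h' | h'
      · exact h'
      · rw [h'] at c2; omega
      · have := Fin.lt_def.1 (((h c).2 hck).2 β hβk h' hcβ')
        omega
    have hμc : σ a < μ c := by
      refine lt_of_le_of_ne ?_ fun e => hcβ.ne' (μ.injective (hβ.trans e))
      exact Fin.le_def.2 (h.threshold_le hck (by
        have := Fin.lt_def.1 hσβ; have := Fin.lt_def.1 hcβ'; omega))
    have hμcβ : μ c ≤ σ β := Fin.le_def.2 (by omega)
    have h0 : InPieri k σ (σ a).val (μ * swap c β) := by
      refine h.mul_swap ⟨fun h' => by omega, fun _ => ?_⟩ ⟨fun h' => by omega, fun _ => ?_⟩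
      · rw [hβ]
        refine ⟨(hσβ.trans hcβ').le, fun p p1 p2 p3 => ?_⟩
        exact hβl p p1 (p2.trans hcβ) ((((h c).2 hck).2 p p1 p2 p3).trans_le hμcβ)
      · exact ⟨hμcβ, fun p p1 p2 p3 => (hβl p p1 p2 p3).trans hμc⟩
    obtain ⟨μ', m1, m2, m3⟩ := ih c.val (by rw [← hm]; exact hcβ) c rfl _ h0
      (by rw [Perm.mul_apply, swap_apply_left, hβ])
    refine ⟨μ', m1, fun d hd => ?_, fun p q => ?_⟩
    · rw [m2 d (hcβ.trans hd), Perm.mul_apply,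
        swap_apply_of_ne_of_ne (hcβ.trans hd).ne' hd.ne']
    · have e1 : μ = (μ * swap c β) * swap c β := by rw [mul_assoc, swap_mul_self, mul_one]
      have e2 := rk_mul_swap (w := μ * swap c β) hcβ (by simpa [hβ] using hμc) p q
      rw [← e1] at e2
      rw [e2]
      split_ifs with hc
      · right
        obtain ⟨d1, d2, d3, d4⟩ := hc
        -- The loss at this stage has `c < p`, while those of the later stages have `p ≤ b ≤ c`.
        have hle : rk (μ * swap c β) p q ≤ rk μ' p q := by
          rcases m3 p q with h' | ⟨_, b, b1, b2, b3, b4, b5, b6⟩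
          · exact h'
          · have := Fin.le_def.1 b2; omega
        have hβ' := m2 β hcβ
        refine ⟨by omega, β, hlist fun e e1 e2 e3 => ?_, le_rfl, ?_, d2, ?_, ?_⟩
        · exact ht.trans (((h a).1 hak).2.1 e e1 e2 e3)
        · omega
        · rwa [Perm.mul_apply, swap_apply_left, hβ] at d3
        · rwa [hβ']
      · rcases m3 p q with h' | ⟨b0, b, b1, b2, b3⟩
        · exact Or.inl h'
        · exact Or.inr ⟨b0, b, b1, b2.trans hcβ.le, b3⟩

theorem InList.lt_of_left {b e : Fin n} (h : InList k σ a b) (h1 : a < e) (h2 : e.val < k)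
    (h3 : σ a < σ e) : σ b < σ e := by
  have heb : e < b := Fin.lt_def.2 (by have := h.1; omega)
  have := h.2.2 e h1 heb
  by_contra h4
  exact this ⟨h3, lt_of_le_of_ne (not_lt.1 h4) fun e' => heb.ne (σ.injective e')⟩

/-- No entry from `p` to the boundary crosses `q`: those below `σ a` are frozen, and those above `σ
a` already exceed `σ b`. The gain in rank is therefore the same at `p` and at `k`. -/
theorem InPieri.rk_eq_of_left {μ : Perm (Fin n)} (h : InPieri k σ ((σ a).val + 1) μ) {b : Fin n}
    (hb : InList k σ a b) {p q : ℕ} (hap : a.val < p) (hpk : p ≤ k) (hq : q ≤ (σ b).val) :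
    rk μ p q + rk σ k q = rk μ k q + rk σ p q := by
  rw [h.rk_of_le hpk, h.rk_of_le le_rfl]
  have : (Finset.univ.filter fun c : Fin n => c.val < p ∧ (σ c).val < q ∧ q ≤ (μ c).val) =
      Finset.univ.filter fun c : Fin n => c.val < k ∧ (σ c).val < q ∧ q ≤ (μ c).val := by
    ext c
    simp only [Finset.mem_filter, Finset.mem_univ, true_and]
    refine ⟨fun h' => ⟨by omega, h'.2⟩, fun h' => ⟨?_, h'.2⟩⟩
    by_contra hc
    have hac : a < c := Fin.lt_def.2 (by omega)
    rcases lt_or_ge (σ a) (σ c) with h'' | h''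
    · have := Fin.lt_def.1 (hb.lt_of_left hac h'.1 h'')
      omega
    · rw [Fin.le_def] at h''
      rw [((h c).1 h'.1).2.2 (by omega)] at h'
      omega
  rw [this]
  omega

/-- For `p ≥ k`, count falls across `q`. Beyond `b`, `w` has at least as many as `μ` by comparison
at `b + 1`. From `p` to `b`, each fall of `μ` occurs at a member of `InList`, hence is a fall of `w`
too, and `w` has one more at `b` itself. Smaller `p` reduce to `p = k` by `InPieri.rk_eq_of_left`.
-/
theorem InPieri.rk_lt_of_inList {μ w : Perm (Fin n)}
    (hμ : InPieri k σ ((σ a).val + 1) μ)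
    (hw : InPieri k σ ((σ a).val + 1) w) (hle : RkLE μ w) {b : Fin n} (hb : InList k σ a b)
    {p q : ℕ} (hap : a.val < p) (hpb : p ≤ b.val) (haq : (σ a).val < q) (hq : q ≤ (μ b).val)
    (hall : ∀ c, InList k σ a c → p ≤ c.val → (w c).val < q) : rk μ p q + 1 ≤ rk w p q := by
  have hbk := hb.1
  have hqb : q ≤ (σ b).val := hq.trans (Fin.le_def.1 ((hμ b).2 hbk).1)
  have main : ∀ p : ℕ, k ≤ p → p ≤ b.val → (∀ c, InList k σ a c → p ≤ c.val → (w c).val < q) →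
      rk μ p q + 1 ≤ rk w p q := by
    intro p hkp hpb hall
    have h1 := hle (b.val + 1) q
    rw [hμ.rk_of_ge (by omega), hw.rk_of_ge (by omega)] at h1
    rw [hμ.rk_of_ge hkp, hw.rk_of_ge hkp]
    have split : ∀ x : Perm (Fin n),
        (Finset.univ.filter fun c : Fin n => p ≤ c.val ∧ (x c).val < q ∧ q ≤ (σ c).val).card =
        (Finset.univ.filter fun c : Fin n => b.val + 1 ≤ c.val ∧ (x c).val < q ∧
          q ≤ (σ c).val).card +
        (Finset.univ.filter fun c : Fin n => (p ≤ c.val ∧ c.val ≤ b.val) ∧ (x c).val < q ∧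
          q ≤ (σ c).val).card := by
      intro x
      rw [← Finset.card_union_of_disjoint]
      · congr 1; ext c; simp; omega
      · rw [Finset.disjoint_filter]; intro c _ _; omega
    have h2 : (Finset.univ.filter fun c : Fin n => (p ≤ c.val ∧ c.val ≤ b.val) ∧ (μ c).val < q ∧
          q ≤ (σ c).val).card <
        (Finset.univ.filter fun c : Fin n => (p ≤ c.val ∧ c.val ≤ b.val) ∧ (w c).val < q ∧
          q ≤ (σ c).val).card := by
      refine Finset.card_lt_card ((Finset.ssubset_iff_of_subset ?_).2 ⟨b, ?_, ?_⟩)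
      · intro c hc
        simp only [Finset.mem_filter, Finset.mem_univ, true_and] at hc ⊢
        obtain ⟨⟨c1, c2⟩, c3, c4⟩ := hc
        refine ⟨⟨c1, c2⟩, hall c ?_ c1, c4⟩
        have hcb : c < b := by
          refine lt_of_le_of_ne (Fin.le_def.2 c2) fun e => ?_
          rw [e] at c3; omega
        have hck : k ≤ c.val := by omega
        refine ⟨hck, Fin.lt_def.2 (by omega), fun e e1 e2 e3 => ?_⟩
        rcases lt_or_ge e.val k with hek | hek
        · have h3 := hμ.lt_of_not_cross hck (fun f f1 f2 f3 => by
            have := Fin.lt_def.1 (hb.lt_of_left f1 f2 f3)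
            exact Fin.lt_def.2 (by omega)) e e1 hek e3.1
          exact lt_asymm h3 e3.2
        · have h3 := Fin.lt_def.1 (((hμ c).2 hck).2 e hek e2 e3.2)
          refine hb.2.2 e e1 (e2.trans hcb) ⟨e3.1, Fin.lt_def.2 (by omega)⟩
      · simp only [Finset.mem_filter, Finset.mem_univ, true_and]
        exact ⟨⟨hpb, le_rfl⟩, hall b hb hpb, hqb⟩
      · simp only [Finset.mem_filter, Finset.mem_univ, true_and]
        omega
    rw [split μ, split w]
    omega
  rcases le_total p k with hpk | hpk
  · have h1 := main k le_rfl hbk fun c hc _ => hall c hc (by have := hc.1; omega)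
    have h2 := hμ.rk_eq_of_left hb hap hpk hqb
    have h3 := hw.rk_eq_of_left hb hap hpk hqb
    omega
  · exact main p hpk hpb hall

/-- The swaps put larger and larger entries at `a` while their second positions move left. Each goes
up, and together they gain at least one unit of rank on the union of the rectangles cornered at `a`
and the members of the list. -/
theorem InPieri.mul_prod_swap (hak : a.val < k) (l : List (Fin n)) :
    ∀ w : Perm (Fin n), InPieri k σ (σ a).val w → (∀ b ∈ l, InList k σ a b) →
      l.Pairwise (fun b b' => b' < b ∧ w b < w b') → (∀ b ∈ l, w a < w b) →
      InPieri k σ (σ a).val (w * (l.map fun b => swap a b).prod) ∧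
      RkLE w (w * (l.map fun b => swap a b).prod) ∧
      ∀ b ∈ l, ∀ p q, a.val < p → p ≤ b.val → (w a).val < q → q ≤ (w b).val →
        rk w p q + 1 ≤ rk (w * (l.map fun b => swap a b).prod) p q := by
  induction l with
  | nil =>
    intro w hw _ _ _
    simpa using ⟨hw, fun p q => le_rfl⟩
  | cons b l ih =>
    intro w hw hl hp ha
    rw [List.pairwise_cons] at hp
    have hb := hl b (by simp)
    have hbk := hb.1
    have hab : a < b := Fin.lt_def.2 (by omega)
    have hwab := ha b (by simp)
    have hwb := (hw b).2 hbk
    have hwa := (hw a).1 hak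
    have hne : ∀ c ∈ l, c ≠ a ∧ c ≠ b := fun c hc =>
      ⟨fun e => by have := (hl c (by simp [hc])).1; rw [e] at this; omega,
        (hp.1 c hc).1.ne⟩
    have hwc : ∀ c ∈ l, (w * swap a b) c = w c := fun c hc => by
      rw [Perm.mul_apply, swap_apply_of_ne_of_ne (hne c hc).1 (hne c hc).2]
    have h1 : InPieri k σ (σ a).val (w * swap a b) := by
      refine hw.mul_swap ⟨fun _ => ⟨hwa.1.trans hwab.le, fun p p1 p2 p3 => ?_, fun h => ?_⟩,
        fun h => by omega⟩ ⟨fun h => by omega, fun _ => ⟨hwab.le.trans hwb.1, ?_⟩⟩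
      · exact hwb.1.trans_lt (hb.lt_of_left p1 p2 p3)
      · omega
      · intro p p1 p2 p3
        refine lt_of_lt_of_le ?_ hwa.1
        have hpa : a < p := Fin.lt_def.2 (by omega)
        refine lt_of_le_of_ne (not_lt.1 fun h => hb.2.2 p hpa p2 ⟨h, p3⟩)
          fun e => hpa.ne' (σ.injective e)
    obtain ⟨i1, i2, i3⟩ := ih (w * swap a b) h1 (fun c hc => hl c (by simp [hc]))
      (hp.2.imp_of_mem fun {c d} hc hd h => by rw [hwc c hc, hwc d hd]; exact h)
      (fun c hc => by
        rw [hwc c hc, Perm.mul_apply, swap_apply_left]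
        exact (hp.1 c hc).2)
    have hle := rkLE_mul_swap hab hwab
    rw [List.map_cons, List.prod_cons, ← mul_assoc]
    refine ⟨i1, hle.trans i2, fun c hc p q p1 p2 q1 q2 => ?_⟩
    -- If `q ≤ w b`, the rectangle of the first swap already contains (p, q), as `b` is the
    -- rightmost position of the list. Otherwise `q` lies above the new entry at `a`, and the tail
    -- supplies the gain.
    by_cases hq : q ≤ (w b).val
    · have hcb : c ≤ b := by
        rcases List.mem_cons.1 hc with rfl | hc
        · exact le_rfl
        · exact (hp.1 c hc).1.le
      have h2 := rk_mul_swap hab hwab p q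
      rw [if_pos ⟨p1, p2.trans (Fin.le_def.1 hcb), q1, hq⟩] at h2
      rw [← h2]
      exact i2 p q
    · have hc : c ∈ l := by
        rcases List.mem_cons.1 hc with rfl | hc
        · exact absurd q2 hq
        · exact hc
      have := i3 c hc p q p1 p2 (by
        rw [Perm.mul_apply, swap_apply_left]; omega) (by rw [hwc c hc]; exact q2)
      have := hle p q
      omega

/-- A competitor `μ` is compared with `w` after `σ a` has been put back at `a`. Where this costs one
unit of rank, the unit is recovered either from the product of swaps or from a strict inequality
already present below `w`. -/
theorem InPieri.max_step (hak : a.val < k) {w : Perm (Fin n)}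
    (hw : InPieri k σ ((σ a).val + 1) w)
    (hmax : ∀ μ, InPieri k σ ((σ a).val + 1) μ → RkLE μ w) (l : List (Fin n))
    (hl : ∀ b, b ∈ l ↔ InList k σ a b) (hs : l.Pairwise fun b b' => σ b < σ b') :
    InPieri k σ (σ a).val (w * (l.map fun b => swap a b).prod) ∧
      ∀ μ, InPieri k σ (σ a).val μ → RkLE μ (w * (l.map fun b => swap a b).prod) := by
  have hwa : w a = σ a := ((hw a).1 hak).2.2 (by omega)
  have hlt : ∀ b, InList k σ a b → σ a < w b := by
    intro b hb
    have h1 := Fin.lt_def.1 hb.2.1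
    have := hw.threshold_le hb.1 (by omega)
    exact Fin.lt_def.2 (by omega)
  -- Among the partners of `a`, a larger entry of `σ` stands further left. Their entries in `w`
  -- follow the same pattern, since exchanging two that do not would produce a larger member of the
  -- set.
  have hpair : l.Pairwise fun b b' => b' < b ∧ w b < w b' := by
    refine hs.imp_of_mem fun {b c} hb hc hbc => ?_
    have hb := (hl b).1 hb
    have hc := (hl c).1 hc
    have hb1 := hb.1
    have hc1 := hc.1
    have h1 : c < b := by
      refine lt_of_le_of_ne (not_lt.1 fun h => ?_) fun e => hbc.ne (by rw [e])
      exact hc.2.2 b (Fin.lt_def.2 (by omega)) h ⟨hb.2.1, hbc⟩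
    refine ⟨h1, ?_⟩
    by_contra h2
    have h3 : w c < w b := lt_of_le_of_ne (not_lt.1 h2) fun e => h1.ne (w.injective e)
    have hwb := (hw b).2 hb1
    have hwc := (hw c).2 hc1
    have h4 : InPieri k σ ((σ a).val + 1) (w * swap c b) := by
      refine hw.mul_swap ⟨fun h => by omega, fun _ => ⟨hwb.1.trans hbc.le, ?_⟩⟩
        ⟨fun h => by omega, fun _ => ⟨h3.le.trans hwb.1, ?_⟩⟩
      · exact fun p p1 p2 p3 => (hwc.2 p p1 p2 p3).trans h3
      · intro p p1 p2 p3
        refine lt_of_le_of_lt (not_lt.1 fun h => ?_) (hlt c hc)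
        exact hb.2.2 p (Fin.lt_def.2 (by omega)) p2 ⟨h, p3⟩
    have h5 := hmax _ h4 b.val (w b).val
    rw [rk_mul_swap h1 h3, if_pos ⟨h1, le_rfl, h3, le_rfl⟩] at h5
    omega
  obtain ⟨i1, i2, i3⟩ := (hw.mono (Nat.le_succ _)).mul_prod_swap hak l w
    (fun b hb => (hl b).1 hb) hpair (fun b hb => by rw [hwa]; exact hlt b ((hl b).1 hb))
  refine ⟨i1, fun μ hμ p q => ?_⟩
  obtain ⟨μ', m1, -, m3⟩ := InPieri.exists_fix hak _ (μ.symm (σ a)) rfl μ hμ (by simp)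
  have hle := hmax μ' m1
  rcases m3 p q with h | ⟨h, b, b1, -, b3, b4, b5, b6⟩
  · exact h.trans ((hle p q).trans (i2 p q))
  -- A partner `c` whose rectangle contains (p, q) gives the unit through the swaps; if there is
  -- none, `InPieri.rk_lt_of_inList` gives it.
  · by_cases hex : ∃ c, InList k σ a c ∧ p ≤ c.val ∧ q ≤ (w c).val
    · obtain ⟨c, c1, c2, c3⟩ := hex
      have := i3 c ((hl c).2 c1) p q b3 c2 (by rw [hwa]; exact b5) c3
      have := hle p q
      omega
    · push Not at hex
      have := m1.rk_lt_of_inList hw hle b1 b3 b4 b5 b6 hex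
      have := i2 p q
      omega

end Step

/-! ### The permutation `eta k σ` is the greatest element of the Pieri set -/

open Classical in
/-- The positions `b` such that `(a, b)` belongs to `W k σ`, by increasing entry. -/
noncomputable def partners (k : ℕ) (σ : Perm (Fin n)) (a : Fin n) : List (Fin n) :=
  ((List.finRange n).map σ.symm).filter fun b => decide (IsKBruhatTransposition k σ (a, b))

theorem isKBruhatTransposition_iff {k : ℕ} {σ : Perm (Fin n)} {a b : Fin n} :
    IsKBruhatTransposition k σ (a, b) ↔ a.val < k ∧ InList k σ a b := by
  simp only [IsKBruhatTransposition, isBruhatTransposition_iff, InList]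
  constructor
  · rintro ⟨h1, h2, -, h4, h5⟩
    exact ⟨h1, h2, h4, h5⟩
  · rintro ⟨h1, h2, h4, h5⟩
    exact ⟨h1, h2, Fin.lt_def.2 (by omega), h4, h5⟩

theorem mem_partners {k : ℕ} {σ : Perm (Fin n)} {a b : Fin n} :
    b ∈ partners k σ a ↔ a.val < k ∧ InList k σ a b := by
  simp only [partners, List.mem_filter, List.mem_map, List.mem_finRange, true_and,
    decide_eq_true_eq, isKBruhatTransposition_iff]
  exact ⟨fun h => h.2, fun h => ⟨⟨σ b, by simp⟩, h⟩⟩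

theorem partners_pairwise (k : ℕ) (σ : Perm (Fin n)) (a : Fin n) :
    (partners k σ a).Pairwise fun b b' => σ b < σ b' := by
  refine List.Pairwise.filter _ ?_
  rw [List.pairwise_map]
  exact (List.pairwise_lt_finRange n).imp fun h => by simpa using h

/-- The product of the transpositions in `W k σ` that move the entry `v`. -/
noncomputable def entryProd (k : ℕ) (σ : Perm (Fin n)) (v : Fin n) : Perm (Fin n) :=
  ((partners k σ (σ.symm v)).map fun b => swap (σ.symm v) b).prod

/-- `W` is grouped by the entry moved, so that one factor corresponds to lowering the threshold by
one. -/
theorem eta_eq (k : ℕ) (σ : Perm (Fin n)) :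
    eta k σ = σ * ((List.finRange n).reverse.map (entryProd k σ)).prod := by
  rw [eta, W, allPairs, List.filter_flatMap, List.map_flatMap, List.flatMap, List.prod_flatten,
    List.map_map]
  congr 3
  funext v
  simp only [Function.comp_apply, entryProd, partners, List.filter_map, List.map_map]
  rfl

/-- With the first block frozen, nothing can balance a fall in the second. -/
theorem inPieri_bot {k : ℕ} {σ μ : Perm (Fin n)} (h : InPieri k σ n μ) : μ = σ := by
  ext c
  rcases lt_or_ge c.val k with hc | hc
  · rw [((h c).1 hc).2.2 (σ c).isLt]
  · have h1 := Fin.le_def.1 ((h c).2 hc).1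
    by_contra hne
    obtain ⟨f, f1, f2, f3⟩ := (h.exists_cross_iff (σ c).val).2 ⟨c, hc, by omega, le_rfl⟩
    rw [((h f).1 f1).2.2 (σ f).isLt] at f3
    omega

theorem inPieri_self (k : ℕ) (σ : Perm (Fin n)) (v : ℕ) : InPieri k σ v σ :=
  fun _ => ⟨fun _ => ⟨le_rfl, fun _ _ _ h => h, fun _ => rfl⟩, fun _ => ⟨le_rfl, fun _ _ _ h => h⟩⟩

/-- Downward induction on the threshold: at `n` only `σ` is left, and passing from `m + 1` to `m`
frees the position of the entry `m`. If that position is in the second block, neither the set nor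
the product changes. -/
theorem exists_partial_eta (k : ℕ) (σ : Perm (Fin n)) (m : ℕ) (hm : m ≤ n) :
    let w := σ * (((List.finRange n).drop m).reverse.map (entryProd k σ)).prod
    InPieri k σ m w ∧ ∀ μ, InPieri k σ m μ → RkLE μ w := by
  induction hm using Nat.decreasingInduction with
  | self =>
    have : (List.finRange n).drop n = [] := by simp
    simp only [this, List.reverse_nil, List.map_nil, List.prod_nil, mul_one]
    exact ⟨inPieri_self k σ n, fun μ h => by rw [inPieri_bot h]; exact fun _ _ => le_rfl⟩
  | of_succ m hm ih =>
    have hd : (List.finRange n).drop m = ⟨m, hm⟩ :: (List.finRange n).drop (m + 1) := by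
      rw [List.drop_eq_getElem_cons (by simpa using hm)]
      simp
    simp only [hd, List.reverse_cons, List.map_append, List.map_cons, List.map_nil,
      List.prod_append, List.prod_cons, List.prod_nil, mul_one, ← mul_assoc]
    set w := σ * (((List.finRange n).drop (m + 1)).reverse.map (entryProd k σ)).prod
    set a := σ.symm ⟨m, hm⟩ with ha
    have hσa : (σ a).val = m := by simp [a]
    by_cases hak : a.val < k
    · have := InPieri.max_step (k := k) (σ := σ) hak (w := w) (by rw [hσa]; exact ih.1)
        (by rw [hσa]; exact ih.2) (partners k σ a)
        (fun b => by rw [mem_partners]; exact and_iff_right hak) (partners_pairwise k σ a)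
      rw [hσa] at this
      exact this
    · have h1 : entryProd k σ ⟨m, hm⟩ = 1 := by
        have : partners k σ a = [] := by
          refine List.eq_nil_iff_forall_not_mem.2 fun b hb => hak (mem_partners.1 hb).1
        rw [entryProd, ← ha, this]
        rfl
      rw [h1, mul_one]
      refine ⟨ih.1.mono (Nat.le_succ m), fun μ hμ => ih.2 μ fun c => ⟨fun hc => ?_, (hμ c).2⟩⟩
      refine ⟨((hμ c).1 hc).1, ((hμ c).1 hc).2.1, fun h => ((hμ c).1 hc).2.2 ?_⟩
      refine lt_of_le_of_ne (Nat.lt_succ_iff.1 h) fun e => hak ?_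
      have : c = a := σ.injective (Fin.ext (by rw [e, hσa]))
      rwa [← this]

theorem inPieri_eta (k : ℕ) (σ : Perm (Fin n)) : InPieri k σ 0 (eta k σ) := by
  rw [eta_eq]
  exact (exists_partial_eta k σ 0 (Nat.zero_le n)).1

theorem InPieri.rkLE_eta {k : ℕ} {σ μ : Perm (Fin n)} (h : InPieri k σ 0 μ) :
    RkLE μ (eta k σ) := by
  rw [eta_eq]
  exact (exists_partial_eta k σ 0 (Nat.zero_le n)).2 μ h

/-- A smaller entry to the left of `p` may not reach `σ p`, so none crosses it. All members of the
set thus share this rank, and `InPieri.of_rkLE` recovers the bounds from such equalities. -/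
theorem InPieri.rk_succ_left {k v : ℕ} {σ η : Perm (Fin n)} (h : InPieri k σ v η) {p : Fin n}
    (hp : p.val < k) : rk η p (σ p).val = rk σ p (σ p).val := by
  rw [h.rk_of_le hp.le, Nat.add_eq_left, Finset.card_eq_zero, Finset.filter_eq_empty_iff]
  rintro c - ⟨h1, h2, h3⟩
  have := Fin.lt_def.1 (((h c).1 (by omega)).2.1 p (Fin.lt_def.2 h1) hp (Fin.lt_def.2 h2))
  omega

theorem InPieri.rk_succ_right {k v : ℕ} {σ η : Perm (Fin n)} (h : InPieri k σ v η) {p : Fin n}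
    (hp : k ≤ p.val) :
    rk η (p.val + 1) ((σ p).val + 1) = rk σ (p.val + 1) ((σ p).val + 1) := by
  rw [h.rk_of_ge (by omega), Nat.add_eq_left, Finset.card_eq_zero, Finset.filter_eq_empty_iff]
  rintro c - ⟨h1, h2, h3⟩
  have := Fin.lt_def.1 (((h c).2 (by omega)).2 p hp (Fin.lt_def.2 h1) (Fin.lt_def.2 h3))
  omega

/-- The Pieri set is an order ideal of the permutations above `σ`. -/
theorem InPieri.of_rkLE {k : ℕ} {σ μ η : Perm (Fin n)} (h : InPieri k σ 0 η) (h1 : RkLE σ μ)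
    (h2 : RkLE μ η) : InPieri k σ 0 μ := by
  -- The ranks of `μ` at these corners are squeezed between those of `σ` and `η`, which agree.
  have eqL : ∀ p : Fin n, p.val < k → rk μ p (σ p).val = rk σ p (σ p).val := fun p hp =>
    le_antisymm ((h2 _ _).trans (h.rk_succ_left hp).le) (h1 _ _)
  have eqR : ∀ p : Fin n, k ≤ p.val →
      rk μ (p.val + 1) ((σ p).val + 1) = rk σ (p.val + 1) ((σ p).val + 1) := fun p hp =>
    le_antisymm ((h2 _ _).trans (h.rk_succ_right hp).le) (h1 _ _)
  have hL : ∀ p : Fin n, p.val < k → σ p ≤ μ p := by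
    intro p hp
    have h3 := h1 (p + 1) (σ p)
    rw [rk_succ, rk_succ, eqL p hp, if_pos le_rfl] at h3
    rw [Fin.le_def]
    by_contra h'
    rw [if_neg h'] at h3
    omega
  have hR : ∀ p : Fin n, k ≤ p.val → μ p ≤ σ p := by
    intro p hp
    have h3 := h1 p ((σ p).val + 1)
    have h4 := eqR p hp
    rw [rk_succ, rk_succ] at h4
    rw [Fin.le_def]
    by_contra h'
    rw [if_pos (by omega), if_neg (by omega)] at h4
    omega
  refine fun c => ⟨fun hc => ⟨hL c hc, fun p p1 p2 p3 => ?_, fun h => by omega⟩,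
    fun hc => ⟨hR c hc, fun p p1 p2 p3 => ?_⟩⟩
  · have h3 := eqL p p2
    by_contra h'
    have hlt : rk σ p (σ p).val < rk μ p (σ p).val := by
      refine Finset.card_lt_card ((Finset.ssubset_iff_of_subset ?_).2 ⟨c, ?_, ?_⟩)
      · intro d hd
        simp only [Finset.mem_filter, Finset.mem_univ, true_and] at hd ⊢
        exact ⟨hd.1, hd.2.trans (Fin.le_def.1 (hL d (by omega)))⟩
      · simpa using ⟨p1, not_lt.1 h'⟩
      · simpa using fun _ => p3
    omega
  · have h3 := eqR p p1
    have h4 := rk_add_card_compl μ (p.val + 1) ((σ p).val + 1)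
    have h5 := rk_add_card_compl σ (p.val + 1) ((σ p).val + 1)
    rw [GrothPieri.rk_of_le μ σ le_rfl] at h4
    by_contra h'
    have hlt : (Finset.univ.filter fun d : Fin n => p.val + 1 ≤ d.val ∧
          (σ p).val + 1 ≤ (μ d).val).card <
        (Finset.univ.filter fun d : Fin n => p.val + 1 ≤ d.val ∧
          (σ p).val + 1 ≤ (σ d).val).card := by
      refine Finset.card_lt_card ((Finset.ssubset_iff_of_subset ?_).2 ⟨c, ?_, ?_⟩)
      · intro d hd
        simp only [Finset.mem_filter, Finset.mem_univ, true_and] at hd ⊢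
        exact ⟨hd.1, hd.2.trans (Fin.le_def.1 (hR d (by omega)))⟩
      · simp only [Finset.mem_filter, Finset.mem_univ, true_and]
        exact ⟨p2, p3⟩
      · simp only [Finset.mem_filter, Finset.mem_univ, true_and]
        rw [not_lt, Fin.le_def] at h'
        omega
    omega

theorem mem_bruhatInterval_eta {k : ℕ} {σ μ : Perm (Fin n)} :
    μ ∈ bruhatInterval σ (eta k σ) ↔ InPieri k σ 0 μ := by
  simp only [bruhatInterval, Finset.mem_filter, Finset.mem_univ, true_and, bruhatLE_iff]
  exact ⟨fun h => (inPieri_eta k σ).of_rkLE h.1 h.2, fun h => ⟨h.rkLE, h.rkLE_eta⟩⟩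

/-! ### Independence of the reduced word -/

theorem simple_apply_of_ne {i : Fin (n - 1)} {c : Fin n} (h1 : c.val ≠ i.val)
    (h2 : c.val ≠ i.val + 1) : simple i c = c :=
  swap_apply_of_ne_of_ne (fun e => h1 (congrArg Fin.val e)) (fun e => h2 (congrArg Fin.val e))

theorem simple_comm {i j : Fin (n - 1)} (h : i.val + 1 < j.val) :
    simple i * simple j = simple j * simple i := by
  rw [simple_eq j, mul_swap_eq_swap_mul,
    simple_apply_of_ne (c := lo j) (by simp; omega) (by simp; omega),
    simple_apply_of_ne (c := hi j) (by simp; omega) (by simp; omega)]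

theorem simple_braid {i j : Fin (n - 1)} (h : i.val + 1 = j.val) :
    simple i * simple j * simple i = simple j * simple i * simple j := by
  have e0 : hi i = lo j := Fin.ext h
  have h1 : lo i ≠ lo j := e0 ▸ lo_ne_hi i
  have h2 : lo i ≠ hi j := fun e => by have := congrArg Fin.val e; simp at this; omega
  rw [simple_eq, simple_eq, e0, swap_mul_swap_mul_swap h1 h2, swap_comm (lo i) (lo j),
    swap_comm (lo j) (hi j), swap_mul_swap_mul_swap (lo_ne_hi j).symm h2.symm, swap_comm]

section Words

variable {X : Type*} {op : Fin (n - 1) → X → X}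

/-- The prefix is a reduced word of `w` with both descents removed. Together with the braid case
below, this is the confluence step for reduced words. -/
theorem exists_common_prefix_comm {w : Perm (Fin n)} {i j : Fin (n - 1)} (hij : i.val + 1 < j.val)
    (hi' : w (hi i) < w (lo i)) (hj : w (hi j) < w (lo j)) :
    ∃ z, IsReducedWord (z ++ [j]) (w * simple i) ∧ IsReducedWord (z ++ [i]) (w * simple j) := by
  obtain ⟨z, hz⟩ := exists_reducedWord (w * simple i * simple j)
  have e1 : simple i (lo j) = lo j := simple_apply_of_ne (by simp; omega) (by simp; omega)
  have e2 : simple i (hi j) = hi j := simple_apply_of_ne (by simp; omega) (by simp; omega)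
  have e3 : simple j (lo i) = lo i := simple_apply_of_ne (by simp; omega) (by simp; omega)
  have e4 : simple j (hi i) = hi i := simple_apply_of_ne (by simp; omega) (by simp; omega)
  refine ⟨z, ?_, ?_⟩
  · have := isReducedWord_append_singleton (i := j) hz (by simpa [e1, e2] using hj)
    simpa using this
  · have := isReducedWord_append_singleton (i := i) hz (by simpa [e3, e4] using hi')
    rwa [mul_assoc w, simple_comm hij, ← mul_assoc, mul_simple_mul_simple] at this

theorem exists_common_prefix_braid {w : Perm (Fin n)} {i j : Fin (n - 1)}
    (hij : i.val + 1 = j.val) (hi' : w (hi i) < w (lo i)) (hj : w (hi j) < w (lo j)) :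
    ∃ z, IsReducedWord (z ++ [i] ++ [j]) (w * simple i) ∧
      IsReducedWord (z ++ [j] ++ [i]) (w * simple j) := by
  obtain ⟨z, hz⟩ := exists_reducedWord (w * simple i * simple j * simple i)
  have e0 : hi i = lo j := Fin.ext hij
  have e1 : simple i (hi j) = hi j := simple_apply_of_ne (by simp; omega) (by simp; omega)
  have e2 : simple j (lo i) = lo i := simple_apply_of_ne (by simp; omega) (by simp; omega)
  have e3 : simple i (lo j) = lo i := by rw [← e0, simple_hi]
  have e4 : simple j (hi i) = hi j := by rw [e0, simple_lo]
  have e5 : simple i (lo i) = lo j := by rw [simple_lo, e0]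
  refine ⟨z, ?_, ?_⟩
  · have h1 := isReducedWord_append_singleton (i := i) hz
      (by simpa [-simple_lo, e0, e1, e2, e3, e4, e5, simple_lo j] using hj)
    have h2 := isReducedWord_append_singleton (i := j) h1
      (by
        rw [e0] at hi'
        simpa [-simple_lo, e0, e1, e2, e3, e4, e5, simple_lo j] using hj.trans hi')
    simpa using h2
  · have h1 := isReducedWord_append_singleton (i := j) hz
      (by
        rw [e0] at hi'
        simpa [-simple_lo, e0, e1, e2, e3, e4, e5, simple_lo j] using hi')
    have h2 := isReducedWord_append_singleton (i := i) h1
      (by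
        rw [e0] at hi'
        simpa [-simple_lo, e0, e1, e2, e3, e4, e5, simple_lo j] using hj.trans hi')
    have e6 : w * simple i * simple j * simple i * simple j * simple i = w * simple j := by
      calc w * simple i * simple j * simple i * simple j * simple i
          = w * (simple i * simple j * simple i) * simple j * simple i := by
            simp only [mul_assoc]
        _ = w * simple j * simple i * simple j * simple j * simple i := by
            rw [simple_braid hij]; simp only [mul_assoc]
        _ = w * simple j := by simp
    rwa [e6] at h2

/-- Operators satisfying the braid relations compose to the same operator along any two reduced
words of a permutation. -/
theorem foldl_eq_of_isReducedWord
    (hcomm : ∀ i j : Fin (n - 1), i.val + 1 < j.val → ∀ f, op i (op j f) = op j (op i f))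
    (hbraid : ∀ i j : Fin (n - 1), i.val + 1 = j.val →
      ∀ f, op i (op j (op i f)) = op j (op i (op j f))) (f : X) :
    ∀ (l l' : List (Fin (n - 1))) (w : Perm (Fin n)), IsReducedWord l w → IsReducedWord l' w →
      l.foldl (fun g i => op i g) f = l'.foldl (fun g i => op i g) f := by
  intro l
  generalize hN : l.length = N
  induction N generalizing l with
  | zero =>
    intro l' w h h'
    have : l'.length = 0 := by rw [h'.2, ← h.2, hN]
    rw [List.length_eq_zero_iff.1 hN, List.length_eq_zero_iff.1 this]
  | succ N ih =>
    -- Distinct last letters are two descents of `w`. By induction each prefix may be replaced by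
    -- one that extends a common word, after which a single commutation or braid relation identifies
    -- the results.
    have aux : ∀ (u u' : List (Fin (n - 1))) (i j : Fin (n - 1)) (w : Perm (Fin n)), i < j →
        u.length = N → u'.length = N → IsReducedWord (u ++ [i]) w → IsReducedWord (u' ++ [j]) w →
        (u ++ [i]).foldl (fun g i => op i g) f = (u' ++ [j]).foldl (fun g i => op i g) f := by
      intro u u' i j w hij hu hu' h h'
      obtain ⟨d, r⟩ := h.of_append_singleton
      obtain ⟨d', r'⟩ := h'.of_append_singleton
      rcases eq_or_lt_of_le (Nat.succ_le_of_lt (Fin.lt_def.1 hij)) with hc | hc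
      · obtain ⟨z, z1, z2⟩ := exists_common_prefix_braid hc d d'
        rw [List.foldl_append, List.foldl_append, ih u hu _ _ r z1, ih u' hu' _ _ r' z2]
        simpa using hbraid i j hc _
      · obtain ⟨z, z1, z2⟩ := exists_common_prefix_comm hc d d'
        rw [List.foldl_append, List.foldl_append, ih u hu _ _ r z1, ih u' hu' _ _ r' z2]
        simpa using hcomm i j hc _
    intro l' w h h'
    have hN' : l'.length = N + 1 := by rw [h'.2, ← h.2, hN]
    rcases List.eq_nil_or_concat l with rfl | ⟨u, i, rfl⟩
    · simp at hN
    rcases List.eq_nil_or_concat l' with rfl | ⟨u', j, rfl⟩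
    · simp at hN'
    simp only [List.concat_eq_append, List.length_append, List.length_singleton,
      Nat.add_right_cancel_iff] at h h' hN hN' ⊢
    rcases lt_trichotomy i j with hij | hij | hij
    · exact aux u u' i j w hij hN hN' h h'
    · subst hij
      rw [List.foldl_append, List.foldl_append,
        ih u hN _ _ h.of_append_singleton.2 h'.of_append_singleton.2]
    · exact (aux u' u j i w hij hN' hN h' h).symm

end Words

/-! ### Relations between the isobaric divided differences -/

theorem ratY_injective : Function.Injective (ratY (n := n)) := by
  intro i j h
  exact Sum.inr_injective (MvPolynomial.X_injective (IsFractionRing.injective _ _ h))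

theorem ratFun_hom_ext {φ ψ : RatFun n →+* RatFun n} (hx : ∀ i, φ (ratX i) = ψ (ratX i))
    (hy : ∀ i, φ (ratY i) = ψ (ratY i)) : φ = ψ := by
  refine IsLocalization.ringHom_ext (nonZeroDivisors (MvPolynomial (Fin n ⊕ Fin n) ℤ)) ?_
  refine MvPolynomial.ringHom_ext (fun r => by simp) ?_
  rintro (i | i)
  · exact hx i
  · exact hy i

theorem permX_mul (σ τ : Perm (Fin n)) (f : RatFun n) :
    permX (σ * τ) f = permX σ (permX τ f) := by
  have : (permX (σ * τ) : RatFun n →+* RatFun n) =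
      (permX σ : RatFun n →+* RatFun n).comp (permX τ : RatFun n →+* RatFun n) :=
    ratFun_hom_ext (fun i => by simp [permX_ratX]) (fun i => by simp [permX_ratY])
  exact congrArg (fun φ : RatFun n →+* RatFun n => φ f) this

theorem permX_one (f : RatFun n) : permX (1 : Perm (Fin n)) f = f := by
  have : (permX (1 : Perm (Fin n)) : RatFun n →+* RatFun n) = RingHom.id _ :=
    ratFun_hom_ext (fun i => by simp [permX_ratX]) (fun i => by simp [permX_ratY])
  exact congrArg (fun φ : RatFun n →+* RatFun n => φ f) this

theorem permX_simple_simple (i : Fin (n - 1)) (f : RatFun n) :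
    permX (simple i) (permX (simple i) f) = f := by
  rw [← permX_mul, simple_mul_self, permX_one]

theorem ratX_sub_ne_zero {i j : Fin n} (h : i ≠ j) : ratX i - ratX j ≠ 0 :=
  sub_ne_zero.2 fun e => h (ratX_injective e)

theorem coe_x (i : Fin n) : ((x i : Laurent n) : RatFun n) = ratX i := rfl

theorem coe_y (i : Fin n) : ((y i : Laurent n) : RatFun n) = ratY i := rfl

theorem coe_xInv (i : Fin n) : ((xInv i : Laurent n) : RatFun n) = (ratX i)⁻¹ := rfl

theorem coe_piOp (i : Fin (n - 1)) (f : Laurent n) :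
    (piOp i f : RatFun n) = (ratX (lo i) * f - ratX (hi i) * permX (simple i) f) /
      (ratX (lo i) - ratX (hi i)) := by
  change ratDiv i (ratX (lo i) * (f : RatFun n)) = _
  rw [ratDiv, map_mul, permX_ratX, simple_lo]
  rfl

theorem hatPiOp_eq (i : Fin (n - 1)) (f : Laurent n) : hatPiOp i f = piOp i f - f := by
  apply Subtype.ext
  rw [Subalgebra.coe_sub, coe_piOp]
  change ratX (hi i) * ratDiv i (f : RatFun n) = _
  rw [ratDiv]
  change ratX (hi i) * (((f : RatFun n) - permX (simple i) f) / (ratX (lo i) - ratX (hi i))) = _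
  have := ratX_sub_ne_zero (lo_ne_hi i)
  field_simp
  ring

theorem piOp_piOp (i : Fin (n - 1)) (f : Laurent n) : piOp i (piOp i f) = piOp i f := by
  apply Subtype.ext
  rw [coe_piOp, coe_piOp, map_div₀, map_sub, map_sub, map_mul, map_mul, permX_ratX, permX_ratX,
    simple_lo, simple_hi, permX_simple_simple]
  have h1 := ratX_sub_ne_zero (lo_ne_hi i)
  have h2 := ratX_sub_ne_zero (lo_ne_hi i).symm
  field_simp
  ring

theorem piOp_sum {ι : Type*} (i : Fin (n - 1)) (s : Finset ι) (f : ι → Laurent n) :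
    piOp i (∑ a ∈ s, f a) = ∑ a ∈ s, piOp i (f a) := by
  apply Subtype.ext
  rw [coe_piOp]
  simp only [AddSubmonoidClass.coe_finsetSum, coe_piOp, map_sum, Finset.mul_sum,
    ← Finset.sum_sub_distrib, Finset.sum_div]

theorem piOp_mul_of_fixed {i : Fin (n - 1)} {g : Laurent n}
    (hg : permX (simple i) (g : RatFun n) = g) (f : Laurent n) :
    piOp i (g * f) = g * piOp i f := by
  apply Subtype.ext
  rw [Subalgebra.coe_mul, coe_piOp, coe_piOp, Subalgebra.coe_mul, map_mul, hg]
  ring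

theorem piOp_sub (i : Fin (n - 1)) (f g : Laurent n) : piOp i (f - g) = piOp i f - piOp i g := by
  apply Subtype.ext
  simp only [coe_piOp, Subalgebra.coe_sub, map_sub]
  ring

theorem piOp_comm {i j : Fin (n - 1)} (h : i.val + 1 < j.val) (f : Laurent n) :
    piOp i (piOp j f) = piOp j (piOp i f) := by
  have e1 : simple i (lo j) = lo j := simple_apply_of_ne (by simp; omega) (by simp; omega)
  have e2 : simple i (hi j) = hi j := simple_apply_of_ne (by simp; omega) (by simp; omega)
  have e3 : simple j (lo i) = lo i := simple_apply_of_ne (by simp; omega) (by simp; omega)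
  have e4 : simple j (hi i) = hi i := simple_apply_of_ne (by simp; omega) (by simp; omega)
  apply Subtype.ext
  simp only [coe_piOp, map_div₀, map_sub, map_mul, permX_ratX, e1, e2, e3, e4, ← permX_mul,
    simple_comm h]
  have h1 := ratX_sub_ne_zero (lo_ne_hi i)
  have h2 := ratX_sub_ne_zero (lo_ne_hi j)
  field_simp
  ring

theorem piOp_braid {i j : Fin (n - 1)} (h : i.val + 1 = j.val) (f : Laurent n) :
    piOp i (piOp j (piOp i f)) = piOp j (piOp i (piOp j f)) := by
  have e0 : hi i = lo j := Fin.ext h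
  have e1 : simple i (hi j) = hi j := simple_apply_of_ne (by simp; omega) (by simp; omega)
  have e2 : simple j (lo i) = lo i := simple_apply_of_ne (by simp; omega) (by simp; omega)
  have e3 : simple i (lo j) = lo i := by rw [← e0, simple_hi]
  have e5 : simple i (lo i) = lo j := by rw [simple_lo, e0]
  have hb : ∀ g : RatFun n, permX (simple i) (permX (simple j) (permX (simple i) g)) =
      permX (simple j) (permX (simple i) (permX (simple j) g)) := fun g => by
    simp only [← permX_mul, ← mul_assoc, simple_braid h]
  apply Subtype.ext
  simp only [coe_piOp, map_div₀, map_sub, map_mul, permX_ratX, e0, e1, e2, e3, e5, simple_lo j,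
    simple_hi j, permX_simple_simple, hb]
  have h1 : ratX (lo i) - ratX (lo j) ≠ 0 := ratX_sub_ne_zero (by rw [← e0]; exact lo_ne_hi i)
  have h2 := ratX_sub_ne_zero (lo_ne_hi j)
  have h3 : ratX (lo i) - ratX (hi j) ≠ 0 := ratX_sub_ne_zero fun e => by
    have := congrArg Fin.val e; simp at this; omega
  have h4 : ratX (lo j) - ratX (lo i) ≠ 0 := by rw [← neg_sub]; exact neg_ne_zero.2 h1
  have h5 : ratX (hi j) - ratX (lo j) ≠ 0 := by rw [← neg_sub]; exact neg_ne_zero.2 h2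
  field_simp
  ring

theorem piPerm_eq_foldl {l : List (Fin (n - 1))} {w : Perm (Fin n)} (h : IsReducedWord l w)
    (f : Laurent n) : piPerm w f = l.foldl (fun g i => piOp i g) f :=
  foldl_eq_of_isReducedWord (op := piOp) (fun _ _ h f => piOp_comm h f)
    (fun _ _ h f => piOp_braid h f) f _ _ w (Classical.choose_spec (exists_reducedWord w)) h

theorem piPerm_mul_simple {w : Perm (Fin n)} {i : Fin (n - 1)} (h : w (lo i) < w (hi i))
    (f : Laurent n) : piPerm (w * simple i) f = piOp i (piPerm w f) := by
  obtain ⟨l, hl⟩ := exists_reducedWord w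
  rw [piPerm_eq_foldl (isReducedWord_append_singleton hl h), piPerm_eq_foldl hl,
    List.foldl_append]
  rfl

theorem omega_apply_lt {a b : Fin n} : omega n a < omega n b ↔ b < a := by
  simp [omega]

theorem omega_mul_omega : omega n * omega n = 1 := by
  ext; simp [omega]

theorem piOp_groth_of_descent {μ : Perm (Fin n)} {i : Fin (n - 1)} (h : μ (hi i) < μ (lo i)) :
    piOp i (groth μ) = groth (μ * simple i) := by
  rw [groth, groth, ← mul_assoc, piPerm_mul_simple]
  simpa [omega_apply_lt] using h

/-- G_μ is the image of G_{μsᵢ} under πᵢ, which is idempotent. -/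
theorem piOp_groth_of_ascent {μ : Perm (Fin n)} {i : Fin (n - 1)} (h : μ (lo i) < μ (hi i)) :
    piOp i (groth μ) = groth μ := by
  have h1 := piOp_groth_of_descent (μ := μ * simple i) (i := i) (by simpa using h)
  rw [mul_simple_mul_simple] at h1
  rw [← h1, piOp_piOp]

theorem reducedWord_one : reducedWord (1 : Perm (Fin n)) = [] := by
  have := (Classical.choose_spec (exists_reducedWord (1 : Perm (Fin n)))).2
  rw [len_one] at this
  exact List.length_eq_zero_iff.1 this

theorem groth_omega : groth (omega n) = grothOmega n := by
  rw [groth, omega_mul_omega, piPerm, reducedWord_one]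
  rfl

/-! ### Signed sums of Grothendieck polynomials -/

open Classical in
/-- The permutations with property `P`. -/
noncomputable def permSet (P : Perm (Fin n) → Prop) : Finset (Perm (Fin n)) :=
  Finset.univ.filter P

theorem mem_permSet {P : Perm (Fin n) → Prop} {μ : Perm (Fin n)} : μ ∈ permSet P ↔ P μ := by
  simp [permSet]

/-- The sum of `(-1)^(ℓ(μ) + m) G_μ` over the permutations `μ` with property `P`. -/
noncomputable def signedSum (P : Perm (Fin n) → Prop) (m : ℕ) : Laurent n :=
  ∑ μ ∈ permSet P, (-1) ^ (len μ + m) * groth μ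

theorem signedSum_congr {P Q : Perm (Fin n) → Prop} (h : ∀ μ, P μ ↔ Q μ) (m : ℕ) :
    signedSum P m = signedSum Q m := by
  rw [show P = Q from funext fun μ => propext (h μ)]

theorem signedSum_or {P Q : Perm (Fin n) → Prop} (h : ∀ μ, P μ → ¬ Q μ) (m : ℕ) :
    signedSum (fun μ => P μ ∨ Q μ) m = signedSum P m + signedSum Q m := by
  have : permSet (fun μ => P μ ∨ Q μ) = permSet P ∪ permSet Q := by
    ext μ; simp [mem_permSet]
  rw [signedSum, signedSum, signedSum, this, Finset.sum_union]
  rw [Finset.disjoint_left]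
  exact fun μ h1 h2 => h μ (mem_permSet.1 h1) (mem_permSet.1 h2)

theorem signedSum_succ (P : Perm (Fin n) → Prop) (m : ℕ) :
    signedSum P (m + 1) = -signedSum P m := by
  rw [signedSum, signedSum, ← Finset.sum_neg_distrib]
  refine Finset.sum_congr rfl fun μ _ => ?_
  rw [← add_assoc, pow_succ]
  ring

theorem piOp_neg_one_pow_mul (i : Fin (n - 1)) (m : ℕ) (f : Laurent n) :
    piOp i ((-1) ^ m * f) = (-1) ^ m * piOp i f :=
  piOp_mul_of_fixed (by simp) f

/-- Terms at ascents are fixed, and terms at descents move down by sᵢ with opposite sign. Closure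
under going up makes every fixed term meet one that has moved down, and they cancel; what survives
came down to a permutation outside `P`. -/
theorem piOp_signedSum {i : Fin (n - 1)} {P : Perm (Fin n) → Prop}
    (hP : ∀ μ, P μ → μ (lo i) < μ (hi i) → P (μ * simple i)) (m : ℕ) :
    piOp i (signedSum P (m + 1)) =
      signedSum (fun ν => ν (lo i) < ν (hi i) ∧ P (ν * simple i) ∧ ¬ P ν) m := by
  set Asc : Perm (Fin n) → Prop := fun μ => P μ ∧ μ (lo i) < μ (hi i)
  set Desc : Perm (Fin n) → Prop := fun μ => P μ ∧ μ (hi i) < μ (lo i)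
  have h1 : signedSum P (m + 1) = signedSum Asc (m + 1) + signedSum Desc (m + 1) := by
    rw [← signedSum_or fun μ h h' => lt_asymm h.2 h'.2]
    refine signedSum_congr (fun μ => ?_) _
    have := lo_lt_or_hi_lt μ i
    tauto
  have h2 : piOp i (signedSum Asc (m + 1)) = signedSum Asc (m + 1) := by
    rw [signedSum, piOp_sum]
    refine Finset.sum_congr rfl fun μ hμ => ?_
    rw [piOp_neg_one_pow_mul, piOp_groth_of_ascent (mem_permSet.1 hμ).2]
  have h3 : piOp i (signedSum Desc (m + 1)) =
      signedSum (fun ν => ν (lo i) < ν (hi i) ∧ P (ν * simple i)) m := by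
    rw [signedSum, signedSum, piOp_sum]
    refine Finset.sum_nbij' (fun μ => μ * simple i) (fun μ => μ * simple i) ?_ ?_ ?_ ?_ ?_
    · intro μ hμ
      simpa [mem_permSet, Desc, and_comm] using hμ
    · intro μ hμ
      simpa [mem_permSet, Desc, and_comm] using hμ
    · intro μ _; simp
    · intro μ _; simp
    · intro μ hμ
      have hd := (mem_permSet.1 hμ).2
      rw [piOp_neg_one_pow_mul, piOp_groth_of_descent hd, len_of_descent hd]
      congr 1
      rw [show len (μ * simple i) + 1 + (m + 1) = len (μ * simple i) + m + 2 by ring, pow_add]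
      simp
  have h4 : signedSum (fun ν => ν (lo i) < ν (hi i) ∧ P (ν * simple i)) m =
      signedSum Asc m +
        signedSum (fun ν => ν (lo i) < ν (hi i) ∧ P (ν * simple i) ∧ ¬ P ν) m := by
    rw [← signedSum_or fun μ h h' => h'.2.2 h.1]
    refine signedSum_congr (fun μ => ?_) _
    have := hP μ
    tauto
  have h5 : piOp i (signedSum Asc (m + 1) + signedSum Desc (m + 1)) =
      piOp i (signedSum Asc (m + 1)) + piOp i (signedSum Desc (m + 1)) := by
    have := piOp_sub i (signedSum Asc (m + 1) + signedSum Desc (m + 1)) (signedSum Desc (m + 1))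
    rw [add_sub_cancel_right] at this
    rw [this, sub_add_cancel]
  rw [h1, h5, h2, h3, h4, signedSum_succ]
  ring

/-! ### Applying the operators `π̂` -/

/-- Lifting property. Only `p = i + 1` matters, where `ν` has its larger entry first: if that entry
reaches `q`, compare ranks at `i`; if not, neither entry does, and ranks at `i + 2` decide. -/
theorem RkLE.mul_simple_left {σ ν : Perm (Fin n)} {i : Fin (n - 1)} (h : RkLE σ ν)
    (hσ : σ (lo i) < σ (hi i)) (hν : ν (hi i) < ν (lo i)) : RkLE (σ * simple i) ν := by
  intro p q
  rw [simple_eq, rk_mul_swap (lo_lt_hi i) hσ]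
  split_ifs with hc
  · obtain ⟨c1, c2, c3, c4⟩ := hc
    have hp : p = i.val + 1 := by simp at c1 c2; omega
    subst hp
    have s1 := rk_succ σ (lo i) q
    have s2 := rk_succ σ (hi i) q
    have n1 := rk_succ ν (lo i) q
    have n2 := rk_succ ν (hi i) q
    have h1 := h i.val q
    have h2 := h (i.val + 1 + 1) q
    rw [Fin.lt_def] at hν hσ
    simp only [lo_val, hi_val] at s1 s2 n1 n2
    rw [if_neg (by omega)] at s1
    rw [if_pos c4] at s2
    by_cases hq : q ≤ (ν (lo i)).val
    · rw [if_pos hq] at n1; omega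
    · rw [if_neg (by omega)] at n1 n2; omega
  · exact h p q

theorem RkLE.of_mul_simple {σ ν : Perm (Fin n)} {i : Fin (n - 1)}
    (h : RkLE (σ * simple i) (ν * simple i)) (hσ : σ (lo i) < σ (hi i))
    (hν : ν (lo i) < ν (hi i)) : RkLE σ ν := by
  intro p q
  have h0 := h p q
  rw [simple_eq, rk_mul_swap (lo_lt_hi i) hσ, rk_mul_swap (lo_lt_hi i) hν] at h0
  by_cases hp : p = i.val + 1
  · subst hp
    have s1 := rk_succ σ (lo i) q
    have s2 := rk_succ σ (hi i) q
    have n1 := rk_succ ν (lo i) q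
    have n2 := rk_succ ν (hi i) q
    have h1 := h i.val q
    have h2 := h (i.val + 1 + 1) q
    rw [simple_eq, rk_mul_swap (lo_lt_hi i) hσ, rk_mul_swap (lo_lt_hi i) hν,
      if_neg (by simp), if_neg (by simp)] at h1 h2
    rw [Fin.lt_def] at hν hσ
    simp only [lo_val, hi_val] at s1 s2 n1 n2
    split_ifs at s1 s2 n1 n2 <;> omega
  · rw [if_neg (by simp; omega), if_neg (by simp; omega)] at h0
    exact h0

theorem rkLE_mul_simple_self {σ : Perm (Fin n)} {i : Fin (n - 1)} (h : σ (lo i) < σ (hi i)) :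
    RkLE σ (σ * simple i) := rkLE_mul_swap (lo_lt_hi i) h

/-- The second alternative is the remainder in `piOp_signedSum` for the elements above `σ * simple
i`; the term -1 in π̂ᵢ = πᵢ - 1 contributes the first. -/
theorem rkLE_iff_of_ascent {σ ν : Perm (Fin n)} {i : Fin (n - 1)} (hσ : σ (lo i) < σ (hi i)) :
    RkLE σ ν ↔ (RkLE (σ * simple i) ν ∨
      (ν (lo i) < ν (hi i) ∧ RkLE (σ * simple i) (ν * simple i) ∧ ¬ RkLE (σ * simple i) ν)) := by
  constructor
  · intro h
    by_cases h' : RkLE (σ * simple i) ν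
    · exact Or.inl h'
    · right
      rcases lo_lt_or_hi_lt ν i with hν | hν
      · exact ⟨hν, (h.trans (rkLE_mul_simple_self hν)).mul_simple_left hσ (by simpa using hν), h'⟩
      · exact absurd (h.mul_simple_left hσ hν) h'
  · rintro (h | ⟨h1, h2, -⟩)
    · exact (rkLE_mul_simple_self hσ).trans h
    · exact h2.of_mul_simple hσ h1

theorem eq_omega_of_rkLE {μ : Perm (Fin n)} (h : RkLE (omega n) μ) : μ = omega n := by
  by_contra hne
  obtain ⟨a, b, h1, h2, -⟩ := h.exists_cover (Ne.symm hne)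
  exact lt_asymm h1 (omega_apply_lt.1 h2)

theorem foldl_hatPiOp (l : List (Fin (n - 1))) : ∀ w : Perm (Fin n), IsReducedWord l w →
    l.foldl (fun g i => hatPiOp i g) (grothOmega n) =
      signedSum (RkLE (omega n * w)) (len (omega n * w)) := by
  induction l using List.reverseRecOn with
  | nil =>
    intro w hw
    have hw1 : w = 1 := hw.1.symm.trans (by simp [wordProd])
    rw [hw1, mul_one, signedSum_congr (Q := fun μ => μ = omega n)
      fun μ => ⟨eq_omega_of_rkLE, fun h => h ▸ fun _ _ => le_rfl⟩, signedSum,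
      show permSet (fun μ => μ = omega n) = {omega n} by ext; simp [mem_permSet],
      Finset.sum_singleton, groth_omega]
    have h1 : (-1 : Laurent n) ^ (len (omega n) + len (omega n)) = 1 :=
      Subtype.ext (Even.neg_one_pow ⟨_, rfl⟩)
    exact ((congrArg (· * grothOmega n) h1).trans (one_mul _)).symm
  | append_singleton u i ih =>
    intro w hw
    obtain ⟨hd, hu⟩ := hw.of_append_singleton
    have ha : (omega n * w) (lo i) < (omega n * w) (hi i) := by simpa [omega_apply_lt] using hd
    rw [List.foldl_append, ih _ hu, ← mul_assoc]
    simp only [List.foldl_cons, List.foldl_nil]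
    rw [hatPiOp_eq, len_mul_simple ha, piOp_signedSum
      (fun μ h h' => h.trans (rkLE_mul_simple_self h')), signedSum_succ, sub_neg_eq_add,
      add_comm, ← signedSum_or fun μ h h' => h'.2.2 h]
    exact signedSum_congr (fun μ => (rkLE_iff_of_ascent ha).symm) _

theorem hatPiPerm_grothOmega (w : Perm (Fin n)) :
    hatPiPerm w (grothOmega n) = signedSum (RkLE (omega n * w)) (len (omega n * w)) :=
  foldl_hatPiOp _ w (Classical.choose_spec (exists_reducedWord w))

/-! ### Coset maxima -/

/-- The entries of `ζ` decrease on the first `k` positions and on the remaining ones. -/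
def BlockDecreasing (k : ℕ) (ζ : Perm (Fin n)) : Prop :=
  ∀ a b : Fin n, a < b → (b.val < k ∨ k ≤ a.val) → ζ b < ζ a

/-- With decreasing blocks the conditions involving a second position are void. The remaining bound
on the entry at `c` is read off from the rank at (c + 1, ζ c) in the first block and at (c, ζ c + 1)
in the second. -/
theorem BlockDecreasing.inPieri_iff {k : ℕ} {ζ μ : Perm (Fin n)} (h : BlockDecreasing k ζ) :
    InPieri k ζ 0 μ ↔ RkLE ζ μ := by
  refine ⟨InPieri.rkLE, fun hle c => ⟨fun hc => ⟨?_, fun p p1 p2 p3 => ?_, fun h => by omega⟩,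
    fun hc => ⟨?_, fun p p1 p2 p3 => ?_⟩⟩⟩
  · by_contra h'
    have h1 := hle (c.val + 1) (ζ c).val
    have h2 : rk μ (c.val + 1) (ζ c).val < rk ζ (c.val + 1) (ζ c).val := by
      refine Finset.card_lt_card ((Finset.ssubset_iff_of_subset ?_).2 ⟨c, ?_, ?_⟩)
      · intro d hd
        simp only [Finset.mem_filter, Finset.mem_univ, true_and] at hd ⊢
        refine ⟨hd.1, ?_⟩
        rcases eq_or_lt_of_le (Nat.lt_succ_iff.1 hd.1) with e | e
        · rw [Fin.ext e]
        · exact (Fin.lt_def.1 (h d c (Fin.lt_def.2 e) (Or.inl hc))).le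
      · simp
      · simpa using h'
    omega
  · exact absurd (h c p p1 (Or.inl p2)) (lt_asymm p3)
  · by_contra h'
    have h1 := hle c.val ((ζ c).val + 1)
    have h2 := rk_add_card_compl ζ c.val ((ζ c).val + 1)
    have h3 := rk_add_card_compl μ c.val ((ζ c).val + 1)
    rw [rk_of_le μ ζ le_rfl] at h3
    have h4 : (Finset.univ.filter fun d : Fin n =>
        c.val ≤ d.val ∧ (ζ c).val + 1 ≤ (ζ d).val).card = 0 := by
      rw [Finset.card_eq_zero, Finset.filter_eq_empty_iff]
      rintro d - ⟨d1, d2⟩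
      rcases eq_or_lt_of_le d1 with e | e
      · rw [Fin.ext e] at d2; omega
      · have := Fin.lt_def.1 (h c d (Fin.lt_def.2 e) (Or.inr hc)); omega
    have h5 : 0 < (Finset.univ.filter fun d : Fin n =>
        c.val ≤ d.val ∧ (ζ c).val + 1 ≤ (μ d).val).card := by
      refine Finset.card_pos.2 ⟨c, ?_⟩
      rw [not_le, Fin.lt_def] at h'
      simp only [Finset.mem_filter, Finset.mem_univ, true_and]
      omega
    omega
  · exact absurd (h p c p2 (Or.inr p1)) (lt_asymm p3)

/-- In an element of greatest length of the coset, no swap inside a block can go up. -/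
theorem exists_blockDecreasing (k : ℕ) (σ : Perm (Fin n)) :
    ∃ τ ∈ youngSubgroup n k, BlockDecreasing k (σ * τ) := by
  classical
  obtain ⟨τ, hτ, hmax⟩ := Finset.exists_max_image
    (Finset.univ.filter fun τ => τ ∈ youngSubgroup n k) (fun τ => len (σ * τ))
    ⟨1, by simp [one_mem]⟩
  simp only [Finset.mem_filter, Finset.mem_univ, true_and] at hτ hmax
  refine ⟨τ, hτ, fun a b hab hk => ?_⟩
  by_contra h'
  have hlt : (σ * τ) a < (σ * τ) b :=
    lt_of_le_of_ne (not_lt.1 h') fun e => hab.ne ((σ * τ).injective e)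
  have hs : swap a b ∈ youngSubgroup n k := by
    intro c
    rw [swap_apply_def]
    split_ifs with h1 h2
    · rw [h1]; rw [Fin.lt_def] at hab; omega
    · rw [h2]; rw [Fin.lt_def] at hab; omega
    · rfl
  have h1 := hmax (τ * swap a b) (mul_mem hτ hs)
  have h2 := (rkLE_mul_swap hab hlt).len_lt (mul_swap_ne hab.ne)
  rw [mul_assoc] at h2
  omega

theorem rk_mul_of_mem_youngSubgroup {k : ℕ} {σ τ : Perm (Fin n)} (h : τ ∈ youngSubgroup n k)
    (q : ℕ) : rk (σ * τ) k q = rk σ k q := by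
  rw [rk, rk]
  refine Finset.card_nbij' τ τ.symm ?_ ?_ ?_ ?_
  · intro c hc
    have hc := (Finset.mem_filter.1 hc).2
    exact Finset.mem_filter.2 ⟨Finset.mem_univ _, (h c).2 hc.1, hc.2⟩
  · intro c hc
    have hc := (Finset.mem_filter.1 hc).2
    have := h (τ.symm c)
    rw [apply_symm_apply] at this
    exact Finset.mem_filter.2 ⟨Finset.mem_univ _, this.1 hc.1, by simpa using hc.2⟩
  · intro c _; simp
  · intro c _; simp

/-- The ranks at `k` fix the set of entries in each block, and listing each block in decreasing
order maximizes every rank at once. -/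
theorem BlockDecreasing.rkLE {k : ℕ} {ζ ν : Perm (Fin n)} (h : BlockDecreasing k ζ)
    (hν : ∀ q, rk ν k q = rk ζ k q) : RkLE ν ζ := by
  intro p q
  have hmono : ∀ (w : Perm (Fin n)) {p p' : ℕ}, p ≤ p' → rk w p q ≤ rk w p' q := by
    intro w p p' hp
    refine Finset.card_le_card fun c hc => ?_
    simp only [Finset.mem_filter, Finset.mem_univ, true_and] at hc ⊢
    omega
  rcases le_total p k with hp | hp
  · by_cases hc : ∃ c : Fin n, c.val < p ∧ (ζ c).val < q
    · obtain ⟨c, c1, c2⟩ := hc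
      refine (hmono ν hp).trans ((hν q).trans_le (Finset.card_le_card fun d hd => ?_))
      simp only [Finset.mem_filter, Finset.mem_univ, true_and] at hd ⊢
      refine ⟨?_, hd.2⟩
      by_contra hd'
      have := Fin.lt_def.1 (h c d (Fin.lt_def.2 (by omega)) (Or.inl hd.1))
      omega
    · push Not at hc
      refine Finset.card_le_card fun d hd => ?_
      simp only [Finset.mem_filter, Finset.mem_univ, true_and] at hd ⊢
      exact ⟨hd.1, hc d hd.1⟩
  · by_cases hc : ∃ c : Fin n, p ≤ c.val ∧ q ≤ (ζ c).val
    · obtain ⟨c, c1, c2⟩ := hc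
      have split : ∀ w : Perm (Fin n), rk w p q = rk w k q + (Finset.univ.filter fun d : Fin n =>
          (k ≤ d.val ∧ d.val < p) ∧ q ≤ (w d).val).card := by
        intro w
        rw [rk, rk, ← Finset.card_union_of_disjoint]
        · congr 1; ext d; simp; omega
        · rw [Finset.disjoint_filter]; intro d _ _; omega
      rw [split ν, split ζ, hν]
      refine Nat.add_le_add_left (Finset.card_le_card fun d hd => ?_) _
      simp only [Finset.mem_filter, Finset.mem_univ, true_and] at hd ⊢
      have := Fin.lt_def.1 (h d c (Fin.lt_def.2 (by omega)) (Or.inr hd.1.1))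
      exact ⟨hd.1, by omega⟩
    · have h1 := rk_add_card_compl ζ p q
      have h2 := rk_add_card_compl ν p q
      rw [rk_of_le ν ζ le_rfl] at h2
      have h3 : (Finset.univ.filter fun d : Fin n => p ≤ d.val ∧ q ≤ (ζ d).val).card = 0 := by
        rw [Finset.card_eq_zero, Finset.filter_eq_empty_iff]
        exact fun d _ hd => hc ⟨d, hd⟩
      omega

theorem BlockDecreasing.isCosetMax {k : ℕ} {σ τ : Perm (Fin n)} (hτ : τ ∈ youngSubgroup n k)
    (h : BlockDecreasing k (σ * τ)) : IsCosetMax k σ (σ * τ) := by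
  refine ⟨⟨τ, hτ, rfl⟩, fun ρ hρ => RkLE.bruhatLE (h.rkLE fun q => ?_)⟩
  rw [rk_mul_of_mem_youngSubgroup hρ, rk_mul_of_mem_youngSubgroup hτ]

/-! ### Applying the operators `π` -/

section Descent

variable {k : ℕ} {σ : Perm (Fin n)} {i : Fin (n - 1)}

theorem lt_simple_iff {c p : Fin n} (h1 : c ≠ lo i) (h2 : c ≠ hi i) :
    c < simple i p ↔ c < p := by
  have h1' : c.val ≠ i.val := fun e => h1 (Fin.ext e)
  have h2' : c.val ≠ i.val + 1 := fun e => h2 (Fin.ext e)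
  rw [simple_eq, swap_apply_def]
  split_ifs with e1 e2
  · rw [e1, Fin.lt_def, Fin.lt_def, lo_val, hi_val]; omega
  · rw [e2, Fin.lt_def, Fin.lt_def, lo_val, hi_val]; omega
  · rfl

theorem simple_lt_iff {c p : Fin n} (h1 : c ≠ lo i) (h2 : c ≠ hi i) :
    simple i p < c ↔ p < c := by
  have h1' : c.val ≠ i.val := fun e => h1 (Fin.ext e)
  have h2' : c.val ≠ i.val + 1 := fun e => h2 (Fin.ext e)
  rw [simple_eq, swap_apply_def]
  split_ifs with e1 e2
  · rw [e1, Fin.lt_def, Fin.lt_def, lo_val, hi_val]; omega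
  · rw [e2, Fin.lt_def, Fin.lt_def, lo_val, hi_val]; omega
  · rfl

theorem simple_mem_youngSubgroup (hik : i.val + 1 ≠ k) : simple i ∈ youngSubgroup n k := by
  intro c
  rw [simple_eq, swap_apply_def]
  split_ifs with e1 e2
  · rw [e1, lo_val, hi_val]; omega
  · rw [e2, lo_val, hi_val]; omega
  · rfl

theorem allowed_mul_simple_of_ne (hik : i.val + 1 ≠ k) {c : Fin n} (h1 : c ≠ lo i)
    (h2 : c ≠ hi i) (t : Fin n) :
    Allowed k (σ * simple i) 0 c t ↔ Allowed k σ 0 c t := by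
  have hc : simple i c = c := swap_apply_of_ne_of_ne h1 h2
  have hy := simple_mem_youngSubgroup (n := n) hik
  simp only [Allowed, Perm.mul_apply, hc]
  refine and_congr (imp_congr_right fun _ => and_congr_right fun _ => and_congr_left fun _ => ?_)
    (imp_congr_right fun _ => and_congr_right fun _ => ?_)
  · refine (simple i).forall_congr fun p => ?_
    rw [lt_simple_iff h1 h2, hy p]
  · refine (simple i).forall_congr fun p => ?_
    rw [simple_lt_iff h1 h2, ← not_lt, ← not_lt, hy p]

theorem forall_gt_lo_iff {P : Fin n → Prop} :
    (∀ p, lo i < p → P p) ↔ P (hi i) ∧ ∀ p, hi i < p → P p := by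
  refine ⟨fun h => ⟨h _ (lo_lt_hi i), fun p hp => h p ((lo_lt_hi i).trans hp)⟩, fun h p hp => ?_⟩
  rcases eq_or_ne p (hi i) with e | e
  · rw [e]; exact h.1
  · refine h.2 p (Fin.lt_def.2 ?_)
    have h1 := Fin.lt_def.1 hp
    have h2 : p.val ≠ i.val + 1 := fun e' => e (Fin.ext e')
    simp at h1 ⊢
    omega

theorem forall_lt_hi_iff {P : Fin n → Prop} :
    (∀ p, p < hi i → P p) ↔ P (lo i) ∧ ∀ p, p < lo i → P p := by
  refine ⟨fun h => ⟨h _ (lo_lt_hi i), fun p hp => h p (hp.trans (lo_lt_hi i))⟩, fun h p hp => ?_⟩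
  rcases eq_or_ne p (lo i) with e | e
  · rw [e]; exact h.1
  · refine h.2 p (Fin.lt_def.2 ?_)
    have h1 := Fin.lt_def.1 hp
    have h2 : p.val ≠ i.val := fun e' => e (Fin.ext e')
    simp at h1 ⊢
    omega

theorem mul_simple_apply_of_gt {p : Fin n} (h : hi i < p) : (σ * simple i) p = σ p := by
  rw [Perm.mul_apply]
  congr 1
  exact swap_apply_of_ne_of_ne ((lo_lt_hi i).trans h).ne' h.ne'

theorem mul_simple_apply_of_lt {p : Fin n} (h : p < lo i) : (σ * simple i) p = σ p := by
  rw [Perm.mul_apply]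
  congr 1
  exact swap_apply_of_ne_of_ne h.ne (h.trans (lo_lt_hi i)).ne

theorem allowed_left_iff {c t : Fin n} (h : c.val < k) :
    Allowed k σ 0 c t ↔ σ c ≤ t ∧ ∀ p, c < p → p.val < k → σ c < σ p → t < σ p := by
  simp [Allowed, h]

theorem allowed_right_iff {c t : Fin n} (h : k ≤ c.val) :
    Allowed k σ 0 c t ↔ t ≤ σ c ∧ ∀ p, p < c → k ≤ p.val → σ p < σ c → σ p < t := by
  simp only [Allowed, not_lt.2 h, false_imp_iff, true_and, h, true_imp_iff]
  exact and_congr_right fun _ => forall_congr' fun p => by tauto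

/-- The entries allowed in positions `i` and `i + 1` before and after a descent is removed. -/
theorem allowed_descent_iff (hik : i.val + 1 ≠ k) (hd : σ (hi i) < σ (lo i)) (s t : Fin n) :
    (Allowed k (σ * simple i) 0 (lo i) s ∧ Allowed k (σ * simple i) 0 (hi i) t) ↔
      s < t ∧ Allowed k σ 0 (hi i) s ∧ Allowed k σ 0 (lo i) t ∧
        ¬ (Allowed k σ 0 (lo i) s ∧ Allowed k σ 0 (hi i) t) := by
  rcases lt_or_gt_of_ne hik with hk | hk
  · have kl : (lo i).val < k := by simp; omega
    have kh : (hi i).val < k := by simpa using hk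
    have a1 : ∀ t, Allowed k σ 0 (lo i) t ↔ σ (lo i) ≤ t ∧
        ∀ p, hi i < p → p.val < k → σ (lo i) < σ p → t < σ p := fun t => by
      rw [allowed_left_iff kl, forall_gt_lo_iff]
      simp [lt_asymm hd]
    have b1 : ∀ t, Allowed k σ 0 (hi i) t ↔ σ (hi i) ≤ t ∧
        ∀ p, hi i < p → p.val < k → σ (hi i) < σ p → t < σ p := fun t => allowed_left_iff kh
    have a2 : Allowed k (σ * simple i) 0 (lo i) s ↔ Allowed k σ 0 (hi i) s ∧ s < σ (lo i) := by
      rw [allowed_left_iff kl, forall_gt_lo_iff, b1]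
      have : (∀ p, hi i < p → p.val < k → (σ * simple i) (lo i) < (σ * simple i) p →
          s < (σ * simple i) p) ↔ ∀ p, hi i < p → p.val < k → σ (hi i) < σ p → s < σ p :=
        forall_congr' fun p => imp_congr_right fun hp => by
          rw [mul_simple_apply_of_gt hp, Perm.mul_apply, simple_lo]
      rw [this]
      simp only [Perm.mul_apply, simple_lo, simple_hi, kh, hd, true_imp_iff]
      tauto
    have b2 : Allowed k (σ * simple i) 0 (hi i) t ↔ Allowed k σ 0 (lo i) t := by
      rw [allowed_left_iff kh, a1, Perm.mul_apply, simple_hi]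
      exact and_congr_right fun _ => forall_congr' fun p => imp_congr_right fun hp => by
        rw [mul_simple_apply_of_gt hp]
    rw [a2, b2]
    constructor
    · rintro ⟨⟨h1, h2⟩, h3⟩
      exact ⟨h2.trans_le ((a1 t).1 h3).1, h1, h3, fun h4 => not_le.2 h2 ((a1 s).1 h4.1).1⟩
    · rintro ⟨h1, h2, h3, h4⟩
      refine ⟨⟨h2, ?_⟩, h3⟩
      -- Otherwise `s` at `lo i` and `t` at `hi i` would both be allowed for `σ`, which `h4`
      -- excludes.
      by_contra h5
      rw [not_lt] at h5
      rw [a1] at h3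
      rw [b1] at h2
      refine h4 ⟨(a1 s).2 ⟨h5, fun p p1 p2 p3 => h1.trans (h3.2 p p1 p2 p3)⟩,
        (b1 t).2 ⟨h2.1.trans h1.le, fun p p1 p2 p3 => ?_⟩⟩
      by_contra h6
      have h7 : ¬ σ (lo i) < σ p := fun h => h6 (h3.2 p p1 p2 h)
      exact absurd (h2.2 p p1 p2 p3) (not_lt.2 ((not_lt.1 h7).trans h5))
  · have kl : k ≤ (lo i).val := by simp; omega
    have kh : k ≤ (hi i).val := by simp; omega
    have a1 : ∀ t, Allowed k σ 0 (lo i) t ↔ t ≤ σ (lo i) ∧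
        ∀ p, p < lo i → k ≤ p.val → σ p < σ (lo i) → σ p < t := fun t => allowed_right_iff kl
    have b1 : ∀ t, Allowed k σ 0 (hi i) t ↔ t ≤ σ (hi i) ∧
        ∀ p, p < lo i → k ≤ p.val → σ p < σ (hi i) → σ p < t := fun t => by
      rw [allowed_right_iff kh, forall_lt_hi_iff]
      simp [lt_asymm hd]
    have a2 : Allowed k (σ * simple i) 0 (lo i) s ↔ Allowed k σ 0 (hi i) s := by
      rw [allowed_right_iff kl, b1, Perm.mul_apply, simple_lo]
      exact and_congr_right fun _ => forall_congr' fun p => imp_congr_right fun hp => by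
        rw [mul_simple_apply_of_lt hp]
    have b2 : Allowed k (σ * simple i) 0 (hi i) t ↔ Allowed k σ 0 (lo i) t ∧ σ (hi i) < t := by
      rw [allowed_right_iff kh, forall_lt_hi_iff, a1]
      have : (∀ p, p < lo i → k ≤ p.val → (σ * simple i) p < (σ * simple i) (hi i) →
          (σ * simple i) p < t) ↔ ∀ p, p < lo i → k ≤ p.val → σ p < σ (lo i) → σ p < t :=
        forall_congr' fun p => imp_congr_right fun hp => by
          rw [mul_simple_apply_of_lt hp, Perm.mul_apply, simple_hi]
      rw [this]
      simp only [Perm.mul_apply, simple_lo, simple_hi, kl, hd, true_imp_iff]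
      tauto
    rw [a2, b2]
    constructor
    · rintro ⟨h1, h2, h3⟩
      exact ⟨((b1 s).1 h1).1.trans_lt h3, h1, h2, fun h4 => not_le.2 h3 ((b1 t).1 h4.2).1⟩
    · rintro ⟨h1, h2, h3, h4⟩
      refine ⟨h2, h3, ?_⟩
      by_contra h5
      rw [not_lt] at h5
      rw [a1] at h3
      rw [b1] at h2
      refine h4 ⟨(a1 s).2 ⟨h1.le.trans h3.1, fun p p1 p2 p3 => ?_⟩,
        (b1 t).2 ⟨h5, fun p p1 p2 p3 => (h2.2 p p1 p2 p3).trans h1⟩⟩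
      by_contra h6
      have h7 : ¬ σ p < σ (hi i) := fun h => h6 (h2.2 p p1 p2 h)
      exact absurd (h3.2 p p1 p2 p3) (not_lt.2 (h5.trans (not_lt.1 h7)))

/-- At a descent of `σ` the bounds at `lo i` lie above those at `hi i`, so the larger entry fits at
`lo i` and the smaller at `hi i`. This gives the upward closure required by `piOp_signedSum`. -/
theorem allowed_exchange (hik : i.val + 1 ≠ k) (hd : σ (hi i) < σ (lo i)) {s t : Fin n}
    (hst : s < t) (h1 : Allowed k σ 0 (lo i) s) (h2 : Allowed k σ 0 (hi i) t) :
    Allowed k σ 0 (lo i) t ∧ Allowed k σ 0 (hi i) s := by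
  rcases lt_or_gt_of_ne hik with hk | hk
  · have kl : (lo i).val < k := by simp; omega
    have kh : (hi i).val < k := by simpa using hk
    rw [allowed_left_iff kl, forall_gt_lo_iff] at h1 ⊢
    rw [allowed_left_iff kh] at h2 ⊢
    exact ⟨⟨h1.1.trans hst.le, fun _ h => absurd h (lt_asymm hd),
      fun p p1 p2 p3 => h2.2 p p1 p2 (hd.trans p3)⟩,
      hd.le.trans h1.1, fun p p1 p2 p3 => hst.trans (h2.2 p p1 p2 p3)⟩
  · have kl : k ≤ (lo i).val := by simp; omega
    have kh : k ≤ (hi i).val := by simp; omega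
    rw [allowed_right_iff kl] at h1 ⊢
    rw [allowed_right_iff kh, forall_lt_hi_iff] at h2 ⊢
    exact ⟨⟨h2.1.trans hd.le, fun p p1 p2 p3 => (h1.2 p p1 p2 p3).trans hst⟩,
      hst.le.trans h2.1, fun _ h => absurd h (lt_asymm hd),
      fun p p1 p2 p3 => h1.2 p p1 p2 (p3.trans hd)⟩

theorem forall_position_iff {P : Fin n → Prop} :
    (∀ c, P c) ↔ (∀ c, c ≠ lo i → c ≠ hi i → P c) ∧ P (lo i) ∧ P (hi i) := by
  refine ⟨fun h => ⟨fun c _ _ => h c, h _, h _⟩, fun h c => ?_⟩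
  by_cases h1 : c = lo i
  · rw [h1]; exact h.2.1
  by_cases h2 : c = hi i
  · rw [h2]; exact h.2.2
  exact h.1 c h1 h2

theorem inPieri_mul_simple_right {ν : Perm (Fin n)} :
    InPieri k σ 0 (ν * simple i) ↔ (∀ c, c ≠ lo i → c ≠ hi i → Allowed k σ 0 c (ν c)) ∧
      Allowed k σ 0 (lo i) (ν (hi i)) ∧ Allowed k σ 0 (hi i) (ν (lo i)) := by
  rw [InPieri, forall_position_iff (i := i)]
  simp only [Perm.mul_apply, simple_lo, simple_hi]
  refine and_congr_left fun _ => forall_congr' fun c => imp_congr_right fun h1 =>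
    imp_congr_right fun h2 => ?_
  rw [simple_eq, swap_apply_of_ne_of_ne h1 h2]

theorem InPieri.mul_simple (hik : i.val + 1 ≠ k) (hd : σ (hi i) < σ (lo i)) {μ : Perm (Fin n)}
    (h : InPieri k σ 0 μ) (ha : μ (lo i) < μ (hi i)) : InPieri k σ 0 (μ * simple i) :=
  inPieri_mul_simple_right.2
    ⟨fun c _ _ => h c, allowed_exchange hik hd ha (h (lo i)) (h (hi i))⟩

/-- The right side is the remainder left by `piOp_signedSum`. Constraints at the other positions do
not notice the exchange, so only the pair `lo i`, `hi i` has to be examined. -/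
theorem inPieri_descent_iff (hik : i.val + 1 ≠ k) (hd : σ (hi i) < σ (lo i))
    {ν : Perm (Fin n)} : InPieri k (σ * simple i) 0 ν ↔
      ν (lo i) < ν (hi i) ∧ InPieri k σ 0 (ν * simple i) ∧ ¬ InPieri k σ 0 ν := by
  rw [inPieri_mul_simple_right, InPieri, InPieri,
    forall_position_iff (i := i) (P := fun c => Allowed k (σ * simple i) 0 c (ν c)),
    forall_position_iff (i := i) (P := fun c => Allowed k σ 0 c (ν c)),
    allowed_descent_iff hik hd]
  have : (∀ c, c ≠ lo i → c ≠ hi i → Allowed k (σ * simple i) 0 c (ν c)) ↔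
      ∀ c, c ≠ lo i → c ≠ hi i → Allowed k σ 0 c (ν c) :=
    forall_congr' fun c => imp_congr_right fun h1 => imp_congr_right fun h2 =>
      allowed_mul_simple_of_ne hik h1 h2 _
  rw [this]
  tauto

theorem piOp_signedSum_inPieri (hik : i.val + 1 ≠ k) (hd : σ (hi i) < σ (lo i)) :
    piOp i (signedSum (InPieri k σ 0) (len σ)) =
      signedSum (InPieri k (σ * simple i) 0) (len (σ * simple i)) := by
  rw [len_of_descent hd, piOp_signedSum fun μ h ha => h.mul_simple hik hd ha]
  exact signedSum_congr (fun ν => (inPieri_descent_iff hik hd).symm) _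

end Descent

/-- Induction along a reduced word of an element of `S_k × S_{n-k}`, starting from a permutation
that decreases on both blocks: every letter is a descent away from the boundary. -/
theorem BlockDecreasing.word_induction {k : ℕ} {ζ : Perm (Fin n)} (hζ : BlockDecreasing k ζ)
    {motive : List (Fin (n - 1)) → Perm (Fin n) → Prop} (nil : motive [] ζ)
    (step : ∀ l i σ, motive l σ → i.val + 1 ≠ k → σ (hi i) < σ (lo i) →
      motive (l ++ [i]) (σ * simple i)) (l : List (Fin (n - 1))) :
    ∀ u : Perm (Fin n), IsReducedWord l u → u ∈ youngSubgroup n k → motive l (ζ * u) := by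
  induction l using List.reverseRecOn with
  | nil =>
    intro u hu _
    have : u = 1 := hu.1.symm.trans (by simp [wordProd])
    rw [this, mul_one]
    exact nil
  | append_singleton l i ih =>
    intro u hu hk
    obtain ⟨hd, hl⟩ := hu.of_append_singleton
    -- An element of the Young subgroup has an ascent at the boundary, never a descent.
    have hik : i.val + 1 ≠ k := by
      intro e
      have h1 := (hk (lo i)).2 (by simp; omega)
      have h2 := (hk (hi i)).1.mt (by simp; omega)
      rw [Fin.lt_def] at hd
      omega
    have hu' := mul_mem hk (simple_mem_youngSubgroup (n := n) hik)
    have := step l i _ (ih _ hl hu') hik ?_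
    · rwa [mul_assoc, mul_simple_mul_simple] at this
    · simp only [Perm.mul_apply, simple_lo, simple_hi]
      refine hζ _ _ hd ?_
      have h1 := hk (lo i)
      have h2 := hk (hi i)
      simp only [lo_val, hi_val] at h1 h2
      omega

theorem BlockDecreasing.piPerm_signedSum {k : ℕ} {ζ u : Perm (Fin n)} (hζ : BlockDecreasing k ζ)
    (hu : u ∈ youngSubgroup n k) :
    piPerm u (signedSum (RkLE ζ) (len ζ)) =
      signedSum (InPieri k (ζ * u) 0) (len (ζ * u)) := by
  refine hζ.word_induction (motive := fun l σ => l.foldl (fun g i => piOp i g)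
    (signedSum (RkLE ζ) (len ζ)) = signedSum (InPieri k σ 0) (len σ)) ?_ ?_ _ u
    (Classical.choose_spec (exists_reducedWord u)) hu
  · exact signedSum_congr (fun μ => hζ.inPieri_iff.symm) _
  · intro l i σ h hik hd
    rw [List.foldl_append, h]
    exact piOp_signedSum_inPieri hik hd

/-! ### Divided differences in the variables `y` -/

/-- The automorphism exchanging `xᵢ` and `yᵢ` for all `i`. -/
noncomputable def swapXY : RatFun n ≃+* RatFun n :=
  IsFractionRing.ringEquivOfRingEquiv
    (MvPolynomial.renameEquiv ℤ (Equiv.sumComm (Fin n) (Fin n))).toRingEquiv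

theorem swapXY_ratX (i : Fin n) : swapXY (ratX i) = ratY i := by
  simp [swapXY, ratX, ratY]

theorem swapXY_ratY (i : Fin n) : swapXY (ratY i) = ratX i := by
  simp [swapXY, ratX, ratY]

theorem swapXY_swapXY (f : RatFun n) : swapXY (swapXY f) = f := by
  have : ((swapXY : RatFun n ≃+* RatFun n) : RatFun n →+* RatFun n).comp
      ((swapXY : RatFun n ≃+* RatFun n) : RatFun n →+* RatFun n) = RingHom.id _ :=
    ratFun_hom_ext (fun i => by simp [swapXY_ratX, swapXY_ratY])
      (fun i => by simp [swapXY_ratX, swapXY_ratY])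
  exact congrArg (fun φ : RatFun n →+* RatFun n => φ f) this

theorem swapXY_mem {f : RatFun n} (hf : f ∈ Laurent n) : swapXY f ∈ Laurent n := by
  induction hf using Algebra.adjoin_induction with
  | mem f hf =>
    rcases hf with ((⟨j, rfl⟩ | ⟨j, rfl⟩) | ⟨j, rfl⟩) | ⟨j, rfl⟩
    · rw [swapXY_ratX]; exact ratY_mem _
    · simp only [map_inv₀, swapXY_ratX]; exact ratY_inv_mem _
    · rw [swapXY_ratY]; exact ratX_mem _
    · simp only [map_inv₀, swapXY_ratY]; exact ratX_inv_mem _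
  | algebraMap r => simp
  | add f g _ _ hf hg => rw [map_add]; exact add_mem hf hg
  | mul f g _ _ hf hg => rw [map_mul]; exact mul_mem hf hg

/-- The action of a permutation on the variables `yᵢ`, the `xᵢ` being fixed. -/
noncomputable def permY (τ : Perm (Fin n)) : RatFun n →+* RatFun n :=
  ((swapXY : RatFun n ≃+* RatFun n) : RatFun n →+* RatFun n).comp
    ((permX τ : RatFun n →+* RatFun n).comp
      ((swapXY : RatFun n ≃+* RatFun n) : RatFun n →+* RatFun n))

theorem permY_apply (τ : Perm (Fin n)) (f : RatFun n) :
    permY τ f = swapXY (permX τ (swapXY f)) := rfl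

theorem permY_ratX (τ : Perm (Fin n)) (i : Fin n) : permY τ (ratX i) = ratX i := by
  rw [permY_apply, swapXY_ratX, permX_ratY, swapXY_ratY]

theorem permY_ratY (τ : Perm (Fin n)) (i : Fin n) : permY τ (ratY i) = ratY (τ i) := by
  rw [permY_apply, swapXY_ratY, permX_ratX, swapXY_ratX]

theorem permX_permY (σ τ : Perm (Fin n)) (f : RatFun n) :
    permX σ (permY τ f) = permY τ (permX σ f) := by
  have : (permX σ : RatFun n →+* RatFun n).comp (permY τ) =
      (permY τ).comp (permX σ : RatFun n →+* RatFun n) :=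
    ratFun_hom_ext (fun i => by simp [permX_ratX, permY_ratX])
      (fun i => by simp [permX_ratY, permY_ratY])
  exact congrArg (fun φ : RatFun n →+* RatFun n => φ f) this

theorem ratY_sub_ne_zero {i j : Fin n} (h : i ≠ j) : ratY i - ratY j ≠ 0 :=
  sub_ne_zero.2 fun e => h (ratY_injective e)

/-- The operator `f ↦ yⱼ (f - f sⱼ) / (yⱼ₊₁ - yⱼ)`, with `sⱼ` acting on the variables `y`. -/
noncomputable def hatPiY (j : Fin (n - 1)) (f : Laurent n) : Laurent n :=
  -(y (lo j) * ⟨swapXY (divDiff j ⟨swapXY f, swapXY_mem f.2⟩ : Laurent n),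
    swapXY_mem (divDiff j ⟨swapXY f, swapXY_mem f.2⟩ : Laurent n).2⟩)

/-- The operator `f ↦ (yⱼ₊₁ f - yⱼ (f sⱼ)) / (yⱼ₊₁ - yⱼ)`. -/
noncomputable def piY (j : Fin (n - 1)) (f : Laurent n) : Laurent n := hatPiY j f + f

theorem coe_hatPiY (j : Fin (n - 1)) (f : Laurent n) :
    (hatPiY j f : RatFun n) =
      -(ratY (lo j) * (((f : RatFun n) - permY (simple j) f) / (ratY (lo j) - ratY (hi j)))) := by
  change -(ratY (lo j) * swapXY ((swapXY (f : RatFun n) - permX (simple j) (swapXY (f : RatFun n))) /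
    (ratX (lo j) - ratX (hi j)))) = _
  rw [map_div₀, map_sub, map_sub, swapXY_swapXY, swapXY_ratX, swapXY_ratX, ← permY_apply]

theorem hatPiY_sub (j : Fin (n - 1)) (f g : Laurent n) :
    hatPiY j (f - g) = hatPiY j f - hatPiY j g := by
  apply Subtype.ext
  simp only [coe_hatPiY, Subalgebra.coe_sub, map_sub]
  ring

theorem hatPiY_add (j : Fin (n - 1)) (f g : Laurent n) :
    hatPiY j (f + g) = hatPiY j f + hatPiY j g := by
  apply Subtype.ext
  simp only [coe_hatPiY, Subalgebra.coe_add, map_add]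
  ring

theorem hatPiY_mul_of_fixed {j : Fin (n - 1)} {g : Laurent n}
    (hg : permY (simple j) (g : RatFun n) = g) (f : Laurent n) :
    hatPiY j (g * f) = g * hatPiY j f := by
  apply Subtype.ext
  simp only [coe_hatPiY, Subalgebra.coe_mul, map_mul, hg]
  ring

theorem piOp_add (i : Fin (n - 1)) (f g : Laurent n) : piOp i (f + g) = piOp i f + piOp i g := by
  apply Subtype.ext
  simp only [coe_piOp, Subalgebra.coe_add, map_add]
  ring

theorem piOp_hatPiY (i j : Fin (n - 1)) (f : Laurent n) :
    piOp i (hatPiY j f) = hatPiY j (piOp i f) := by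
  apply Subtype.ext
  simp only [coe_hatPiY, coe_piOp, map_neg, map_mul, map_div₀, map_sub, permX_ratY, permY_ratX,
    permX_permY]
  have h1 := ratX_sub_ne_zero (lo_ne_hi i)
  have h2 := ratY_sub_ne_zero (lo_ne_hi j)
  field_simp
  ring

theorem piOp_piY (i j : Fin (n - 1)) (f : Laurent n) :
    piOp i (piY j f) = piY j (piOp i f) := by
  rw [piY, piY, piOp_add, piOp_hatPiY]

theorem hatPiOp_hatPiY (i j : Fin (n - 1)) (f : Laurent n) :
    hatPiOp i (hatPiY j f) = hatPiY j (hatPiOp i f) := by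
  rw [hatPiOp_eq, hatPiOp_eq, piOp_hatPiY, hatPiY_sub]

/-- In the induction of `BlockDecreasing.mk_groth_mul` this identity changes one y-variable of the
monomial and at the same time replaces the operator π̂ by π. -/
theorem hatPiY_y_mul (j : Fin (n - 1)) (f : Laurent n) :
    hatPiY j (y (hi j) * f) = y (lo j) * piY j f := by
  apply Subtype.ext
  simp only [piY, coe_hatPiY, Subalgebra.coe_mul, Subalgebra.coe_add, map_mul, coe_y, permY_ratY,
    simple_hi]
  have h2 := ratY_sub_ne_zero (lo_ne_hi j)
  field_simp
  ring

/-! ### The staircase product -/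

theorem coe_grothOmega : (grothOmega n : RatFun n) =
    ∏ p : Fin n × Fin n with p.1.val + p.2.val + 1 < n, (1 - ratY p.2 * (ratX p.1)⁻¹) := by
  rw [grothOmega, ← Finset.prod_product', Finset.prod_filter]
  simp only [SubmonoidClass.coe_finsetProd, Finset.univ_product_univ]
  refine Finset.prod_congr rfl fun p _ => ?_
  split_ifs
  · simp [coe_y, coe_xInv]
  · simp

/-- The factors of the staircase product other than the corner in row `i`. -/
noncomputable def stairRest (i : Fin (n - 1)) : RatFun n :=
  ∏ p : Fin n × Fin n with p.1.val + p.2.val + 1 < n ∧ ¬ (p.1 = lo i ∧ p.2 = lo (Fin.rev i)),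
    (1 - ratY p.2 * (ratX p.1)⁻¹)

theorem coe_grothOmega_eq (i : Fin (n - 1)) : (grothOmega n : RatFun n) =
    (1 - ratY (lo (Fin.rev i)) * (ratX (lo i))⁻¹) * stairRest i := by
  have hmem : (lo i, lo (Fin.rev i)) ∈ Finset.univ.filter
      (fun p : Fin n × Fin n => p.1.val + p.2.val + 1 < n) := by
    simp [Fin.val_rev]; omega
  rw [coe_grothOmega, ← Finset.mul_prod_erase _ _ hmem, stairRest]
  congr 1
  refine Finset.prod_congr ?_ fun _ _ => rfl
  ext p
  simp [Prod.ext_iff, and_comm]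

/-- Deprived of its last box, row `i` is as long as row `i + 1`, so exchanging the two rows permutes
the factors. -/
theorem permX_stairRest (i : Fin (n - 1)) : permX (simple i) (stairRest i) = stairRest i := by
  rw [stairRest, map_prod]
  refine Finset.prod_nbij' (fun p => (simple i p.1, p.2)) (fun p => (simple i p.1, p.2))
    ?_ ?_ ?_ ?_ ?_
  · rintro ⟨a, b⟩ h
    simp only [Finset.mem_filter, Finset.mem_univ, true_and, simple_eq, swap_apply_def,
      Fin.ext_iff, lo_val, hi_val, Fin.val_rev] at h ⊢
    split_ifs <;> (try rw [lo_val]) <;> (try rw [hi_val]) <;> omega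
  · rintro ⟨a, b⟩ h
    simp only [Finset.mem_filter, Finset.mem_univ, true_and, simple_eq, swap_apply_def,
      Fin.ext_iff, lo_val, hi_val, Fin.val_rev] at h ⊢
    split_ifs <;> (try rw [lo_val]) <;> (try rw [hi_val]) <;> omega
  · intro p _; simp [simple_eq]
  · intro p _; simp [simple_eq]
  · intro p _
    simp [permX_ratX, permX_ratY]

theorem permY_stairRest (i : Fin (n - 1)) :
    permY (simple (Fin.rev i)) (stairRest i) = stairRest i := by
  rw [stairRest, map_prod]
  refine Finset.prod_nbij' (fun p => (p.1, simple (Fin.rev i) p.2))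
    (fun p => (p.1, simple (Fin.rev i) p.2)) ?_ ?_ ?_ ?_ ?_
  · rintro ⟨a, b⟩ h
    simp only [Finset.mem_filter, Finset.mem_univ, true_and, simple_eq, swap_apply_def,
      Fin.ext_iff, lo_val, hi_val, Fin.val_rev] at h ⊢
    split_ifs <;> (try rw [lo_val]) <;> (try rw [hi_val]) <;> (try rw [Fin.val_rev]) <;> omega
  · rintro ⟨a, b⟩ h
    simp only [Finset.mem_filter, Finset.mem_univ, true_and, simple_eq, swap_apply_def,
      Fin.ext_iff, lo_val, hi_val, Fin.val_rev] at h ⊢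
    split_ifs <;> (try rw [lo_val]) <;> (try rw [hi_val]) <;> (try rw [Fin.val_rev]) <;> omega
  · intro p _; simp [simple_eq]
  · intro p _; simp [simple_eq]
  · intro p _
    simp [permY_ratX, permY_ratY]

/-- Both operators send the corner factor 1 - y/x to 1 and leave the other factors alone. The index
is reversed because row `i` ends in column `Fin.rev i`. -/
theorem piOp_grothOmega (i : Fin (n - 1)) :
    piOp i (grothOmega n) = piY (Fin.rev i) (grothOmega n) := by
  apply Subtype.ext
  rw [piY, Subalgebra.coe_add, coe_piOp, coe_hatPiY, coe_grothOmega_eq i, map_mul, map_mul,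
    permX_stairRest, permY_stairRest]
  simp only [map_sub, map_one, map_mul, map_inv₀, permX_ratX, permX_ratY, permY_ratX, permY_ratY,
    simple_lo]
  have h1 := ratX_sub_ne_zero (lo_ne_hi i)
  have h2 := ratY_sub_ne_zero (lo_ne_hi (Fin.rev i))
  have h3 := ratX_ne_zero (lo i)
  have h4 := ratX_ne_zero (hi i)
  field_simp
  ring

theorem hatPiOp_grothOmega (i : Fin (n - 1)) :
    hatPiOp i (grothOmega n) = hatPiY (Fin.rev i) (grothOmega n) := by
  rw [hatPiOp_eq, piOp_grothOmega, piY, add_sub_cancel_right]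

theorem omega_lo (j : Fin (n - 1)) : omega n (lo (Fin.rev j)) = hi j := by
  apply Fin.ext
  simp [omega, Fin.val_rev]
  omega

theorem omega_hi (j : Fin (n - 1)) : omega n (hi (Fin.rev j)) = lo j := by
  apply Fin.ext
  simp [omega, Fin.val_rev]
  omega

theorem omega_mul_simple (j : Fin (n - 1)) :
    omega n * simple j = simple (Fin.rev j) * omega n := by
  have h1 := omega_lo j
  have h2 := omega_hi j
  have h3 : omega n (lo j) = hi (Fin.rev j) := by
    have := congrArg (omega n) h2
    rw [← Perm.mul_apply, omega_mul_omega] at this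
    exact this.symm
  have h4 : omega n (hi j) = lo (Fin.rev j) := by
    have := congrArg (omega n) h1
    rw [← Perm.mul_apply, omega_mul_omega] at this
    exact this.symm
  rw [simple_eq, mul_swap_eq_swap_mul, h3, h4, swap_comm]
  rfl

theorem omega_inv : (omega n)⁻¹ = omega n := inv_eq_of_mul_eq_one_left omega_mul_omega

/-- Prepending a letter to a reduced word of `ω σ`. -/
theorem exists_word_omega_simple_mul {σ : Perm (Fin n)} {j : Fin (n - 1)}
    (h : σ⁻¹ (hi j) < σ⁻¹ (lo j)) :
    ∃ l, IsReducedWord l (omega n * σ) ∧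
      IsReducedWord (Fin.rev j :: l) (omega n * (simple j * σ)) := by
  obtain ⟨l, hl⟩ := exists_reducedWord (omega n * σ)
  refine ⟨l, hl, ?_⟩
  rw [← mul_assoc, omega_mul_simple, mul_assoc]
  refine isReducedWord_cons hl ?_
  rw [mul_inv_rev, Perm.mul_apply, Perm.mul_apply, omega_inv, omega_lo, omega_hi]
  exact h

/-- The letter prepended to the word acts first, directly on G_ω, where it may be traded for an
operator in y; this one then commutes past all the others. -/
theorem groth_simple_mul {σ : Perm (Fin n)} {j : Fin (n - 1)} (h : σ⁻¹ (hi j) < σ⁻¹ (lo j)) :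
    groth (simple j * σ) = piY j (groth σ) := by
  obtain ⟨l, h1, h2⟩ := exists_word_omega_simple_mul h
  rw [groth, groth, piPerm_eq_foldl h1, piPerm_eq_foldl h2, List.foldl_cons, piOp_grothOmega,
    Fin.rev_rev]
  have : ∀ (l : List (Fin (n - 1))) (f : Laurent n), l.foldl (fun g i => piOp i g) (piY j f) =
      piY j (l.foldl (fun g i => piOp i g) f) := by
    intro l
    induction l with
    | nil => intro f; rfl
    | cons i l ih => intro f; rw [List.foldl_cons, List.foldl_cons, piOp_piY, ih]
  exact this l _

theorem signedSum_simple_mul {σ : Perm (Fin n)} {j : Fin (n - 1)}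
    (h : σ⁻¹ (hi j) < σ⁻¹ (lo j)) :
    signedSum (RkLE (simple j * σ)) (len (simple j * σ)) =
      hatPiY j (signedSum (RkLE σ) (len σ)) := by
  obtain ⟨l, h1, h2⟩ := exists_word_omega_simple_mul h
  have e1 := foldl_hatPiOp l _ h1
  have e2 := foldl_hatPiOp _ _ h2
  rw [← mul_assoc, omega_mul_omega, one_mul] at e1 e2
  rw [← e1, ← e2, List.foldl_cons, hatPiOp_grothOmega, Fin.rev_rev]
  have : ∀ (l : List (Fin (n - 1))) (f : Laurent n),
      l.foldl (fun g i => hatPiOp i g) (hatPiY j f) =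
      hatPiY j (l.foldl (fun g i => hatPiOp i g) f) := by
    intro l
    induction l with
    | nil => intro f; rfl
    | cons i l ih => intro f; rw [List.foldl_cons, List.foldl_cons, hatPiOp_hatPiY, ih]
  exact this l _

theorem signedSum_omega : signedSum (RkLE (omega n)) (len (omega n)) = grothOmega n := by
  have := foldl_hatPiOp (n := n) [] 1 ⟨by simp [wordProd], by simp [len_one]⟩
  rw [mul_one] at this
  exact this.symm

/-! ### Operators modulo the ideal -/

theorem permX_aeval_x (τ : Perm (Fin n)) (f : MvPolynomial (Fin n) ℤ) :
    permX τ ((MvPolynomial.aeval (x (n := n)) f : Laurent n) : RatFun n) =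
      (MvPolynomial.aeval (x (n := n)) (MvPolynomial.rename τ f) : Laurent n) := by
  induction f using MvPolynomial.induction_on with
  | C a => simp
  | add p q hp hq => simp only [map_add, Subalgebra.coe_add, hp, hq]
  | mul_X p i hp =>
    simp only [map_mul, Subalgebra.coe_mul, hp, MvPolynomial.aeval_X, MvPolynomial.rename_X,
      coe_x, permX_ratX]

theorem permX_aeval_y (τ : Perm (Fin n)) (f : MvPolynomial (Fin n) ℤ) :
    permX τ ((MvPolynomial.aeval (y (n := n)) f : Laurent n) : RatFun n) =
      (MvPolynomial.aeval (y (n := n)) f : Laurent n) := by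
  induction f using MvPolynomial.induction_on with
  | C a => simp
  | add p q hp hq => simp only [map_add, Subalgebra.coe_add, hp, hq]
  | mul_X p i hp =>
    simp only [map_mul, Subalgebra.coe_mul, hp, MvPolynomial.aeval_X, coe_y, permX_ratY]

theorem permY_aeval_x (τ : Perm (Fin n)) (f : MvPolynomial (Fin n) ℤ) :
    permY τ ((MvPolynomial.aeval (x (n := n)) f : Laurent n) : RatFun n) =
      (MvPolynomial.aeval (x (n := n)) f : Laurent n) := by
  induction f using MvPolynomial.induction_on with
  | C a => simp
  | add p q hp hq => simp only [map_add, Subalgebra.coe_add, hp, hq]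
  | mul_X p i hp =>
    simp only [map_mul, Subalgebra.coe_mul, hp, MvPolynomial.aeval_X, coe_x, permY_ratX]

theorem permY_aeval_y (τ : Perm (Fin n)) (f : MvPolynomial (Fin n) ℤ) :
    permY τ ((MvPolynomial.aeval (y (n := n)) f : Laurent n) : RatFun n) =
      (MvPolynomial.aeval (y (n := n)) (MvPolynomial.rename τ f) : Laurent n) := by
  induction f using MvPolynomial.induction_on with
  | C a => simp
  | add p q hp hq => simp only [map_add, Subalgebra.coe_add, hp, hq]
  | mul_X p i hp =>
    simp only [map_mul, Subalgebra.coe_mul, hp, MvPolynomial.aeval_X, MvPolynomial.rename_X,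
      coe_y, permY_ratY]

theorem generator_fixed {f : MvPolynomial (Fin n) ℤ} (hf : f.IsSymmetric) (τ : Perm (Fin n)) :
    (permX τ ((MvPolynomial.aeval (x (n := n)) f - MvPolynomial.aeval (y (n := n)) f :
        Laurent n) : RatFun n) =
      (MvPolynomial.aeval (x (n := n)) f - MvPolynomial.aeval (y (n := n)) f : Laurent n)) ∧
    (permY τ ((MvPolynomial.aeval (x (n := n)) f - MvPolynomial.aeval (y (n := n)) f :
        Laurent n) : RatFun n) =
      (MvPolynomial.aeval (x (n := n)) f - MvPolynomial.aeval (y (n := n)) f : Laurent n)) := by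
  rw [Subalgebra.coe_sub, map_sub, map_sub, permX_aeval_x, permX_aeval_y, permY_aeval_x,
    permY_aeval_y, hf τ]
  exact ⟨rfl, rfl⟩

/-- An additive operator that is linear over the generators preserves the ideal. -/
theorem map_mem_symIdeal {op : Laurent n → Laurent n}
    (hadd : ∀ f g, op (f + g) = op f + op g)
    (hmul : ∀ f : MvPolynomial (Fin n) ℤ, f.IsSymmetric → ∀ h,
      op ((MvPolynomial.aeval (x (n := n)) f - MvPolynomial.aeval (y (n := n)) f) * h) =
        (MvPolynomial.aeval (x (n := n)) f - MvPolynomial.aeval (y (n := n)) f) * op h)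
    {f : Laurent n} (hf : f ∈ symIdeal n) : op f ∈ symIdeal n := by
  -- The operator is not linear over the whole ring, so the multiplier `a` has to be carried through
  -- the induction on the span.
  have key : ∀ a, op (a * f) ∈ symIdeal n := by
    induction hf using Submodule.span_induction with
    | mem g hg =>
      obtain ⟨p, hp, rfl⟩ := hg
      intro a
      rw [mul_comm, hmul p hp]
      exact Ideal.mul_mem_right _ _ (Ideal.subset_span ⟨p, hp, rfl⟩)
    | zero =>
      intro a
      have := hadd 0 0
      rw [add_zero, left_eq_add] at this
      rw [mul_zero, this]
      exact zero_mem _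
    | add g h _ _ hg hh =>
      intro a
      rw [mul_add, hadd]
      exact add_mem (hg a) (hh a)
    | smul b g _ hg =>
      intro a
      rw [smul_eq_mul, ← mul_assoc]
      exact hg _
  simpa using key 1

theorem mk_piOp {i : Fin (n - 1)} {f g : Laurent n}
    (h : Ideal.Quotient.mk (symIdeal n) f = Ideal.Quotient.mk (symIdeal n) g) :
    Ideal.Quotient.mk (symIdeal n) (piOp i f) = Ideal.Quotient.mk (symIdeal n) (piOp i g) := by
  rw [Ideal.Quotient.eq] at h ⊢
  rw [← piOp_sub]
  exact map_mem_symIdeal (piOp_add i)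
    (fun p hp h => piOp_mul_of_fixed (generator_fixed hp _).1 h) h

theorem mk_hatPiY {j : Fin (n - 1)} {f g : Laurent n}
    (h : Ideal.Quotient.mk (symIdeal n) f = Ideal.Quotient.mk (symIdeal n) g) :
    Ideal.Quotient.mk (symIdeal n) (hatPiY j f) =
      Ideal.Quotient.mk (symIdeal n) (hatPiY j g) := by
  rw [Ideal.Quotient.eq] at h ⊢
  rw [← hatPiY_sub]
  exact map_mem_symIdeal (hatPiY_add j)
    (fun p hp h => hatPiY_mul_of_fixed (generator_fixed hp _).2 h) h

/-! ### The staircase product modulo the ideal -/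

section Staircase

open Polynomial

/-- The first `m` rows of the staircase product. -/
def stair {R : Type*} [CommRing R] (n : ℕ) (X' Y' : ℕ → R) (m : ℕ) : R :=
  ∏ a ∈ Finset.range m, ∏ b ∈ Finset.range (n - 1 - a), (X' a - Y' b)

variable {R : Type*} [CommRing R] {X' Y' : ℕ → R}

theorem stair_succ (n m : ℕ) :
    stair n X' Y' (m + 1) = stair n X' Y' m * ∏ b ∈ Finset.range (n - 1 - m), (X' m - Y' b) :=
  Finset.prod_range_succ _ _

/-- Evaluation at the root `X' m` kills the first product, and the second becomes row `m` of the
staircase times one extra factor. -/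
theorem stair_mul_eval {n m : ℕ} (hm : m < n)
    (h : C (stair n X' Y' m) * (∏ j ∈ Finset.Ico m n, (X - C (X' j)) -
      ∏ b ∈ Finset.range (n - m), (X - C (Y' b))) = 0) :
    stair n X' Y' (m + 1) * (X' m - Y' (n - 1 - m)) = 0 := by
  have h1 := congrArg (eval (X' m)) h
  have h2 : ∏ j ∈ Finset.Ico m n, (X' m - X' j) = 0 :=
    Finset.prod_eq_zero (Finset.mem_Ico.2 ⟨le_rfl, hm⟩) (sub_self _)
  have h3 : n - m = n - 1 - m + 1 := by omega
  simp only [eval_mul, eval_sub, eval_C, eval_prod, eval_X, eval_zero, h2, zero_sub] at h1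
  rw [h3, Finset.prod_range_succ, mul_neg, neg_eq_zero, ← mul_assoc] at h1
  rw [stair_succ]
  exact h1

/-- One root is removed from each side at every step: after multiplication by row `m`,
`stair_mul_eval` allows `X' m` to replace the last root among the `Y'`, and the common factor `X - C
(X' m)` cancels because it is monic, even if `R` has zero divisors. -/
theorem stair_mul_prod {n : ℕ}
    (h : ∏ j ∈ Finset.range n, (X - C (X' j)) = ∏ j ∈ Finset.range n, (X - C (Y' j))) :
    ∀ m, m ≤ n → C (stair n X' Y' m) * (∏ j ∈ Finset.Ico m n, (X - C (X' j)) -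
      ∏ b ∈ Finset.range (n - m), (X - C (Y' b))) = 0 := by
  intro m
  induction m with
  | zero =>
    intro _
    rw [Nat.sub_zero, ← Finset.range_eq_Ico, h, sub_self, mul_zero]
  | succ m ih =>
    intro hm
    have h1 := ih (by omega)
    have h2 := congrArg C (stair_mul_eval hm h1)
    rw [← (monic_X_sub_C (X' m)).mul_right_eq_zero_iff]
    have h3 : n - m = n - 1 - m + 1 := by omega
    have h4 : n - (m + 1) = n - 1 - m := by omega
    rw [h3, Finset.prod_range_succ, Finset.prod_eq_prod_Ico_succ_bot hm] at h1
    rw [h4]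
    rw [C_mul, C_sub, C_0] at h2
    rw [stair_succ, C_mul] at h2 ⊢
    linear_combination (C (∏ b ∈ Finset.range (n - 1 - m), (X' m - Y' b))) * h1 +
      (∏ b ∈ Finset.range (n - 1 - m), (X - C (Y' b))) * h2

theorem stair_dvd {n m m' : ℕ} (h : m ≤ m') : stair n X' Y' m ∣ stair n X' Y' m' :=
  Finset.prod_dvd_prod_of_subset _ _ _ (by simpa using h)

theorem stair_mul_sub {n : ℕ}
    (h : ∏ j ∈ Finset.range n, (X - C (X' j)) = ∏ j ∈ Finset.range n, (X - C (Y' j)))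
    {m : ℕ} (hm : m < n) : stair n X' Y' n * (X' m - Y' (n - 1 - m)) = 0 := by
  obtain ⟨c, hc⟩ := stair_dvd (n := n) (X' := X') (Y' := Y') (Nat.succ_le_of_lt hm)
  rw [hc, mul_right_comm, stair_mul_eval hm (stair_mul_prod h m hm.le), zero_mul]

/-- Two specializations that agree on symmetric polynomials give the roots of one polynomial. -/
theorem prod_X_sub_eq {φ ψ : MvPolynomial (Fin n) ℤ →+* R}
    (h : ∀ f : MvPolynomial (Fin n) ℤ, f.IsSymmetric → φ f = ψ f) :
    ∏ i : Fin n, (X - C (φ (MvPolynomial.X i))) = ∏ i : Fin n, (X - C (ψ (MvPolynomial.X i))) := by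
  set F : (MvPolynomial (Fin n) ℤ)[X] := ∏ i : Fin n, (X - C (MvPolynomial.X i)) with hF
  have hsym : ∀ d, (F.coeff d).IsSymmetric := by
    intro d τ
    have h1 : F.map (MvPolynomial.rename τ : MvPolynomial (Fin n) ℤ →ₐ[ℤ] _).toRingHom = F := by
      rw [hF, Polynomial.map_prod]
      refine Eq.trans ?_ (Equiv.prod_comp τ fun i => (X - C (MvPolynomial.X i) :
        (MvPolynomial (Fin n) ℤ)[X]))
      exact Finset.prod_congr rfl fun i _ => by simp
    have h2 := congrArg (fun G => Polynomial.coeff G d) h1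
    simpa [Polynomial.coeff_map] using h2
  have hmap : ∀ χ : MvPolynomial (Fin n) ℤ →+* R,
      ∏ i : Fin n, (X - C (χ (MvPolynomial.X i))) = F.map χ := by
    intro χ
    simp [hF, Polynomial.map_prod]
  rw [hmap, hmap]
  ext d
  rw [Polynomial.coeff_map, Polynomial.coeff_map]
  exact h _ (hsym d)

theorem staircase_mul {φ ψ : MvPolynomial (Fin n) ℤ →+* R}
    (h : ∀ f : MvPolynomial (Fin n) ℤ, f.IsSymmetric → φ f = ψ f) {u : Fin n → R}
    (hu : ∀ i, φ (MvPolynomial.X i) * u i = 1) (a : Fin n) :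
    (∏ i : Fin n, ∏ j : Fin n, if i.val + j.val + 1 < n then 1 - ψ (MvPolynomial.X j) * u i
        else 1) * (ψ (MvPolynomial.X (omega n a)) * u a) =
      ∏ i : Fin n, ∏ j : Fin n, if i.val + j.val + 1 < n then 1 - ψ (MvPolynomial.X j) * u i
        else 1 := by
  let X' : ℕ → R := fun i => if h : i < n then φ (MvPolynomial.X ⟨i, h⟩) else 0
  let Y' : ℕ → R := fun i => if h : i < n then ψ (MvPolynomial.X ⟨i, h⟩) else 0
  have hX : ∀ i : Fin n, X' i = φ (MvPolynomial.X i) := fun i => by simp [X']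
  have hY : ∀ i : Fin n, Y' i = ψ (MvPolynomial.X i) := fun i => by simp [Y']
  have h1 : ∏ j ∈ Finset.range n, (X - C (X' j)) = ∏ j ∈ Finset.range n, (X - C (Y' j)) := by
    rw [Finset.prod_range, Finset.prod_range]
    simpa only [hX, hY] using prod_X_sub_eq h
  have h2 := stair_mul_sub h1 a.isLt
  have hω : n - 1 - a.val = (omega n a).val := by simp [omega]; omega
  rw [hω, hX, hY] at h2
  set G := ∏ i : Fin n, ∏ j : Fin n, if i.val + j.val + 1 < n then
    1 - ψ (MvPolynomial.X j) * u i else 1 with hG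
  have h3 : G = stair n X' Y' n *
      ∏ i : Fin n, ∏ j : Fin n, if i.val + j.val + 1 < n then u i else 1 := by
    rw [hG, stair, Finset.prod_range, ← Finset.prod_mul_distrib]
    refine Finset.prod_congr rfl fun i _ => ?_
    have h4 : ∏ b ∈ Finset.range (n - 1 - i.val), (X' i - Y' b) =
        ∏ j : Fin n, if i.val + j.val + 1 < n then X' i - Y' j else 1 := by
      rw [← Finset.prod_range (fun j => if i.val + j + 1 < n then X' i - Y' j else 1),
        ← Finset.prod_filter]
      refine Finset.prod_congr ?_ fun _ _ => rfl
      ext b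
      simp only [Finset.mem_range, Finset.mem_filter]
      omega
    rw [h4, ← Finset.prod_mul_distrib]
    refine Finset.prod_congr rfl fun j _ => ?_
    split_ifs
    · rw [hX, hY, sub_mul, hu]
    · simp
  have h5 : G * (φ (MvPolynomial.X a) - ψ (MvPolynomial.X (omega n a))) = 0 := by
    rw [h3, mul_right_comm, h2, zero_mul]
  linear_combination (-u a) * h5 + G * hu a

theorem mk_staircase_mul {A : Type*} [CommRing A] [Algebra ℤ A] {J : Ideal A} {v w u : Fin n → A}
    (h : ∀ f : MvPolynomial (Fin n) ℤ, f.IsSymmetric →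
      MvPolynomial.aeval v f - MvPolynomial.aeval w f ∈ J)
    (hu : ∀ i, v i * u i = 1) (a : Fin n) :
    Ideal.Quotient.mk J ((∏ i : Fin n, ∏ j : Fin n, if i.val + j.val + 1 < n then
        1 - w j * u i else 1) * (w (omega n a) * u a)) =
      Ideal.Quotient.mk J (∏ i : Fin n, ∏ j : Fin n, if i.val + j.val + 1 < n then
        1 - w j * u i else 1) := by
  have key := staircase_mul
    (φ := (Ideal.Quotient.mk J).comp (MvPolynomial.aeval v : _ →ₐ[ℤ] A).toRingHom)
    (ψ := (Ideal.Quotient.mk J).comp (MvPolynomial.aeval w : _ →ₐ[ℤ] A).toRingHom)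
    (fun f hf => Ideal.Quotient.eq.2 (h f hf))
    (u := fun i => Ideal.Quotient.mk J (u i))
    (fun i => by simp [← map_mul, hu]) a
  have hG : Ideal.Quotient.mk J (∏ i : Fin n, ∏ j : Fin n, if i.val + j.val + 1 < n then
      1 - w j * u i else 1) = ∏ i : Fin n, ∏ j : Fin n, if i.val + j.val + 1 < n then
        1 - Ideal.Quotient.mk J (w j) * Ideal.Quotient.mk J (u i) else 1 := by
    simp only [map_prod]
    refine Finset.prod_congr rfl fun i _ => Finset.prod_congr rfl fun j _ => ?_
    split_ifs <;> simp
  rw [map_mul, map_mul, hG]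
  simpa using key

end Staircase

theorem x_mul_xInv (i : Fin n) : (x i * xInv i : Laurent n) = 1 :=
  Subtype.ext (mul_inv_cancel₀ (ratX_ne_zero i))

theorem mk_grothOmega_mul (a : Fin n) :
    Ideal.Quotient.mk (symIdeal n) (grothOmega n * (y (omega n a) * xInv a)) =
      Ideal.Quotient.mk (symIdeal n) (grothOmega n) := by
  have h : ∀ f : MvPolynomial (Fin n) ℤ, f.IsSymmetric →
      MvPolynomial.aeval (x (n := n)) f - MvPolynomial.aeval (y (n := n)) f ∈ symIdeal n := by
    intro f hf
    rw [symIdeal]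
    exact Ideal.subset_span ⟨f, hf, rfl⟩
  rw [grothOmega]
  exact mk_staircase_mul (J := symIdeal n) (v := x) (w := y) (u := xInv) h x_mul_xInv a

/-! ### The congruence -/

/-- The monomial `y_{σ₁} ⋯ y_{σ_k} / (x₁ ⋯ x_k)`. -/
noncomputable def ratioMonomial (k : ℕ) (σ : Perm (Fin n)) : Laurent n :=
  ∏ i : Fin n, if i.val < k then y (σ i) * xInv i else 1

theorem mk_omega_ratioMonomial (k : ℕ) :
    Ideal.Quotient.mk (symIdeal n) (grothOmega n * ratioMonomial k (omega n)) =
      Ideal.Quotient.mk (symIdeal n) (grothOmega n) := by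
  have key : ∀ s : Finset (Fin n), Ideal.Quotient.mk (symIdeal n) (grothOmega n *
      ∏ i ∈ s, if i.val < k then y (omega n i) * xInv i else 1) =
      Ideal.Quotient.mk (symIdeal n) (grothOmega n) := by
    classical
    intro s
    induction s using Finset.induction_on with
    | empty => simp
    | insert a s ha ih =>
      have hc : Ideal.Quotient.mk (symIdeal n) (grothOmega n *
          if a.val < k then y (omega n a) * xInv a else 1) =
          Ideal.Quotient.mk (symIdeal n) (grothOmega n) := by
        split_ifs
        · exact mk_grothOmega_mul a
        · rw [mul_one]
      rw [Finset.prod_insert ha, ← mul_assoc, map_mul, hc, ← map_mul, ih]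
  exact key Finset.univ

/-- Exchanging two consecutive values affects only their own relative order, and the two occupy
different blocks since the smaller stands first. -/
theorem BlockDecreasing.simple_mul {k : ℕ} {ζ : Perm (Fin n)} (h : BlockDecreasing k ζ)
    {j : Fin (n - 1)} (hj : ζ⁻¹ (lo j) < ζ⁻¹ (hi j)) : BlockDecreasing k (simple j * ζ) := by
  intro c d hcd hk
  have h1 := h c d hcd hk
  have h2 : ¬ (ζ d = lo j ∧ ζ c = hi j) := by
    rintro ⟨e1, e2⟩
    rw [← e1, ← e2, Perm.inv_def, symm_apply_apply, symm_apply_apply] at hj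
    exact lt_asymm hcd hj
  simp only [Perm.mul_apply, simple_eq, swap_apply_def]
  simp only [Fin.ext_iff, Fin.lt_def, lo_val, hi_val] at h1 h2 ⊢
  split_ifs <;> (try rw [lo_val]) <;> (try rw [hi_val]) <;> omega

theorem eq_omega_of_descents {w : Perm (Fin n)} (h : ∀ j, w (hi j) < w (lo j)) : w = omega n := by
  have h1 : omega n * w = 1 := eq_one_of_no_descent fun i => by
    simpa [omega_apply_lt] using h i
  rw [← omega_inv, eq_inv_of_mul_eq_one_right h1]

theorem len_simple_mul {ζ : Perm (Fin n)} {j : Fin (n - 1)} (hj : ζ⁻¹ (lo j) < ζ⁻¹ (hi j)) :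
    len (simple j * ζ) = len ζ + 1 := by
  have h := len_mul_simple (w := ζ⁻¹) hj
  rwa [← len_inv, mul_inv_rev, inv_inv, simple_eq, swap_inv, ← simple_eq, len_inv] at h

theorem len_le_sq (w : Perm (Fin n)) : len w ≤ n * n := by
  rw [len_eq_card_inversions]
  exact (Finset.card_le_univ _).trans (by simp)

theorem ratioMonomial_split {k : ℕ} {a : Fin n} (ha : a.val < k) (ζ : Perm (Fin n)) :
    ratioMonomial k ζ = y (ζ a) *
      ∏ i : Fin n, if i.val < k then (if i = a then 1 else y (ζ i)) * xInv i else 1 := by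
  classical
  have h : y (ζ a) = ∏ i : Fin n, if i = a then y (ζ i) else 1 := by
    rw [Finset.prod_ite_eq' Finset.univ a, if_pos (Finset.mem_univ _)]
  conv_rhs => rw [h]
  rw [ratioMonomial, ← Finset.prod_mul_distrib]
  refine Finset.prod_congr rfl fun i _ => ?_
  by_cases hi : i = a
  · subst hi; simp [ha]
  · simp [hi]

/-- The congruence for a permutation that decreases on both blocks, by induction on its colength. -/
theorem BlockDecreasing.mk_groth_mul {k : ℕ} {ζ : Perm (Fin n)} (hζ : BlockDecreasing k ζ) :
    Ideal.Quotient.mk (symIdeal n) (groth ζ * ratioMonomial k ζ) =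
      Ideal.Quotient.mk (symIdeal n) (signedSum (RkLE ζ) (len ζ)) := by
  induction hm : n * n - len ζ using Nat.strong_induction_on generalizing ζ with
  | _ m ih =>
  by_cases hall : ∀ j, ζ⁻¹ (hi j) < ζ⁻¹ (lo j)
  · have hω : ζ = omega n := by
      rw [← inv_inv ζ, eq_omega_of_descents hall, omega_inv]
    rw [hω, groth_omega, mk_omega_ratioMonomial, signedSum_omega]
  · push Not at hall
    obtain ⟨j, hj⟩ := hall
    have hj : ζ⁻¹ (lo j) < ζ⁻¹ (hi j) :=
      lt_of_le_of_ne hj fun h => lo_ne_hi j (ζ⁻¹.injective h)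
    set a := ζ⁻¹ (lo j) with ha
    set b := ζ⁻¹ (hi j) with hb
    have hζa : ζ a = lo j := ζ.apply_symm_apply _
    have hζb : ζ b = hi j := ζ.apply_symm_apply _
    -- Two values in increasing order cannot share a block of `ζ`.
    have hab : a.val < k ∧ k ≤ b.val := by
      by_contra hcon
      have := hζ a b hj (by omega)
      rw [hζa, hζb] at this
      exact lt_asymm this (lo_lt_hi j)
    set η := simple j * ζ with hη
    have hηa : η a = hi j := by rw [hη, Perm.mul_apply, hζa, simple_lo]
    have hηb : η b = lo j := by rw [hη, Perm.mul_apply, hζb, simple_hi]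
    have hζη : simple j * η = ζ := by
      rw [hη, ← mul_assoc, simple_eq, swap_mul_self, one_mul]
    have hd : η⁻¹ (hi j) < η⁻¹ (lo j) := by
      rw [← hηa, ← hηb]
      simpa using hj
    have hlen : len η = len ζ + 1 := len_simple_mul hj
    have hle := len_le_sq η
    have ih' := mk_hatPiY (j := j) (ih (n * n - len η) (by omega) (ζ := η) (hζ.simple_mul hj) rfl)
    rw [← signedSum_simple_mul hd, hζη] at ih'
    rw [← ih']
    congr 1
    have hZ : (∏ i : Fin n, if i.val < k then (if i = a then 1 else y (η i)) * xInv i else 1) =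
        ∏ i : Fin n, if i.val < k then (if i = a then 1 else y (ζ i)) * xInv i else 1 := by
      refine Finset.prod_congr rfl fun i _ => ?_
      split_ifs with h1 h2
      · rfl
      · have h3 : i ≠ b := by rintro rfl; omega
        rw [hη, Perm.mul_apply, simple_apply_of_ne]
        · exact fun h => h2 (ζ.injective ((Fin.ext h : ζ i = lo j).trans hζa.symm))
        · exact fun h => h3 (ζ.injective ((Fin.ext h : ζ i = hi j).trans hζb.symm))
      · rfl
    rw [ratioMonomial_split hab.1 η, ratioMonomial_split hab.1 ζ, hZ, hηa, hζa]
    set Z := ∏ i : Fin n, if i.val < k then (if i = a then 1 else y (ζ i)) * xInv i else 1 with hZd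
    -- Neither of the two exchanged y-variables occurs in `Z`: the one at `a` has been taken out,
    -- and the other stands at `b`, beyond the first block.
    have hfix : permY (simple j) (Z : RatFun n) = Z := by
      conv_rhs => rw [← hZ]
      simp only [hZd, SubmonoidClass.coe_finsetProd, map_prod]
      refine Finset.prod_congr rfl fun i _ => ?_
      split_ifs <;> simp [coe_y, coe_xInv, permY_ratX, permY_ratY, hη]
    rw [show groth η * (y (hi j) * Z) = Z * (y (hi j) * groth η) by ring,
      hatPiY_mul_of_fixed hfix, hatPiY_y_mul, ← groth_simple_mul hd, hζη]
    ring

theorem ratioMonomial_mul_simple {k : ℕ} {i : Fin (n - 1)} (hik : i.val + 1 ≠ k)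
    (σ : Perm (Fin n)) : ratioMonomial k (σ * simple i) = ratioMonomial k σ := by
  have hy := simple_mem_youngSubgroup (n := n) hik
  have split : ∀ τ : Perm (Fin n), ratioMonomial k τ =
      (∏ c : Fin n, if c.val < k then y (τ c) else 1) *
        ∏ c : Fin n, if c.val < k then xInv c else 1 := by
    intro τ
    rw [ratioMonomial, ← Finset.prod_mul_distrib]
    refine Finset.prod_congr rfl fun c _ => ?_
    split_ifs <;> simp
  rw [split, split]
  congr 1
  rw [← Equiv.prod_comp (simple i) fun c => if c.val < k then y (σ c) else 1]
  refine Finset.prod_congr rfl fun c _ => ?_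
  simp only [hy c, Perm.mul_apply]

theorem permX_ratioMonomial {k : ℕ} {i : Fin (n - 1)} (hik : i.val + 1 ≠ k)
    (σ : Perm (Fin n)) :
    permX (simple i) (ratioMonomial k σ : RatFun n) = ratioMonomial k σ := by
  have hy := simple_mem_youngSubgroup (n := n) hik
  conv_rhs => rw [← ratioMonomial_mul_simple hik σ]
  simp only [ratioMonomial, SubmonoidClass.coe_finsetProd, map_prod]
  rw [← Equiv.prod_comp (simple i)]
  refine Finset.prod_congr rfl fun c _ => ?_
  simp only [hy c, Perm.mul_apply]
  split_ifs
  · have : simple i (simple i c) = c := swap_apply_self _ _ _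
    simp [coe_y, coe_xInv, permX_ratX, permX_ratY, this]
  · simp

/-- For a letter away from the boundary the monomial is a constant for πᵢ and is the same for σ and
σsᵢ, so πᵢ acts on the Grothendieck factor alone. -/
theorem BlockDecreasing.mk_piPerm {k : ℕ} {ζ u : Perm (Fin n)} (hζ : BlockDecreasing k ζ)
    (hu : u ∈ youngSubgroup n k) :
    Ideal.Quotient.mk (symIdeal n) (groth (ζ * u) * ratioMonomial k (ζ * u)) =
      Ideal.Quotient.mk (symIdeal n) (piPerm u (signedSum (RkLE ζ) (len ζ))) := by
  refine hζ.word_induction (motive := fun l σ => Ideal.Quotient.mk (symIdeal n)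
    (groth σ * ratioMonomial k σ) = Ideal.Quotient.mk (symIdeal n)
      (l.foldl (fun g i => piOp i g) (signedSum (RkLE ζ) (len ζ)))) ?_ ?_ _ u
    (Classical.choose_spec (exists_reducedWord u)) hu
  · exact hζ.mk_groth_mul
  · intro l i σ h hik hd
    rw [List.foldl_append, List.foldl_cons, List.foldl_nil, ← mk_piOp h, mul_comm (groth σ),
      piOp_mul_of_fixed (permX_ratioMonomial hik σ), piOp_groth_of_descent hd,
      ratioMonomial_mul_simple hik, mul_comm]

end GrothPieri

/-! ### Assembly of the congruence and the expansion -/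

theorem mainTheorem1 (n k : ℕ) (hk : 1 ≤ k) (hkn : k < n) (σ : Equiv.Perm (Fin n)) :
    ∃ ζ : Equiv.Perm (Fin n), IsCosetMax k σ ζ ∧
      Ideal.Quotient.mk (symIdeal n)
          (groth σ * ∏ i : Fin n, if i.val < k then y (σ i) * xInv i else 1) =
        Ideal.Quotient.mk (symIdeal n)
          (piPerm (ζ⁻¹ * σ) (hatPiPerm (omega n * ζ) (groth (omega n)))) ∧
      BruhatLE σ (eta k σ) ∧
      piPerm (ζ⁻¹ * σ) (hatPiPerm (omega n * ζ) (groth (omega n))) =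
        ∑ μ ∈ bruhatInterval σ (eta k σ), (-1) ^ (len μ - len σ) * groth μ := by
  obtain ⟨τ, hτ, hdec⟩ := exists_blockDecreasing k σ
  have hu : (σ * τ)⁻¹ * σ ∈ youngSubgroup n k := by
    rw [mul_inv_rev, inv_mul_cancel_right]
    exact inv_mem hτ
  have hmul : σ * τ * ((σ * τ)⁻¹ * σ) = σ := mul_inv_cancel_left _ _
  have hhat : hatPiPerm (omega n * (σ * τ)) (groth (omega n)) =
      signedSum (RkLE (σ * τ)) (len (σ * τ)) := by
    rw [groth_omega, hatPiPerm_grothOmega, ← mul_assoc (omega n), omega_mul_omega, one_mul]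
  refine ⟨σ * τ, hdec.isCosetMax hτ, ?_, (inPieri_eta k σ).rkLE.bruhatLE, ?_⟩
  · have := hdec.mk_piPerm hu
    rw [hmul] at this
    rw [hhat]
    exact this
  · rw [hhat, hdec.piPerm_signedSum hu, hmul, signedSum]
    have hset : permSet (InPieri k σ 0) = bruhatInterval σ (eta k σ) := by
      ext μ
      rw [mem_permSet, mem_bruhatInterval_eta]
    rw [hset]
    refine Finset.sum_congr rfl fun μ hμ => ?_
    -- On the interval the truncated difference of lengths is a true one, so the two exponents
    -- differ by the even number `2 * len σ`.
    have hle := (mem_bruhatInterval_eta.1 hμ).rkLE.len_le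
    congr 1
    rw [show len μ + len σ = len μ - len σ + 2 * len σ by omega, pow_add, pow_mul,
      show (-1 : Laurent n) ^ 2 = 1 from Subtype.ext (by norm_num), one_pow, mul_one]
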